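/- **Theorem 4.2.** Let $d\ge 2$. *Setting.* For a tuple $J=(j_1,\dots,j_{d-1})$ of positive integers put $p_l=j_1+\dots+j_{l-1}$ and $k_l=p_l-\frac1d\sum_i p_i$ ($1\le l\le d$), so that $k_1<\dots<k_d$ and $\sum_l k_l=0$. For tuples $I,J$ of positive integers the generalized pentagram map $T_{I,J}$ sends a polygon $(v_k)_{k\in\mathbb Z}$ in $\mathbb{RP}^d$ to the polygon with vertices $\Pi_k\cap\Pi_{k+i_1}\cap\dots\cap\Pi_{k+i_1+\dots+i_{d-1}}$, where $\Pi_k=\mathrm{span}\langle v_{k+p_1},\dots,v_{k+p_d}\rangle$; it is defined where all $\Pi_k$ are hyperplanes and each of these intersections is one point. Let $G:\mathbb R\to\mathbb R^{d+1}$ be smooth with $\det(G,G',\dots,G^{(d)})=1$ and $G(x+2\pi)=MG(x)$ for some $M\in \mathrm{SL}_{d+1}(\mathbb R)$. Let $L=\partial^{d+1}+u_{d-1}\partial^{d-1}+\dots+u_0$ be the operator with smooth $2\pi$-periodic coefficients such that $LG=0$. For small $\varepsilon>0$ let $Z_\varepsilon$ be the normalized lift of the envelope of the hyperplanes spanned by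 $G(x+k_1\varepsilon),\dots,G(x+k_d\varepsilon)$: $Z_\varepsilon$ is smooth, these $d$ vectors are linearly independent, $\det(G(x+k_1\varepsilon),\dots,G(x+k_d\varepsilon),Z_\varepsilon^{(j)}(x))=0$ for $0\le j\le d-1$, $\det(Z_\varepsilon,Z_\varepsilon',\dots,Z_\varepsilon^{(d)})=1$, and $Z_\varepsilon\to G$ pointwise as $\varepsilon\to0^+$ (this fixes the sign of $Z_\varepsilon$ when $d$ is odd). Let $u_{j,\varepsilon}$ be the coefficients of the operator $\partial^{d+1}+u_{d-1,\varepsilon}\partial^{d-1}+\dots+u_{0,\varepsilon}$ that annihilates $Z_\varepsilon$. For $I=m\cdot(1,\dots,1)$, $m\ge 1$, the continuous limit of $T_{I,J}$ is the system $du_j/dt=w_j$, where $u_{j,\varepsilon}=u_j+\varepsilon^2w_j+O(\varepsilon^3)$. All $O(\varepsilon^3)$ are meant for every $x$-derivative, uniformly on compact sets. The $(2,d+1)$-KdV flow is $dL/dt=[Q_2,L]$, where $Q_2=(L^{2/(d+1)})_+$ is the differential part of the square of the pseudo-differential root $L^{1/(d+1)}=\partial+\dots$. *Claims.* 1. For every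 $m\ge1$ and every $J$ there is a constant $C\ne0$, independent of $G$, such that for every $G$ as above: the operator $L$ exists; for small $\varepsilon>0$ the curves $Z_\varepsilon$ exist and have annihilating operators as above with smooth $2\pi$-periodic coefficients; $$Z_\varepsilon=G+\varepsilon^2C\Big(\partial^2+\tfrac{2}{d+1}u_{d-1}\Big)G+O(\varepsilon^3);$$ and the continuous limit of $T_{I,J}$, $I=m\cdot(1,\dots,1)$, exists and is the $(2,d+1)$-KdV flow with time rescaled by $C$, i.e. $\sum_j w_j\partial^j=C\,[Q_2,L]$, with smooth $2\pi$-periodic $w_j$. 2. Let $B\subset\mathbb Z$, $|B|=d$, be the union of two non-empty disjoint arithmetic progressions with common difference $m\ge 1$, such that $B$ is not itself an arithmetic progression with difference $m$, and let $T$ be the long-diagonal map $v\mapsto\big(\bigcap_{b\in B}\mathrm{span}\langle v_{k+b},v_{k+b+m},\dots,v_{k+b+(d-1)m}\rangle\big)_k$. Let $J$ be the tuple of successive differences of $B$ read backwards and $I=m\cdot(1,\dots,1)$. Then up to a shift of indices $T_{I,J}$ is the inverse of $T$: there is $s\in\mathbb Z$ such that for all polygons $v,w$ with $T$ defined at $v$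 and $T_{I,J}$ defined at $w$, one has $w=T(v)$ if and only if $T_{I,J}(w)=(v_{k+s})_k$. 3. Let $A_\pm\subset\mathbb Z$ be disjoint arithmetic progressions with common difference $m\ge1$, with at least two elements each and $|A_+|+|A_-|=d+2$, and let $T$ be the bi-diagonal map $v\mapsto\big(\mathrm{span}\langle v_{k+a}\mid a\in A_+\rangle\cap\mathrm{span}\langle v_{k+a}\mid a\in A_-\rangle\big)_k$ (defined where the two planes have dimensions $|A_\pm|-1$ and meet in one point). Then, in the same sense, its inverse is $T_{I,J}$ up to a shift of indices, with $I=m\cdot(1,\dots,1)$ and some tuple $J$ of positive integers. In particular, Claim 1 describes the continuous limits of the inverses of all long-diagonal and bi-diagonal maps. -/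

import Mathlib

open Filter Topology
open scoped ContDiff LinearAlgebra.Projectivization

noncomputable section

/-! ## Polygons and pentagram maps

A polygon in `ℝP^d` is a bi-infinite sequence of points.  A strictly monotonic tuple of integers
enters the definition of a pentagram map only through the set of its entries. -/

abbrev ProjPolygon (d : ℕ) := ℤ → ℙ ℝ (Fin (d + 1) → ℝ)

/-- The span of the vertices `v_{k+p}`, `p ∈ P`. -/
def diagonalSpan {d : ℕ} (P : Finset ℤ) (v : ProjPolygon d) (k : ℤ) :
    Submodule ℝ (Fin (d + 1) → ℝ) :=
  ⨆ p ∈ P, (v (k + p)).submodule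

/-- The intersection of the `P`-diagonal planes with indices `k + q`, `q ∈ Q`. -/
def diagonalMeet {d : ℕ} (P Q : Finset ℤ) (v : ProjPolygon d) (k : ℤ) :
    Submodule ℝ (Fin (d + 1) → ℝ) :=
  ⨅ q ∈ Q, diagonalSpan P v (k + q)

/-- `T_{P,Q}` is defined at `v`: the `P`-diagonal planes are hyperplanes, and those with indices
in `k + Q` meet in exactly one point. -/
def PentagramDefined {d : ℕ} (P Q : Finset ℤ) (v : ProjPolygon d) : Prop :=
  ∀ k, Module.finrank ℝ (diagonalSpan P v k) = d ∧
    Module.finrank ℝ (diagonalMeet P Q v k) = 1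

/-- `w = T_{P,Q}(v)`. -/
def IsPentagramImage {d : ℕ} (P Q : Finset ℤ) (v w : ProjPolygon d) : Prop :=
  ∀ k, (w k).submodule = diagonalMeet P Q v k

/-- The bi-diagonal map of `A₊`, `A₋` is defined at `v`: the two planes have dimensions
`|A₊| - 1` and `|A₋| - 1`, and they meet in exactly one point. -/
def BidiagonalDefined {d : ℕ} (A₁ A₂ : Finset ℤ) (v : ProjPolygon d) : Prop :=
  ∀ k, Module.finrank ℝ (diagonalSpan A₁ v k) = A₁.card ∧
    Module.finrank ℝ (diagonalSpan A₂ v k) = A₂.card ∧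
    Module.finrank ℝ (diagonalSpan A₁ v k ⊓ diagonalSpan A₂ v k :
      Submodule ℝ (Fin (d + 1) → ℝ)) = 1

/-- `w` is the image of `v` under the bi-diagonal map of `A₊`, `A₋`. -/
def IsBidiagonalImage {d : ℕ} (A₁ A₂ : Finset ℤ) (v w : ProjPolygon d) : Prop :=
  ∀ k, (w k).submodule = diagonalSpan A₁ v k ⊓ diagonalSpan A₂ v k

/-- The arithmetic progression `a, a + m, …, a + (n - 1) m`. -/
def arithProg (a : ℤ) (m n : ℕ) : Finset ℤ :=
  (Finset.range n).image fun i : ℕ => a + (m : ℤ) * i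

/-- The entries `p_l = j_1 + ⋯ + j_l`, `l = 0, …, d - 1`, of the sequence with successive
differences `J = (j_1, …, j_{d-1})` and first entry `0`. -/
def jumpSeq {d : ℕ} (J : Fin (d - 1) → ℕ) (l : Fin d) : ℕ :=
  ∑ i : Fin (d - 1) with i.val < l.val, J i

def jumpSet {d : ℕ} (J : Fin (d - 1) → ℕ) : Finset ℤ :=
  Finset.univ.image fun l : Fin d => (jumpSeq J l : ℤ)

/-! ## Linear differential operators on the circle -/

/-- Coefficients `u_0, …, u_{d-1}` that are smooth functions on the circle `ℝ/2πℤ`. -/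
def IsCircleCoeffs {d : ℕ} (u : Fin d → ℝ → ℝ) : Prop :=
  ∀ j, ContDiff ℝ ∞ (u j) ∧ Function.Periodic (u j) (2 * Real.pi)

/-- `L f` for `L = ∂^{d+1} + u_{d-1} ∂^{d-1} + ⋯ + u_1 ∂ + u_0`. -/
def applyOp {E : Type*} [NormedAddCommGroup E] [NormedSpace ℝ E] {d : ℕ}
    (u : Fin d → ℝ → ℝ) (f : ℝ → E) (x : ℝ) : E :=
  iteratedDeriv (d + 1) f x + ∑ j : Fin d, u j x • iteratedDeriv j f x

/-! ## Formal pseudo-differential operators and the flows of the hierarchy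

A pseudo-differential operator of order at most `N` is the formal series
`∑_{s ≥ 0} a_s(x) ∂^{N - s}`; it is given by `N` and the sequence `a`. -/

/-- The composition `(∑ a_i ∂^{N-i}) ∘ (∑ b_j ∂^{M-j})`, as a series of order at most `N + M`.
It comes from `∂^n ∘ b = ∑_{r ≥ 0} (n choose r) b^{(r)} ∂^{n-r}`, for every integer `n`, and its
coefficients do not depend on `M`. -/
def psiComp (N : ℤ) (a b : ℕ → ℝ → ℝ) (s : ℕ) (x : ℝ) : ℝ :=
  ∑ i ∈ Finset.range (s + 1), ∑ j ∈ Finset.range (s + 1 - i),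
    ((Ring.choose (N - (i : ℤ)) (s - i - j) : ℤ) : ℝ) * a i x * iteratedDeriv (s - i - j) (b j) x

/-- The `n`-th power of `R = ∑_s R_s ∂^{1-s}`, as a series of order at most `n`. -/
def psiPow (R : ℕ → ℝ → ℝ) : ℕ → ℕ → ℝ → ℝ
  | 0 => fun s _ => if s = 0 then 1 else 0
  | n + 1 => psiComp 1 R (psiPow R n)

/-- `A₊ f`, where `A = ∑_s a_s ∂^{n-s}` and `A₊` is the differential part of `A`. -/
def applyDiffPart (n : ℕ) (a : ℕ → ℝ → ℝ) (f : ℝ → ℝ) (x : ℝ) : ℝ :=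
  ∑ s ∈ Finset.range (n + 1), a s x * iteratedDeriv (n - s) f x

/-- The operator `L = ∂^{d+1} + u_{d-1} ∂^{d-1} + ⋯ + u_0` as a series `∑_s a_s ∂^{d+1-s}`. -/
def opSymbol {d : ℕ} (u : Fin d → ℝ → ℝ) (s : ℕ) : ℝ → ℝ :=
  if s = 0 then 1 else if h : 2 ≤ s ∧ s ≤ d + 1 then u ⟨d + 1 - s, by omega⟩ else 0

/-- `R = ∂ + R_1 + R_2 ∂^{-1} + ⋯` is the root `L^{1/(d+1)}`. -/
def IsOperatorRoot {d : ℕ} (u : Fin d → ℝ → ℝ) (R : ℕ → ℝ → ℝ) : Prop :=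
  (∀ s, ContDiff ℝ ∞ (R s)) ∧ R 0 = 1 ∧ psiPow R (d + 1) = opSymbol u

/-- `v` is the velocity at `L` of the `(k, d+1)`-KdV flow `dL/dt = [Q_k, L]`, that is
`v_{d-1} ∂^{d-1} + ⋯ + v_0 = [Q_k, L]`, where `Q_k = (L^{k/(d+1)})₊`. -/
def IsKdVVelocity {d : ℕ} (k : ℕ) (u v : Fin d → ℝ → ℝ) : Prop :=
  ∃ R : ℕ → ℝ → ℝ, IsOperatorRoot u R ∧
    ∀ f : ℝ → ℝ, ContDiff ℝ ∞ f → ∀ x,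
      ∑ j : Fin d, v j x * iteratedDeriv j f x =
        applyDiffPart k (psiPow R k) (applyOp u f) x -
          applyOp u (applyDiffPart k (psiPow R k) f) x

/-! ## Curves, envelopes and the continuous limit -/

def wronskianDet {d : ℕ} (G : ℝ → Fin (d + 1) → ℝ) (x : ℝ) : ℝ :=
  Matrix.det (Matrix.of fun i : Fin (d + 1) => iteratedDeriv i G x)

/-- `G` is the normalized lift of a smooth non-degenerate quasi-periodic curve in `ℝP^d`. -/
structure IsNormalizedLift {d : ℕ} (G : ℝ → Fin (d + 1) → ℝ) : Prop where
  smooth : ContDiff ℝ ∞ G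
  wronskian : ∀ x, wronskianDet G x = 1
  quasiPeriodic : ∃ M : Matrix.SpecialLinearGroup (Fin (d + 1)) ℝ,
    ∀ x, G (x + 2 * Real.pi) = Matrix.mulVec M.1 (G x)

/-- The numbers `k_1 < ⋯ < k_d` with differences `J`, shifted so that their sum is `0`. -/
def centeredSeq {d : ℕ} (J : Fin (d - 1) → ℕ) (l : Fin d) : ℝ :=
  (jumpSeq J l : ℝ) - (∑ i : Fin d, (jumpSeq J i : ℝ)) / d

/-- `Z` is the normalized lift of the envelope of the hyperplanes `Π_ε(x)` spanned by the points
`G(x + k_1 ε), …, G(x + k_d ε)`. -/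
structure IsEnvelopeLift {d : ℕ} (k : Fin d → ℝ) (ε : ℝ) (G Z : ℝ → Fin (d + 1) → ℝ) :
    Prop where
  smooth : ContDiff ℝ ∞ Z
  hyperplane : ∀ x, LinearIndependent ℝ fun l : Fin d => G (x + k l * ε)
  envelope : ∀ x, ∀ j < d,
    Matrix.det (Matrix.of (Fin.snoc (α := fun _ => Fin (d + 1) → ℝ)
      (fun l : Fin d => G (x + k l * ε)) (iteratedDeriv j Z x))) = 0
  wronskian : ∀ x, wronskianDet Z x = 1

/-- `Z ε` is the normalized lift of the envelope for all small `ε > 0`, with `Z_0 = G`. The limit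
fixes the sign, which the normalization leaves open if `d` is odd. -/
structure IsEnvelopeFamily {d : ℕ} (k : Fin d → ℝ) (G : ℝ → Fin (d + 1) → ℝ)
    (Z : ℝ → ℝ → Fin (d + 1) → ℝ) : Prop where
  lift : ∀ᶠ ε in 𝓝[>] (0 : ℝ), IsEnvelopeLift k ε G (Z ε)
  tendsto : ∀ x, Tendsto (fun ε => Z ε x) (𝓝[>] 0) (𝓝 (G x))

/-- `f_ε = f_0 + ε² f_2 + O(ε³)` as `ε → 0+`, in `C^∞`: for every derivative in `x`, uniformly on
compact sets. -/
def HasSecondOrderExpansion {E : Type*} [NormedAddCommGroup E] [NormedSpace ℝ E]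
    (f : ℝ → ℝ → E) (f₀ f₂ : ℝ → E) : Prop :=
  ∀ (i : ℕ) (r : ℝ), ∃ K : ℝ, ∀ᶠ ε in 𝓝[>] (0 : ℝ), ∀ x ∈ Set.Icc (-r) r,
    ‖iteratedDeriv i (f ε) x - iteratedDeriv i f₀ x - ε ^ 2 • iteratedDeriv i f₂ x‖ ≤ K * ε ^ 3

/-- The system `du_j/dt = w_j` is the continuous limit of `T_{I,J}` at the curve `G`, where
`u` are the coefficients of the operator that annihilates `G`. The definition through the envelope
takes the intersected hyperplanes to be equally spaced, `I = m (1, …, 1)`; they become infinitely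
close ones of the family `Π_ε(x)`, whatever `m` is. -/
structure IsContinuousLimit {d : ℕ} (I J : Fin (d - 1) → ℕ) (G : ℝ → Fin (d + 1) → ℝ)
    (u w : Fin d → ℝ → ℝ) : Prop where
  equallySpaced : ∃ m : ℕ, 0 < m ∧ ∀ l, I l = m
  operator : ∀ x, applyOp u G x = 0
  exists_family : ∃ Z, IsEnvelopeFamily (centeredSeq J) G Z
  expansion : ∀ Z, IsEnvelopeFamily (centeredSeq J) G Z →
    ∃ U : ℝ → Fin d → ℝ → ℝ,
      (∀ᶠ ε in 𝓝[>] (0 : ℝ), IsCircleCoeffs (U ε) ∧ ∀ x, applyOp (U ε) (Z ε) x = 0) ∧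
      ∀ j, HasSecondOrderExpansion (fun ε => U ε j) (u j) (w j)

end

/-! Inverse maps. The incidence of points with hyperplanes is self-dual. If `w_k` lies on the
hyperplanes `Π_{k+b}`, `b ∈ B`, of `v`, then the vertices `w_{k+c-b}` all lie on `Π_{k+c}` and span
it by a dimension count. In turn each vertex of `v` lies on `d` equally spaced hyperplanes, so it is
recovered as their intersection. This gives `longDiagonal_inverse`. A diagonal plane spanned by `n₁`
vertices in arithmetic progression is the intersection of `d + 1 - n₁ = n₂ - 1` equally spaced
hyperplanes, so a bi-diagonal map also imposes `(n₂ - 1) + (n₁ - 1) = d` incidences, and the same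
duality gives `bidiagonal_inverse`.

Continuous limit. The points `G(x + k_l ε)` are replaced by combinations `nodeDiff` that span the
same hyperplane and equal `G^(i) + ε² c_i G^(i+2) + O(ε³)`; the term in `ε` disappears because `∑
k_l = 0` (`nodeMoment_succ`). The covector `φ_ε` of the hyperplane is a determinant in these, the
envelope is the direction annihilated by `φ_ε, …, φ_ε^(d-1)`, and a power of its Wronskian
normalizes it. All these operations preserve expansions of the form `f_0 + ε² f_2 + O(ε³)`, and
computing with `f_0 + η f_2`, `η² = 0`, keeps track of the coefficients. The Wronskian leaves only a
sign free, and the limit `G` fixes it.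

Let `Y` be the `ε²` term of the envelope and `φ` the limit covector. Linearizing the incidences
gives `φ·Y^(j) = c_j φ·G^(j+2)` for `j < d` (`pairing_secondOrderTerm`). The right side is zero
unless `j = d - 2`, because `φ` annihilates `G, …, G^(d-1)` and, since `L` has no `∂^d` term, also
`G^(d+1)`. With `C = c_{d-2}`, which is `∑ k_l² / (2d(d-1))` and hence nonzero, `Y - C G''` is
therefore a multiple of `G`. The linearized Wronskian condition determines the multiple, and `Y = C
(∂² + 2/(d+1) u_{d-1}) G = C Q₂ G` (`secondOrderTerm_eq`).

Linearizing `L_ε Z_ε = 0` gives `W G = -C L Q₂ G = C [Q₂, L] G`, where `W = ∑ w_j ∂^j`. Both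
operators have order at most `d`, and such an operator is determined by its action on the components
of `G`, whose Wronskian is `1`. Hence `W = C [Q₂, L]` (`isKdVVelocity`). -/

theorem mem_arithProg {a b : ℤ} {m n : ℕ} :
    b ∈ arithProg a m n ↔ ∃ i < n, b = a + (m : ℤ) * (i : ℕ) := by
  simp [arithProg, eq_comm]

theorem card_arithProg {m : ℕ} (hm : 0 < m) (a : ℤ) (n : ℕ) : (arithProg a m n).card = n := by
  rw [arithProg, Finset.card_image_of_injective, Finset.card_range]
  intro i j h
  have hm' : (m : ℤ) ≠ 0 := by positivity
  have h : a + (m : ℤ) * (i : ℤ) = a + (m : ℤ) * (j : ℤ) := h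
  exact_mod_cast mul_left_cancel₀ hm' (add_left_cancel h)

/-! ### Index tuples -/

theorem jumpSeq_zero {d : ℕ} (J : Fin (d - 1) → ℕ) (h : 0 < d) : jumpSeq J ⟨0, h⟩ = 0 := by
  simp [jumpSeq]

theorem jumpSeq_succ {d : ℕ} (J : Fin (d - 1) → ℕ) (l : ℕ) (h : l + 1 < d) :
    jumpSeq J ⟨l + 1, h⟩ = jumpSeq J ⟨l, by omega⟩ + J ⟨l, by omega⟩ := by
  have : (Finset.univ.filter fun i : Fin (d - 1) => i.val < l + 1) =
      insert ⟨l, by omega⟩ (Finset.univ.filter fun i : Fin (d - 1) => i.val < l) := by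
    ext i
    simp only [Finset.mem_filter, Finset.mem_univ, true_and, Finset.mem_insert, Fin.ext_iff]
    omega
  simp only [jumpSeq]
  rw [this, Finset.sum_insert (by simp), add_comm]

theorem jumpSeq_const {d : ℕ} (m : ℕ) (l : Fin d) :
    jumpSeq (fun _ : Fin (d - 1) => m) l = m * l := by
  obtain ⟨l, h⟩ := l
  induction l with
  | zero => simp [jumpSeq_zero]
  | succ l ih => rw [jumpSeq_succ, ih (by omega)]; push_cast; ring

theorem jumpSet_const (d m : ℕ) : jumpSet (d := d) (fun _ => m) = arithProg 0 m d := by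
  ext b
  simp only [jumpSet, mem_arithProg, jumpSeq_const, Finset.mem_image, Finset.mem_univ, true_and]
  constructor
  · rintro ⟨l, rfl⟩
    exact ⟨l, l.2, by push_cast; ring⟩
  · rintro ⟨i, hi, rfl⟩
    exact ⟨⟨i, hi⟩, by push_cast; ring⟩

/-- Every finite set of integers is, read backwards, a translate of the entries of a tuple with
positive successive differences. -/
theorem exists_jumpSet_eq_image {d : ℕ} (hd : 0 < d) (B : Finset ℤ) (hB : B.card = d) :
    ∃ (J : Fin (d - 1) → ℕ) (c : ℤ), (∀ l, 0 < J l) ∧ jumpSet J = B.image fun b => c - b := by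
  have hS : (B.image fun b => -b).card = d := by
    rw [Finset.card_image_of_injective _ neg_injective, hB]
  -- The entries of `-B` in increasing order; their gaps are the jumps, and the translation `c = -e
  -- 0` is the largest element of `B`.
  set e := (B.image fun b => -b).orderEmbOfFin hS with he
  have hlt : ∀ l : Fin (d - 1),
      e ⟨l, by omega⟩ < e ⟨l + 1, by omega⟩ := fun l => by simp [Fin.lt_def]
  have hJ : ∀ l (h : l < d),
      (jumpSeq (fun i : Fin (d - 1) => (e ⟨i + 1, by omega⟩ - e ⟨i, by omega⟩).toNat) ⟨l, h⟩ : ℤ)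
        = e ⟨l, h⟩ - e ⟨0, hd⟩ := by
    intro l
    induction l with
    | zero => intro h; simp [jumpSeq_zero]
    | succ l ih =>
      intro h
      rw [jumpSeq_succ]
      have := hlt ⟨l, by omega⟩
      dsimp only at this
      push_cast
      rw [ih (by omega), Int.toNat_of_nonneg (by omega)]
      ring
  refine ⟨fun i => (e ⟨i + 1, by omega⟩ - e ⟨i, by omega⟩).toNat, -e ⟨0, hd⟩, fun l => ?_, ?_⟩
  · have := hlt l
    simp only [Int.lt_toNat]
    push_cast
    omega
  · have hr : Finset.univ.image e = B.image fun b => -b := by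
      apply Finset.coe_injective
      simp [he]
    ext x
    simp only [jumpSet, Finset.mem_image, Finset.mem_univ, true_and]
    constructor
    · rintro ⟨⟨l, hl⟩, rfl⟩
      rw [hJ]
      have : e ⟨l, hl⟩ ∈ B.image fun b => -b := by rw [← hr]; simp
      obtain ⟨b, hb, hb'⟩ := Finset.mem_image.1 this
      exact ⟨b, hb, by rw [← hb']; ring⟩
    · rintro ⟨b, hb, rfl⟩
      have : -b ∈ Finset.univ.image e := by rw [hr]; exact Finset.mem_image_of_mem _ hb
      obtain ⟨⟨l, hl⟩, -, hl'⟩ := Finset.mem_image.1 this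
      exact ⟨⟨l, hl⟩, by rw [hJ, hl']; ring⟩

/-! ### Duality between vertices and hyperplanes -/

section Polygon

variable {d : ℕ}

theorem submodule_le_diagonalSpan {P : Finset ℤ} {v : ProjPolygon d} {k l : ℤ} (h : l - k ∈ P) :
    (v l).submodule ≤ diagonalSpan P v k := by
  have := le_iSup₂_of_le (f := fun p (_ : p ∈ P) => (v (k + p)).submodule) (l - k) h le_rfl
  simpa [diagonalSpan] using this

theorem diagonalSpan_le {P : Finset ℤ} {v : ProjPolygon d} {k : ℤ}
    {W : Submodule ℝ (Fin (d + 1) → ℝ)} (h : ∀ p ∈ P, (v (k + p)).submodule ≤ W) :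
    diagonalSpan P v k ≤ W :=
  iSup₂_le h

theorem finrank_diagonalSpan_le (P : Finset ℤ) (v : ProjPolygon d) (k : ℤ) :
    Module.finrank ℝ (diagonalSpan P v k) ≤ P.card := by
  classical
  have h := finrank_span_finset_le_card (R := ℝ) (P.image fun p => (v (k + p)).rep)
  refine le_trans (le_trans (Submodule.finrank_mono ?_) h) Finset.card_image_le
  refine diagonalSpan_le fun p hp => ?_
  rw [Projectivization.submodule_eq, Submodule.span_le]
  intro x hx
  rw [Set.mem_singleton_iff.1 hx]
  exact Submodule.subset_span (by simpa using ⟨p, hp, rfl⟩)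

/-- If every vertex `w_k` lies on the hyperplanes of `v` with indices in `k + B`, then the
hyperplanes spanned by `w` are those of `v`. -/
theorem diagonalSpan_eq_of_incident {B P' Q' : Finset ℤ} {m : ℕ} {c : ℤ} {v w : ProjPolygon d}
    (hP' : P' = B.image fun b => c - b) (hw : PentagramDefined P' Q' w)
    (h : ∀ k, ∀ b ∈ B, (w k).submodule ≤ diagonalSpan (arithProg 0 m d) v (k + b)) (k : ℤ) :
    diagonalSpan P' w k = diagonalSpan (arithProg 0 m d) v (k + c) := by
  apply Submodule.eq_of_le_of_finrank_le
  · apply diagonalSpan_le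
    intro p hp
    rw [hP'] at hp
    obtain ⟨b, hb, rfl⟩ := Finset.mem_image.1 hp
    simpa [add_assoc] using h (k + (c - b)) b hb
  · rw [(hw k).1]
    refine (finrank_diagonalSpan_le _ _ _).trans ?_
    exact Finset.card_image_le.trans (by simp)

/-- The shift `c + m(d - 1)` is the index of the last vertex spanning `Π_{k+c}`, which is the vertex
shared by `Π_{k+c}, Π_{k+c+m}, …, Π_{k+c+(d-1)m}`. Since the intersection is known to be one point,
containment of that vertex suffices. -/
theorem isPentagramImage_of_incident {B P' : Finset ℤ} {m : ℕ} {c : ℤ} {v w : ProjPolygon d}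
    (hP' : P' = B.image fun b => c - b) (hw : PentagramDefined P' (arithProg 0 m d) w)
    (h : ∀ k, ∀ b ∈ B, (w k).submodule ≤ diagonalSpan (arithProg 0 m d) v (k + b)) :
    IsPentagramImage P' (arithProg 0 m d) w fun k => v (k + (c + m * ((d : ℤ) - 1))) := by
  intro k
  apply Submodule.eq_of_le_of_finrank_eq
  · refine le_iInf₂ fun q hq => ?_
    rw [diagonalSpan_eq_of_incident hP' hw h]
    obtain ⟨i, hi, rfl⟩ := mem_arithProg.1 hq
    apply submodule_le_diagonalSpan
    refine mem_arithProg.2 ⟨d - 1 - i, by omega, ?_⟩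
    have : ((d - 1 - i : ℕ) : ℤ) = d - 1 - i := by omega
    rw [this]
    ring
  · rw [(hw k).2, Projectivization.finrank_submodule]

theorem submodule_le_of_isPentagramImage {P' : Finset ℤ} {m : ℕ} {c : ℤ} {v w : ProjPolygon d}
    (h : IsPentagramImage P' (arithProg 0 m d) w fun k => v (k + (c + m * ((d : ℤ) - 1))))
    {k l : ℤ} (hl : l - (k + c) ∈ arithProg 0 m d) :
    (v l).submodule ≤ diagonalSpan P' w k := by
  obtain ⟨i, hi, hi'⟩ := mem_arithProg.1 hl
  have := h (k - m * ((d : ℤ) - 1) + m * i)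
  beta_reduce at this
  rw [show k - m * ((d : ℤ) - 1) + m * i + (c + m * ((d : ℤ) - 1)) = l by linarith] at this
  rw [this]
  refine (iInf₂_le (m * ((d : ℤ) - 1 - i)) (mem_arithProg.2 ⟨d - 1 - i, by omega, ?_⟩)).trans ?_
  · have : ((d - 1 - i : ℕ) : ℤ) = d - 1 - i := by omega
    rw [this]
    ring
  · rw [show k - m * ((d : ℤ) - 1) + m * i + m * ((d : ℤ) - 1 - i) = k by ring]

theorem finrank_le_finrank_inf_add_one {U W : Submodule ℝ (Fin (d + 1) → ℝ)}
    (hW : Module.finrank ℝ W = d) :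
    Module.finrank ℝ U ≤ Module.finrank ℝ (U ⊓ W : Submodule ℝ (Fin (d + 1) → ℝ)) + 1 := by
  have h1 := Submodule.finrank_sup_add_finrank_inf_eq U W
  have h2 := Submodule.finrank_le (U ⊔ W)
  rw [Module.finrank_fin_fun] at h2
  omega

/-- Each further hyperplane lowers the dimension of an intersection by at most one. -/
theorem finrank_iInf_le {ι : Type*} [DecidableEq ι]
    {W : ι → Submodule ℝ (Fin (d + 1) → ℝ)} (hW : ∀ i, Module.finrank ℝ (W i) = d)
    (s t : Finset ι) :
    Module.finrank ℝ (⨅ i ∈ s, W i : Submodule ℝ (Fin (d + 1) → ℝ)) ≤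
      Module.finrank ℝ (⨅ i ∈ t ∪ s, W i : Submodule ℝ (Fin (d + 1) → ℝ)) + t.card := by
  induction t using Finset.induction_on with
  | empty => rw [Finset.empty_union, Finset.card_empty, add_zero]
  | insert a t ha ih =>
    rw [Finset.insert_union, Finset.iInf_insert, Finset.card_insert_of_notMem ha, inf_comm]
    have := finrank_le_finrank_inf_add_one (U := ⨅ i ∈ t ∪ s, W i) (hW a)
    omega

theorem longDiagonal_inverse {B P' : Finset ℤ} {m : ℕ} {c : ℤ}
    (hP' : P' = B.image fun b => c - b) {v w : ProjPolygon d}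
    (hv : PentagramDefined (arithProg 0 m d) B v)
    (hw : PentagramDefined P' (arithProg 0 m d) w) :
    IsPentagramImage (arithProg 0 m d) B v w ↔
      IsPentagramImage P' (arithProg 0 m d) w fun k => v (k + (c + m * ((d : ℤ) - 1))) := by
  constructor
  · intro h
    refine isPentagramImage_of_incident hP' hw fun k b hb => ?_
    rw [h k]
    exact iInf₂_le b hb
  · intro h k
    -- The vertices of `v` that span `Π_{k+c}` all lie on the `k`-th hyperplane of `w`; both spaces
    -- have dimension `d`.
    have key : ∀ k, diagonalSpan (arithProg 0 m d) v (k + c) = diagonalSpan P' w k := fun k =>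
      Submodule.eq_of_le_of_finrank_eq
        (diagonalSpan_le fun p hp => submodule_le_of_isPentagramImage h (by simpa using hp))
        (by rw [(hv _).1, (hw _).1])
    apply Submodule.eq_of_le_of_finrank_eq
    · refine le_iInf₂ fun b hb => ?_
      rw [show k + b = k + b - c + c by ring, key]
      apply submodule_le_diagonalSpan
      rw [hP']
      exact Finset.mem_image.2 ⟨b, hb, by ring⟩
    · rw [(hv k).2, Projectivization.finrank_submodule]

/-- The hyperplanes of an equally spaced family of `d` consecutive ones are independent. -/
theorem finrank_iInf_diagonalSpan_le {P' : Finset ℤ} {m : ℕ} (hm : 0 < m) {w : ProjPolygon d}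
    (hw : PentagramDefined P' (arithProg 0 m d) w) (k : ℤ) {n : ℕ} (hn : n ≤ d) :
    Module.finrank ℝ (⨅ q ∈ arithProg 0 m n, diagonalSpan P' w (k + q) :
      Submodule ℝ (Fin (d + 1) → ℝ)) ≤ d + 1 - n := by
  have hsub : arithProg 0 m n ⊆ arithProg 0 m d := by
    intro x hx
    obtain ⟨i, hi, rfl⟩ := mem_arithProg.1 hx
    exact mem_arithProg.2 ⟨i, by omega, rfl⟩
  -- All `d` hyperplanes meet in dimension one, and omitting `d - n` of them can raise this only to
  -- `d + 1 - n`.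
  have h := finrank_iInf_le (W := fun q => diagonalSpan P' w (k + q)) (fun q => (hw _).1)
    (arithProg 0 m n) (arithProg 0 m d \ arithProg 0 m n)
  rw [Finset.sdiff_union_of_subset hsub, Finset.card_sdiff_of_subset hsub, card_arithProg hm,
    card_arithProg hm] at h
  have := (hw k).2
  rw [diagonalMeet] at this
  omega

/-- The hyperplanes on the right, translated by `c` into indices of `v`, start `n, n - 1, …, 0`
steps before the first vertex of the diagonal, so each contains the `d - n` vertices of it.
Independence of the hyperplanes makes the dimensions agree. -/
theorem diagonalSpan_eq_iInf {P' : Finset ℤ} {m n : ℕ} (hm : 0 < m) {v w : ProjPolygon d} {c a : ℤ}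
    (hn : n + 1 ≤ d) (hA : ∀ k, Module.finrank ℝ (diagonalSpan (arithProg a m (d - n)) v k) = d - n)
    (hw : PentagramDefined P' (arithProg 0 m d) w)
    (h : IsPentagramImage P' (arithProg 0 m d) w fun k => v (k + (c + m * ((d : ℤ) - 1)))) (k : ℤ) :
    diagonalSpan (arithProg a m (d - n)) v k =
      ⨅ q ∈ arithProg 0 m (n + 1), diagonalSpan P' w (k + (a - m * n) - c + q) := by
  apply Submodule.eq_of_le_of_finrank_le
  · refine diagonalSpan_le fun p hp => le_iInf₂ fun q hq => ?_
    obtain ⟨i, hi, rfl⟩ := mem_arithProg.1 hp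
    obtain ⟨j, hj, rfl⟩ := mem_arithProg.1 hq
    refine submodule_le_of_isPentagramImage h (mem_arithProg.2 ⟨i + n - j, by omega, ?_⟩)
    have : ((i + n - j : ℕ) : ℤ) = i + n - j := by omega
    rw [this]
    ring
  · rw [hA]
    exact (finrank_iInf_diagonalSpan_le hm hw _ hn).trans (by omega)

/-- The two progressions in `hP'` list the starting indices of the hyperplanes of `v` that contain
the first and the second diagonal plane. -/
theorem bidiagonal_inverse {P' : Finset ℤ} {m n₁ n₂ : ℕ} (hm : 0 < m) {a₁ a₂ c : ℤ} (h₁ : 2 ≤ n₁)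
    (h₂ : 2 ≤ n₂) (hn : n₁ + n₂ = d + 2)
    (hP' : P' = (arithProg (a₁ - m * (n₂ - 2 : ℕ)) m (n₂ - 1) ∪
      arithProg (a₂ - m * (n₁ - 2 : ℕ)) m (n₁ - 1)).image fun b => c - b)
    {v w : ProjPolygon d} (hv : BidiagonalDefined (arithProg a₁ m n₁) (arithProg a₂ m n₂) v)
    (hw : PentagramDefined P' (arithProg 0 m d) w) :
    IsBidiagonalImage (arithProg a₁ m n₁) (arithProg a₂ m n₂) v w ↔
      IsPentagramImage P' (arithProg 0 m d) w fun k => v (k + (c + m * ((d : ℤ) - 1))) := by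
  have incl : ∀ (a : ℤ) (n n' : ℕ), 2 ≤ n → 2 ≤ n' → n + n' = d + 2 → ∀ k,
      ∀ b ∈ arithProg (a - m * (n' - 2 : ℕ)) m (n' - 1),
      diagonalSpan (arithProg a m n) v k ≤ diagonalSpan (arithProg 0 m d) v (k + b) := by
    intro a n n' h h' hn k b hb
    refine diagonalSpan_le fun p hp => submodule_le_diagonalSpan ?_
    obtain ⟨i, hi, rfl⟩ := mem_arithProg.1 hb
    obtain ⟨j, hj, rfl⟩ := mem_arithProg.1 hp
    refine mem_arithProg.2 ⟨j + (n' - 2) - i, by omega, ?_⟩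
    have : ((j + (n' - 2) - i : ℕ) : ℤ) = j + (n' - 2 : ℕ) - i := by omega
    rw [this]
    ring
  constructor
  · intro h
    refine isPentagramImage_of_incident hP' hw fun k b hb => ?_
    rw [h k]
    rcases Finset.mem_union.1 hb with hb | hb
    · exact inf_le_left.trans (incl _ _ _ h₁ h₂ hn k b hb)
    · exact inf_le_right.trans (incl _ _ _ h₂ h₁ (by omega) k b hb)
  · intro h k
    have e₁ := diagonalSpan_eq_iInf (n := n₂ - 2) (a := a₁) (v := v) hm (by omega)
      (fun k => by rw [show d - (n₂ - 2) = n₁ by omega, (hv k).1, card_arithProg hm]) hw h k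
    have e₂ := diagonalSpan_eq_iInf (n := n₁ - 2) (a := a₂) (v := v) hm (by omega)
      (fun k => by rw [show d - (n₁ - 2) = n₂ by omega, (hv k).2.1, card_arithProg hm]) hw h k
    rw [show d - (n₂ - 2) = n₁ by omega, show n₂ - 2 + 1 = n₂ - 1 by omega] at e₁
    rw [show d - (n₁ - 2) = n₂ by omega, show n₁ - 2 + 1 = n₁ - 1 by omega] at e₂
    apply Submodule.eq_of_le_of_finrank_eq
    · refine le_inf ?_ ?_
      · rw [e₁]
        refine le_iInf₂ fun q hq => submodule_le_diagonalSpan ?_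
        obtain ⟨i, hi, rfl⟩ := mem_arithProg.1 hq
        rw [hP']
        exact Finset.mem_image.2 ⟨_, Finset.mem_union_left _ (mem_arithProg.2 ⟨i, hi, rfl⟩), by ring⟩
      · rw [e₂]
        refine le_iInf₂ fun q hq => submodule_le_diagonalSpan ?_
        obtain ⟨i, hi, rfl⟩ := mem_arithProg.1 hq
        rw [hP']
        exact Finset.mem_image.2
          ⟨_, Finset.mem_union_right _ (mem_arithProg.2 ⟨i, hi, rfl⟩), by ring⟩
    · rw [(hv k).2.2, Projectivization.finrank_submodule]

end Polygon

/-- A common index would give `a₁ = a₂ + m t` with `-(n₁ - 2) ≤ t ≤ n₂ - 2`, and then the first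
element of one progression would lie in the other. Disjointness guarantees exactly `d` hyperplanes.
-/
theorem disjoint_hyperplane_indices {m n₁ n₂ : ℕ} (hm : 0 < m) {a₁ a₂ : ℤ} (h₁ : 2 ≤ n₁)
    (h₂ : 2 ≤ n₂) (h : Disjoint (arithProg a₁ m n₁) (arithProg a₂ m n₂)) :
    Disjoint (arithProg (a₁ - m * (n₂ - 2 : ℕ)) m (n₂ - 1))
      (arithProg (a₂ - m * (n₁ - 2 : ℕ)) m (n₁ - 1)) := by
  rw [Finset.disjoint_left] at h ⊢
  intro x hx hy
  obtain ⟨i, hi, rfl⟩ := mem_arithProg.1 hx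
  obtain ⟨j, hj, hij⟩ := mem_arithProg.1 hy
  have hm' : (0 : ℤ) < m := by exact_mod_cast hm
  obtain ⟨t, ht⟩ : ∃ t : ℤ, t = (j : ℤ) - (n₁ - 2 : ℕ) + (n₂ - 2 : ℕ) - i := ⟨_, rfl⟩
  have ha : a₁ = a₂ + m * t := by rw [ht]; linarith
  rcases le_or_gt 0 t with h0 | h0
  · lift t to ℕ using h0
    refine h (mem_arithProg.2 ⟨0, by omega, by simp⟩) (mem_arithProg.2 ⟨t, by omega, ha⟩)
  · obtain ⟨s, rfl⟩ : ∃ s : ℕ, t = -s := ⟨(-t).toNat, by omega⟩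
    refine h (mem_arithProg.2 ⟨s, by omega, rfl⟩) (mem_arithProg.2 ⟨0, by omega, ?_⟩)
    rw [ha]; push_cast; ring

/-! ### Roots of formal pseudo-differential operators -/

theorem psiComp_smooth {N : ℤ} {a b : ℕ → ℝ → ℝ} (ha : ∀ s, ContDiff ℝ ∞ (a s))
    (hb : ∀ s, ContDiff ℝ ∞ (b s)) (s : ℕ) : ContDiff ℝ ∞ (psiComp N a b s) := by
  unfold psiComp
  refine ContDiff.sum fun i _ => ContDiff.sum fun j _ => (contDiff_const.mul (ha i)).mul ?_
  rw [iteratedDeriv_eq_iterate]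
  exact (hb j).iterate_deriv _

theorem psiPow_smooth {R : ℕ → ℝ → ℝ} (hR : ∀ s, ContDiff ℝ ∞ (R s)) (n s : ℕ) :
    ContDiff ℝ ∞ (psiPow R n s) := by
  induction n generalizing s with
  | zero => exact contDiff_const
  | succ n ih => exact psiComp_smooth hR ih s

theorem psiComp_zero (N : ℤ) (a b : ℕ → ℝ → ℝ) (x : ℝ) : psiComp N a b 0 x = a 0 x * b 0 x := by
  simp [psiComp]

theorem psiComp_congr {N : ℤ} {a a' b b' : ℕ → ℝ → ℝ} {s : ℕ} (ha : ∀ i ≤ s, a i = a' i)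
    (hb : ∀ i ≤ s, b i = b' i) : psiComp N a b s = psiComp N a' b' s := by
  funext x
  refine Finset.sum_congr rfl fun i hi => Finset.sum_congr rfl fun j hj => ?_
  rw [Finset.mem_range] at hi hj
  rw [ha i (by omega), hb j (by omega)]

/-- The top coefficients of the factors enter a coefficient of a product of monic series
additively. -/
theorem psiComp_succ_sub {N : ℤ} {a a' b b' : ℕ → ℝ → ℝ} {s : ℕ} (ha : ∀ i ≤ s, a i = a' i)
    (hb : ∀ i ≤ s, b i = b' i) (ha0 : a 0 = 1) (hb0 : b 0 = 1) (x : ℝ) :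
    psiComp N a b (s + 1) x - psiComp N a' b' (s + 1) x =
      (a (s + 1) x - a' (s + 1) x) + (b (s + 1) x - b' (s + 1) x) := by
  have ha0' : a' 0 = 1 := by rw [← ha 0 (by omega), ha0]
  have hb0' : b' 0 = 1 := by rw [← hb 0 (by omega), hb0]
  simp only [psiComp]
  rw [Finset.sum_range_succ, Finset.sum_range_succ', Finset.sum_range_succ (n := s + 1),
    Finset.sum_range_succ' (n := s), Nat.sub_zero, Nat.sub_zero, Finset.sum_range_succ _ (s + 1),
    Finset.sum_range_succ _ (s + 1)]
  have e1 : ∀ i ∈ Finset.range s, ∑ j ∈ Finset.range (s + 1 + 1 - (i + 1)),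
      ((Ring.choose (N - ((i + 1 : ℕ) : ℤ)) (s + 1 - (i + 1) - j) : ℤ) : ℝ) * a (i + 1) x *
        iteratedDeriv (s + 1 - (i + 1) - j) (b j) x =
      ∑ j ∈ Finset.range (s + 1 + 1 - (i + 1)),
      ((Ring.choose (N - ((i + 1 : ℕ) : ℤ)) (s + 1 - (i + 1) - j) : ℤ) : ℝ) * a' (i + 1) x *
        iteratedDeriv (s + 1 - (i + 1) - j) (b' j) x := by
    intro i hi
    refine Finset.sum_congr rfl fun j hj => ?_
    rw [Finset.mem_range] at hi hj
    rw [ha (i + 1) (by omega), hb j (by omega)]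
  have e2 : ∀ j ∈ Finset.range (s + 1), ((Ring.choose (N - ((0 : ℕ) : ℤ)) (s + 1 - j) : ℤ) : ℝ) *
      a 0 x * iteratedDeriv (s + 1 - j) (b j) x =
      ((Ring.choose (N - ((0 : ℕ) : ℤ)) (s + 1 - j) : ℤ) : ℝ) *
      a' 0 x * iteratedDeriv (s + 1 - j) (b' j) x := by
    intro j hj
    rw [Finset.mem_range] at hj
    rw [ha 0 (by omega), hb j (by omega)]
  rw [Finset.sum_congr rfl e1, Finset.sum_congr rfl e2]
  simp [ha0, hb0, ha0', hb0']
  ring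

theorem psiPow_zero_coeff {R : ℕ → ℝ → ℝ} (hR : R 0 = 1) (n : ℕ) : psiPow R n 0 = 1 := by
  induction n with
  | zero => funext x; simp [psiPow]
  | succ n ih => funext x; simp [psiPow, psiComp_zero, hR, ih]

theorem psiPow_congr {R R' : ℕ → ℝ → ℝ} {s : ℕ} (h : ∀ i ≤ s, R i = R' i) (n : ℕ) :
    psiPow R n s = psiPow R' n s := by
  induction n generalizing s with
  | zero => rfl
  | succ n ih => exact psiComp_congr h fun i hi => ih fun j hj => h j (hj.trans hi)

/-- A new coefficient of `R` enters the same coefficient of `R^n` once for each of the `n` monic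
factors. This makes the root recursively solvable and yields its first coefficients. -/
theorem psiPow_succ_sub {R R' : ℕ → ℝ → ℝ} {s : ℕ} (h : ∀ i ≤ s, R i = R' i) (hR : R 0 = 1)
    (n : ℕ) (x : ℝ) :
    psiPow R n (s + 1) x - psiPow R' n (s + 1) x = n * (R (s + 1) x - R' (s + 1) x) := by
  induction n with
  | zero => simp [psiPow]
  | succ n ih =>
    have := psiComp_succ_sub (N := 1) h
      (fun i hi => psiPow_congr (fun j hj => h j (hj.trans hi)) n) hR (psiPow_zero_coeff hR n) x
    simp only [psiPow]
    rw [this, ih]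
    push_cast
    ring

/-- The coefficients of the monic `n`-th root of the series with coefficients `a`. -/
noncomputable def rootCoeff (n : ℕ) (a : ℕ → ℝ → ℝ) : ℕ → ℝ → ℝ
  -- The power of the truncated root misses the target by `n` times the unknown coefficient.
  | s => if s = 0 then 1 else fun x =>
      (a s x - psiPow (fun i => if _h : i < s then rootCoeff n a i else 0) n s x) / n

theorem rootCoeff_zero (n : ℕ) (a : ℕ → ℝ → ℝ) : rootCoeff n a 0 = 1 := by
  rw [rootCoeff]; simp

theorem rootCoeff_succ (n : ℕ) (a : ℕ → ℝ → ℝ) (s : ℕ) :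
    rootCoeff n a (s + 1) = fun x => (a (s + 1) x -
      psiPow (fun i => if i < s + 1 then rootCoeff n a i else 0) n (s + 1) x) / n := by
  conv_lhs => rw [rootCoeff]
  simp

theorem rootCoeff_smooth (n : ℕ) {a : ℕ → ℝ → ℝ} (ha : ∀ s, ContDiff ℝ ∞ (a s)) (s : ℕ) :
    ContDiff ℝ ∞ (rootCoeff n a s) := by
  induction s using Nat.strong_induction_on with
  | _ s ih =>
    cases s with
    | zero => rw [rootCoeff_zero]; exact contDiff_const
    | succ s =>
      rw [rootCoeff_succ]
      refine ((ha _).sub (psiPow_smooth (fun i => ?_) _ _)).div_const _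
      split_ifs with h
      · exact ih i h
      · exact contDiff_const

theorem psiPow_rootCoeff {n : ℕ} (hn : n ≠ 0) {a : ℕ → ℝ → ℝ} (ha : a 0 = 1) :
    psiPow (rootCoeff n a) n = a := by
  funext s
  cases s with
  | zero => rw [psiPow_zero_coeff (rootCoeff_zero n a), ha]
  | succ s =>
    funext x
    have := psiPow_succ_sub (R := rootCoeff n a)
      (R' := fun i => if i < s + 1 then rootCoeff n a i else 0) (s := s)
      (fun i hi => by simp [Nat.lt_succ_of_le hi]) (rootCoeff_zero n a) n x
    have e : rootCoeff n a (s + 1) x = (a (s + 1) x -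
      psiPow (fun i => if i < s + 1 then rootCoeff n a i else 0) n (s + 1) x) / n := by
      rw [rootCoeff_succ]
    have hn' : (n : ℝ) ≠ 0 := by exact_mod_cast hn
    rw [e] at this
    simp only [lt_irrefl, if_false, Pi.zero_apply, sub_zero] at this
    rw [mul_div_cancel₀ _ hn'] at this
    linarith

/-- The sequence `1, 0, 0, …` represents `∂`; its powers are the reference from which the first
coefficients of powers of `R` are computed. -/
theorem psiComp_one_one (s : ℕ) :
    psiComp 1 (fun s _ => if s = 0 then 1 else 0) (fun s _ => if s = 0 then 1 else 0) s =
      fun _ => if s = 0 then 1 else 0 := by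
  funext x
  rw [psiComp, Finset.sum_eq_single 0, Finset.sum_eq_single 0]
  · rcases s with _ | s <;> simp [iteratedDeriv_const]
  · intro j _ hj
    simp [hj]
  · simp
  · intro i _ hi
    simp [hi]
  · simp

theorem psiPow_one (n : ℕ) :
    psiPow (fun s _ => if s = 0 then 1 else 0) n = fun s _ => if s = 0 then 1 else 0 := by
  induction n with
  | zero => rfl
  | succ n ih => funext s; rw [psiPow, ih, psiComp_one_one]

theorem opSymbol_smooth {d : ℕ} {u : Fin d → ℝ → ℝ} (hu : ∀ j, ContDiff ℝ ∞ (u j)) (s : ℕ) :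
    ContDiff ℝ ∞ (opSymbol u s) := by
  unfold opSymbol
  split_ifs
  · exact contDiff_const
  · exact hu _
  · exact contDiff_const

theorem exists_isOperatorRoot {d : ℕ} {u : Fin d → ℝ → ℝ} (hu : ∀ j, ContDiff ℝ ∞ (u j)) :
    ∃ R, IsOperatorRoot u R :=
  ⟨rootCoeff (d + 1) (opSymbol u), rootCoeff_smooth _ (opSymbol_smooth hu), rootCoeff_zero _ _,
    psiPow_rootCoeff (by omega) (by simp [opSymbol])⟩

/-- The differential part of the square of the root is `∂² + 2/(d+1) u_{d-1}`. -/
theorem IsOperatorRoot.applyDiffPart_two {d : ℕ} (hd : 1 ≤ d) {u : Fin d → ℝ → ℝ}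
    {R : ℕ → ℝ → ℝ} (hR : IsOperatorRoot u R) (f : ℝ → ℝ) (x : ℝ) :
    applyDiffPart 2 (psiPow R 2) f x =
      iteratedDeriv 2 f x + 2 / ((d : ℝ) + 1) * u ⟨d - 1, by omega⟩ x * f x := by
  obtain ⟨-, h0, h⟩ := hR
  set δ : ℕ → ℝ → ℝ := fun s _ => if s = 0 then 1 else 0 with hδ
  have hδ0 : R 0 = δ 0 := by rw [h0]; funext y; simp [hδ]
  -- Comparison with `∂`, which shares the leading coefficient. Since `L` has no `∂^d` term, the
  -- case `n = d + 1` will give `R_1 = 0`.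
  have k1 : ∀ n y, psiPow R n 1 y = n * R 1 y := by
    intro n y
    have := psiPow_succ_sub (R := R) (R' := δ) (s := 0)
      (fun i hi => by rw [Nat.le_zero.1 hi, hδ0]) h0 n y
    rw [psiPow_one] at this
    simpa [hδ] using this
  have hR1 : R 1 = δ 1 := by
    funext y
    have := k1 (d + 1) y
    rw [h] at this
    have h' : (d : ℝ) + 1 ≠ 0 := by positivity
    simpa [opSymbol, hδ, h'] using this
  -- As `R_1 = 0`, the comparison with `∂` extends one step further. The case `n = d + 1` identifies
  -- `R_2`, and `n = 2` is the coefficient wanted.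
  have k2 : ∀ n y, psiPow R n 2 y = n * R 2 y := by
    intro n y
    have := psiPow_succ_sub (R := R) (R' := δ) (s := 1)
      (fun i hi => by interval_cases i <;> assumption) h0 n y
    rw [psiPow_one] at this
    simpa [hδ] using this
  have hR2 : ((d : ℝ) + 1) * R 2 x = u ⟨d - 1, by omega⟩ x := by
    have := k2 (d + 1) x
    rw [h] at this
    simp only [opSymbol] at this
    rw [if_neg (by omega), dif_pos (by omega)] at this
    push_cast at this
    rw [← this]
  have hd' : (d : ℝ) + 1 ≠ 0 := by positivity
  rw [applyDiffPart, Finset.sum_range_succ, Finset.sum_range_succ, Finset.sum_range_one,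
    psiPow_zero_coeff h0, k1, k2, hR1, ← hR2]
  have e : 2 / ((d : ℝ) + 1) * (((d : ℝ) + 1) * R 2 x) = 2 * R 2 x := by field_simp
  rw [e]
  simp [hδ]

/-! ### Calculus of second order expansions

A family `f_ε = f_0 + ε² f_2 + O(ε³)` is described by the function `f_0 + η f_2` with values in the
dual numbers, so that products of families correspond to products of functions. -/

section Expansion

open Asymptotics TrivSqZeroExt

/-- The filter of points `(ε, x)` with `ε → 0+` and `x ∈ [-r, r]`. -/
def smallOn (r : ℝ) : Filter (ℝ × ℝ) := 𝓝[>] (0 : ℝ) ×ˢ 𝓟 (Set.Icc (-r) r)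

theorem eventually_smallOn {r : ℝ} {p : ℝ → ℝ → Prop} :
    (∀ᶠ q in smallOn r, p q.1 q.2) ↔ ∀ᶠ ε in 𝓝[>] (0 : ℝ), ∀ x ∈ Set.Icc (-r) r, p ε x :=
  eventually_prod_principal_iff (p := fun q => p q.1 q.2)

theorem isBigO_smallOn_iff {E : Type*} [NormedAddCommGroup E] {f : ℝ → ℝ → E} {n : ℕ} {r : ℝ} :
    (fun q : ℝ × ℝ => f q.1 q.2) =O[smallOn r] (fun q => q.1 ^ n) ↔
      ∃ K : ℝ, ∀ᶠ ε in 𝓝[>] (0 : ℝ), ∀ x ∈ Set.Icc (-r) r, ‖f ε x‖ ≤ K * ε ^ n := by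
  rw [isBigO_iff]
  refine exists_congr fun K => ?_
  rw [eventually_smallOn (p := fun ε x => ‖f ε x‖ ≤ K * ‖ε ^ n‖)]
  refine eventually_congr ?_
  filter_upwards [self_mem_nhdsWithin] with ε hε
  rw [Real.norm_of_nonneg (pow_nonneg (le_of_lt hε) n)]

theorem isBigO_pow_smallOn {m n : ℕ} (h : n ≤ m) (r : ℝ) :
    (fun q : ℝ × ℝ => q.1 ^ m) =O[smallOn r] fun q => q.1 ^ n := by
  refine (isBigO_smallOn_iff (f := fun ε _ => ε ^ m)).2 ⟨1, ?_⟩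
  filter_upwards [Ioo_mem_nhdsGT (zero_lt_one' ℝ)] with ε hε x _
  rw [Real.norm_of_nonneg (pow_nonneg hε.1.le m), one_mul]
  exact pow_le_pow_of_le_one hε.1.le hε.2.le h

theorem isBigO_one_smallOn {g : ℝ → ℝ} (hg : Continuous g) (r : ℝ) :
    (fun q : ℝ × ℝ => g q.2) =O[smallOn r] fun q => q.1 ^ 0 := by
  obtain ⟨K, hK⟩ := (isCompact_Icc (a := -r) (b := r)).exists_bound_of_continuousOn hg.continuousOn
  exact (isBigO_smallOn_iff (f := fun _ x => g x)).2
    ⟨K, Eventually.of_forall fun ε x hx => by simpa using hK x hx⟩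

/-- Coefficients of an expansion are unique, so exact identities between families may be read off as
identities over the dual numbers. -/
theorem eq_zero_of_isBigO {a b : ℝ}
    (h : (fun ε : ℝ => a + ε ^ 2 * b) =O[𝓝[>] 0] fun ε => ε ^ 3) : a = 0 ∧ b = 0 := by
  have hid : Tendsto (fun ε : ℝ => ε) (𝓝[>] 0) (𝓝 0) := tendsto_id.mono_left nhdsWithin_le_nhds
  have h3 : Tendsto (fun ε : ℝ => ε ^ 3) (𝓝[>] 0) (𝓝 0) := by simpa using hid.pow 3
  have ha : a = 0 := by
    refine tendsto_nhds_unique (f := fun ε : ℝ => a + ε ^ 2 * b) (l := 𝓝[>] 0) ?_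
      (h.trans_tendsto h3)
    simpa using ((hid.pow 2).mul_const b).const_add a
  refine ⟨ha, ?_⟩
  have h' : (fun _ : ℝ => b) =O[𝓝[>] 0] fun ε : ℝ => ε := by
    obtain ⟨K, hK⟩ := h.bound
    refine IsBigO.of_bound K ?_
    filter_upwards [hK, self_mem_nhdsWithin] with ε hε (hpos : 0 < ε)
    rw [ha, zero_add, norm_mul, Real.norm_of_nonneg (pow_pos hpos 2).le,
      Real.norm_of_nonneg (pow_pos hpos 3).le] at hε
    rw [Real.norm_of_nonneg hpos.le]
    have : 0 < ε ^ 2 := pow_pos hpos 2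
    nlinarith
  exact tendsto_nhds_unique tendsto_const_nhds (h'.trans_tendsto hid)

/-- `f_ε = f_0 + ε² f_2 + O(ε³)` uniformly on compact sets, where `F = f_0 + η f_2`. -/
def Approx (f : ℝ → ℝ → ℝ) (F : ℝ → DualNumber ℝ) : Prop :=
  ∀ r, (fun q : ℝ × ℝ => f q.1 q.2 - (F q.2).fst - q.1 ^ 2 * (F q.2).snd) =O[smallOn r]
    fun q => q.1 ^ 3

/-- The expansion holds for the derivatives of order at most `n`. -/
def ApproxTo : ℕ → (ℝ → ℝ → ℝ) → (ℝ → DualNumber ℝ) → Prop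
  | 0, f, F => Approx f F
  | n + 1, f, F => Approx f F ∧ ApproxTo n (fun ε => deriv (f ε)) (deriv F)

/-- The expansion holds for all derivatives of a smooth family. -/
structure Expands (f : ℝ → ℝ → ℝ) (F : ℝ → DualNumber ℝ) : Prop where
  smooth : ∀ᶠ ε in 𝓝[>] (0 : ℝ), ContDiff ℝ ∞ (f ε)
  coeff : ContDiff ℝ ∞ F
  approx : ∀ n, ApproxTo n f F

theorem ContDiff.deriv_infty {E : Type*} [NormedAddCommGroup E] [NormedSpace ℝ E] {f : ℝ → E}
    (hf : ContDiff ℝ ∞ f) : ContDiff ℝ ∞ (deriv f) :=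
  (contDiff_infty_iff_deriv.1 hf).2

theorem ContDiff.differentiable_infty {E : Type*} [NormedAddCommGroup E] [NormedSpace ℝ E]
    {f : ℝ → E} (hf : ContDiff ℝ ∞ f) : Differentiable ℝ f :=
  (contDiff_infty_iff_deriv.1 hf).1

theorem ContDiff.iteratedDeriv_infty {E : Type*} [NormedAddCommGroup E] [NormedSpace ℝ E]
    {f : ℝ → E} (hf : ContDiff ℝ ∞ f) (n : ℕ) : ContDiff ℝ ∞ (iteratedDeriv n f) := by
  rw [iteratedDeriv_eq_iterate]
  exact hf.iterate_deriv n

theorem continuous_fst_dual {F : ℝ → DualNumber ℝ} (hF : ContDiff ℝ ∞ F) :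
    Continuous fun x => (F x).fst :=
  (fstCLM ℝ ℝ).continuous.comp hF.continuous

theorem continuous_snd_dual {F : ℝ → DualNumber ℝ} (hF : ContDiff ℝ ∞ F) :
    Continuous fun x => (F x).snd :=
  (sndCLM ℝ ℝ).continuous.comp hF.continuous

theorem contDiff_fst_dual {F : ℝ → DualNumber ℝ} (hF : ContDiff ℝ ∞ F) :
    ContDiff ℝ ∞ fun x => (F x).fst :=
  (fstCLM ℝ ℝ).contDiff.comp hF

theorem contDiff_snd_dual {F : ℝ → DualNumber ℝ} (hF : ContDiff ℝ ∞ F) :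
    ContDiff ℝ ∞ fun x => (F x).snd :=
  (sndCLM ℝ ℝ).contDiff.comp hF

theorem contDiff_dual {f g : ℝ → ℝ} (hf : ContDiff ℝ ∞ f) (hg : ContDiff ℝ ∞ g) :
    ContDiff ℝ ∞ fun x => (inl (f x) + inr (g x) : DualNumber ℝ) :=
  ((inlCLM ℝ ℝ).contDiff.comp hf).add ((inrCLM ℝ ℝ).contDiff.comp hg)

theorem deriv_fst_dual {F : ℝ → DualNumber ℝ} (hF : ContDiff ℝ ∞ F) :
    deriv (fun x => (F x).fst) = fun x => (deriv F x).fst := by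
  funext x
  exact ((fstCLM ℝ ℝ).hasFDerivAt.comp_hasDerivAt x (hF.differentiable_infty x).hasDerivAt).deriv

theorem deriv_snd_dual {F : ℝ → DualNumber ℝ} (hF : ContDiff ℝ ∞ F) :
    deriv (fun x => (F x).snd) = fun x => (deriv F x).snd := by
  funext x
  exact ((sndCLM ℝ ℝ).hasFDerivAt.comp_hasDerivAt x (hF.differentiable_infty x).hasDerivAt).deriv

theorem iteratedDeriv_fst_dual {F : ℝ → DualNumber ℝ} (hF : ContDiff ℝ ∞ F) (n : ℕ) :
    iteratedDeriv n (fun x => (F x).fst) = fun x => (iteratedDeriv n F x).fst := by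
  induction n generalizing F with
  | zero => simp
  | succ n ih => rw [iteratedDeriv_succ', deriv_fst_dual hF, ih hF.deriv_infty, iteratedDeriv_succ']

theorem iteratedDeriv_snd_dual {F : ℝ → DualNumber ℝ} (hF : ContDiff ℝ ∞ F) (n : ℕ) :
    iteratedDeriv n (fun x => (F x).snd) = fun x => (iteratedDeriv n F x).snd := by
  induction n generalizing F with
  | zero => simp
  | succ n ih => rw [iteratedDeriv_succ', deriv_snd_dual hF, ih hF.deriv_infty, iteratedDeriv_succ']

/-! ### Algebra of second order expansions -/

namespace Approx

variable {f g : ℝ → ℝ → ℝ} {F G : ℝ → DualNumber ℝ}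

theorem congr (h : ∀ᶠ ε in 𝓝[>] (0 : ℝ), f ε = g ε) (hf : Approx f F) : Approx g F := by
  intro r
  refine (hf r).congr' ?_ EventuallyEq.rfl
  have := eventually_smallOn (r := r) (p := fun ε x => f ε x = g ε x)
  refine (this.2 (h.mono fun ε hε x _ => by rw [hε])).mono fun q hq => ?_
  dsimp only
  rw [hq]

theorem add (hf : Approx f F) (hg : Approx g G) :
    Approx (fun ε x => f ε x + g ε x) (fun x => F x + G x) := by
  intro r
  refine ((hf r).add (hg r)).congr_left fun q => ?_
  simp only [fst_add, snd_add]
  ring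

theorem isBigO_coeff (hf : Approx f F) (hF : ContDiff ℝ ∞ F) (r : ℝ) :
    (fun q : ℝ × ℝ => f q.1 q.2 - (F q.2).fst) =O[smallOn r] fun q => q.1 ^ 2 := by
  have h1 := (hf r).trans (isBigO_pow_smallOn (show 2 ≤ 3 by norm_num) r)
  have h2 := (isBigO_refl (fun q : ℝ × ℝ => q.1 ^ 2) (smallOn r)).mul
    (isBigO_one_smallOn (continuous_snd_dual hF) r)
  simp only [pow_zero, mul_one] at h2
  exact (h1.add h2).congr_left fun q => by ring

theorem isBigO_one (hf : Approx f F) (hF : ContDiff ℝ ∞ F) (r : ℝ) :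
    (fun q : ℝ × ℝ => f q.1 q.2) =O[smallOn r] fun q => q.1 ^ 0 := by
  have h1 := (hf.isBigO_coeff hF r).trans (isBigO_pow_smallOn (Nat.zero_le 2) r)
  exact (h1.add (isBigO_one_smallOn (continuous_fst_dual hF) r)).congr_left fun q => by ring

/-- The error is `(f - f_0 - ε² f_2) g + f_0 (g - g_0 - ε² g_2) + ε² f_2 (g - g_0)`. Its last term
is `O(ε⁴)` because there is no term linear in `ε`; this is the analytic content of `η² = 0`. -/
theorem mul (hf : Approx f F) (hg : Approx g G) (hF : ContDiff ℝ ∞ F) (hG : ContDiff ℝ ∞ G) :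
    Approx (fun ε x => f ε x * g ε x) (fun x => F x * G x) := by
  intro r
  have h1 := (hf r).mul (hg.isBigO_one hG r)
  have h2 := (isBigO_one_smallOn (continuous_fst_dual hF) r).mul (hg r)
  have h3 := ((isBigO_refl (fun q : ℝ × ℝ => q.1 ^ 2) (smallOn r)).mul
    (isBigO_one_smallOn (continuous_snd_dual hF) r)).mul (hg.isBigO_coeff hG r)
  have h4 := isBigO_pow_smallOn (show 3 ≤ 4 by norm_num) r
  simp only [pow_zero, mul_one, one_mul] at h1 h2 h3
  have h3' : _ =O[smallOn r] fun q : ℝ × ℝ => q.1 ^ 4 := h3.congr_right fun q => by ring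
  refine ((h1.add h2).add (h3'.trans h4)).congr_left fun q => ?_
  simp only [fst_mul, snd_mul, smul_eq_mul, MulOpposite.smul_eq_mul_unop, MulOpposite.unop_op]
  ring

theorem at_point (hf : Approx f F) (x : ℝ) :
    (fun ε : ℝ => f ε x - (F x).fst - ε ^ 2 * (F x).snd) =O[𝓝[>] 0] fun ε => ε ^ 3 := by
  obtain ⟨K, hK⟩ := (isBigO_smallOn_iff
    (f := fun ε x => f ε x - (F x).fst - ε ^ 2 * (F x).snd)).1 (hf |x|)
  refine IsBigO.of_bound K ?_
  filter_upwards [hK, self_mem_nhdsWithin] with ε hε hpos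
  rw [Real.norm_of_nonneg (pow_nonneg (le_of_lt hpos) 3)]
  exact hε x ⟨neg_abs_le x, le_abs_self x⟩

/-- Allowing two different points lets periodicity of a family pass to its coefficients. -/
theorem unique_at {x y : ℝ} (hf : Approx f F) (hg : Approx g G)
    (h : ∀ᶠ ε in 𝓝[>] (0 : ℝ), f ε x = g ε y) : F x = G y := by
  have h' := ((hf.at_point x).sub (hg.at_point y)).congr' (f₂ := fun ε : ℝ =>
    ((G y).fst - (F x).fst) + ε ^ 2 * ((G y).snd - (F x).snd))
    (h.mono fun ε hε => by simp only [hε]; ring) EventuallyEq.rfl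
  obtain ⟨h1, h2⟩ := eq_zero_of_isBigO h'
  exact TrivSqZeroExt.ext (by linarith) (by linarith)

theorem unique (hf : Approx f F) (hg : Approx g G) (h : ∀ᶠ ε in 𝓝[>] (0 : ℝ), f ε = g ε) :
    F = G :=
  funext fun _ => hf.unique_at hg (h.mono fun _ hε => by rw [hε])

theorem eventually_dist_lt (hf : Approx f F) (hF : ContDiff ℝ ∞ F) (r : ℝ) {δ : ℝ} (hδ : 0 < δ) :
    ∀ᶠ ε in 𝓝[>] (0 : ℝ), ∀ x ∈ Set.Icc (-r) r, |f ε x - (F x).fst| < δ := by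
  obtain ⟨K, hK⟩ := (isBigO_smallOn_iff (f := fun ε x => f ε x - (F x).fst)).1
    (hf.isBigO_coeff hF r)
  have ht : Tendsto (fun ε : ℝ => K * ε ^ 2) (𝓝[>] 0) (𝓝 0) := by
    have hid : Tendsto (fun ε : ℝ => ε) (𝓝[>] 0) (𝓝 0) := tendsto_id.mono_left nhdsWithin_le_nhds
    simpa using (hid.pow 2).const_mul K
  filter_upwards [hK, ht.eventually_lt_const hδ] with ε h1 h2 x hx
  exact (h1 x hx).trans_lt h2

end Approx

namespace ApproxTo

variable {f g : ℝ → ℝ → ℝ} {F G : ℝ → DualNumber ℝ} {n : ℕ}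

theorem congr (h : ∀ᶠ ε in 𝓝[>] (0 : ℝ), f ε = g ε) (hf : ApproxTo n f F) : ApproxTo n g F := by
  induction n generalizing f g F with
  | zero => exact Approx.congr h hf
  | succ n ih => exact ⟨hf.1.congr h, ih (h.mono fun ε hε => by rw [hε]) hf.2⟩

theorem of_succ (h : ApproxTo (n + 1) f F) : ApproxTo n f F := by
  induction n generalizing f F with
  | zero => exact h.1
  | succ n ih => exact ⟨h.1, ih h.2⟩

theorem add (hf : ApproxTo n f F) (hg : ApproxTo n g G)
    (sf : ∀ᶠ ε in 𝓝[>] (0 : ℝ), ContDiff ℝ ∞ (f ε))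
    (sg : ∀ᶠ ε in 𝓝[>] (0 : ℝ), ContDiff ℝ ∞ (g ε)) (hF : ContDiff ℝ ∞ F) (hG : ContDiff ℝ ∞ G) :
    ApproxTo n (fun ε x => f ε x + g ε x) (fun x => F x + G x) := by
  induction n generalizing f g F G with
  | zero => exact Approx.add hf hg
  | succ n ih =>
    refine ⟨hf.1.add hg.1, ?_⟩
    have e : deriv (fun x => F x + G x) = fun x => deriv F x + deriv G x :=
      funext fun x => deriv_fun_add (hF.differentiable_infty x) (hG.differentiable_infty x)
    rw [e]
    refine (ih hf.2 hg.2 (sf.mono fun _ h => h.deriv_infty) (sg.mono fun _ h => h.deriv_infty)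
      hF.deriv_infty hG.deriv_infty).congr ?_
    filter_upwards [sf, sg] with ε h1 h2
    exact funext fun x =>
      (deriv_fun_add (h1.differentiable_infty x) (h2.differentiable_infty x)).symm

theorem mul (hf : ApproxTo n f F) (hg : ApproxTo n g G)
    (sf : ∀ᶠ ε in 𝓝[>] (0 : ℝ), ContDiff ℝ ∞ (f ε))
    (sg : ∀ᶠ ε in 𝓝[>] (0 : ℝ), ContDiff ℝ ∞ (g ε)) (hF : ContDiff ℝ ∞ F) (hG : ContDiff ℝ ∞ G) :
    ApproxTo n (fun ε x => f ε x * g ε x) (fun x => F x * G x) := by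
  induction n generalizing f g F G with
  | zero => exact Approx.mul hf hg hF hG
  | succ n ih =>
    refine ⟨hf.1.mul hg.1 hF hG, ?_⟩
    have e : deriv (fun x => F x * G x) = fun x => deriv F x * G x + F x * deriv G x :=
      funext fun x => deriv_fun_mul (hF.differentiable_infty x) (hG.differentiable_infty x)
    rw [e]
    have sf' := sf.mono fun _ h => h.deriv_infty
    have sg' := sg.mono fun _ h => h.deriv_infty
    refine ((ih hf.2 hg.of_succ sf' sg hF.deriv_infty hG).add
      (ih hf.of_succ hg.2 sf sg' hF hG.deriv_infty) ?_ ?_ (hF.deriv_infty.mul hG)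
      (hF.mul hG.deriv_infty)).congr ?_
    · filter_upwards [sf', sg] with ε h1 h2 using h1.mul h2
    · filter_upwards [sf, sg'] with ε h1 h2 using h1.mul h2
    · filter_upwards [sf, sg] with ε h1 h2
      exact funext fun x =>
        (deriv_fun_mul (h1.differentiable_infty x) (h2.differentiable_infty x)).symm

end ApproxTo

namespace Expands

variable {f g : ℝ → ℝ → ℝ} {F G : ℝ → DualNumber ℝ}

theorem toApprox (hf : Expands f F) : Approx f F := hf.approx 0

theorem congr (h : ∀ᶠ ε in 𝓝[>] (0 : ℝ), f ε = g ε) (hf : Expands f F) : Expands g F where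
  smooth := by filter_upwards [h, hf.smooth] with ε h1 h2 using h1 ▸ h2
  coeff := hf.coeff
  approx n := (hf.approx n).congr h

theorem const_family {f : ℝ → ℝ} (hf : ContDiff ℝ ∞ f) :
    Expands (fun _ => f) fun x => inl (f x) where
  smooth := Eventually.of_forall fun _ => hf
  coeff := (inlCLM ℝ ℝ).contDiff.comp hf
  approx n := by
    have base : ∀ f : ℝ → ℝ, Approx (fun _ => f) fun x => inl (f x) := fun f r =>
      (isBigO_zero _ _).congr_left fun q => by simp
    induction n generalizing f with
    | zero => exact base f
    | succ n ih =>
      refine ⟨base f, ?_⟩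
      have e : deriv (fun x => (inl (f x) : DualNumber ℝ)) = fun x => inl (deriv f x) :=
        funext fun x => ((inlCLM ℝ ℝ).hasFDerivAt.comp_hasDerivAt x
          (hf.differentiable_infty x).hasDerivAt).deriv
      rw [e]
      exact ih hf.deriv_infty

theorem const (c : ℝ) : Expands (fun _ _ => c) fun _ => inl c :=
  const_family contDiff_const

theorem add (hf : Expands f F) (hg : Expands g G) :
    Expands (fun ε x => f ε x + g ε x) (fun x => F x + G x) where
  smooth := by filter_upwards [hf.smooth, hg.smooth] with ε h1 h2 using h1.add h2
  coeff := hf.coeff.add hg.coeff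
  approx n := (hf.approx n).add (hg.approx n) hf.smooth hg.smooth hf.coeff hg.coeff

theorem mul (hf : Expands f F) (hg : Expands g G) :
    Expands (fun ε x => f ε x * g ε x) (fun x => F x * G x) where
  smooth := by filter_upwards [hf.smooth, hg.smooth] with ε h1 h2 using h1.mul h2
  coeff := hf.coeff.mul hg.coeff
  approx n := (hf.approx n).mul (hg.approx n) hf.smooth hg.smooth hf.coeff hg.coeff

theorem sum {ι : Type*} (s : Finset ι) {f : ι → ℝ → ℝ → ℝ} {F : ι → ℝ → DualNumber ℝ}
    (h : ∀ i ∈ s, Expands (f i) (F i)) :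
    Expands (fun ε x => ∑ i ∈ s, f i ε x) (fun x => ∑ i ∈ s, F i x) := by
  classical
  induction s using Finset.induction_on with
  | empty => simpa using const 0
  | insert a s ha ih =>
    simp only [Finset.sum_insert ha]
    exact (h a (by simp)).add (ih fun i hi => h i (by simp [hi]))

theorem prod {ι : Type*} (s : Finset ι) {f : ι → ℝ → ℝ → ℝ} {F : ι → ℝ → DualNumber ℝ}
    (h : ∀ i ∈ s, Expands (f i) (F i)) :
    Expands (fun ε x => ∏ i ∈ s, f i ε x) (fun x => ∏ i ∈ s, F i x) := by
  classical
  induction s using Finset.induction_on with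
  | empty => simpa using const 1
  | insert a s ha ih =>
    simp only [Finset.prod_insert ha]
    exact (h a (by simp)).mul (ih fun i hi => h i (by simp [hi]))

theorem det {ι : Type*} [Fintype ι] [DecidableEq ι] {A : ℝ → ℝ → Matrix ι ι ℝ}
    {𝒜 : ℝ → Matrix ι ι (DualNumber ℝ)}
    (h : ∀ i j, Expands (fun ε x => A ε x i j) fun x => 𝒜 x i j) :
    Expands (fun ε x => (A ε x).det) fun x => (𝒜 x).det := by
  simp only [Matrix.det_apply']
  refine sum _ fun σ _ => Expands.mul ?_ (prod _ fun i _ => h _ _)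
  simpa using const ((Equiv.Perm.sign σ : ℤ) : ℝ)

/-- A cofactor is the determinant of the matrix with one row replaced by a unit vector, whose
entries expand trivially. -/
theorem adjugate {ι : Type*} [Fintype ι] [DecidableEq ι] {A : ℝ → ℝ → Matrix ι ι ℝ}
    {𝒜 : ℝ → Matrix ι ι (DualNumber ℝ)}
    (h : ∀ i j, Expands (fun ε x => A ε x i j) fun x => 𝒜 x i j) (i j : ι) :
    Expands (fun ε x => (A ε x).adjugate i j) fun x => (𝒜 x).adjugate i j := by
  simp only [Matrix.adjugate_apply]
  refine det fun k l => ?_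
  by_cases hk : k = j
  · subst hk
    simp only [Matrix.updateRow_self]
    by_cases hl : l = i
    · subst hl
      simpa using const 1
    · simpa [hl] using const 0
  · simpa [Matrix.updateRow_ne hk] using h k l

theorem deriv (hf : Expands f F) : Expands (fun ε => _root_.deriv (f ε)) (_root_.deriv F) where
  smooth := hf.smooth.mono fun _ h => h.deriv_infty
  coeff := hf.coeff.deriv_infty
  approx n := (hf.approx (n + 1)).2

theorem iteratedDeriv (hf : Expands f F) (n : ℕ) :
    Expands (fun ε => _root_.iteratedDeriv n (f ε)) (_root_.iteratedDeriv n F) := by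
  induction n generalizing f F with
  | zero => simpa only [iteratedDeriv_zero] using hf
  | succ n ih => simpa only [iteratedDeriv_succ'] using ih hf.deriv

theorem hasSecondOrderExpansion (hf : Expands f F) :
    HasSecondOrderExpansion f (fun x => (F x).fst) fun x => (F x).snd := by
  intro i r
  rw [iteratedDeriv_fst_dual hf.coeff, iteratedDeriv_snd_dual hf.coeff]
  exact (isBigO_smallOn_iff (f := fun ε x => _root_.iteratedDeriv i (f ε) x -
    (_root_.iteratedDeriv i F x).fst - ε ^ 2 • (_root_.iteratedDeriv i F x).snd)).1
    ((hf.iteratedDeriv i).toApprox r)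

theorem tendsto (hf : Expands f F) (x : ℝ) :
    Tendsto (fun ε => f ε x) (𝓝[>] 0) (𝓝 (F x).fst) := by
  rw [Metric.tendsto_nhds]
  intro δ hδ
  filter_upwards [hf.toApprox.eventually_dist_lt hf.coeff |x| hδ] with ε h
  exact h x ⟨neg_abs_le x, le_abs_self x⟩

theorem periodic (hf : Expands f F) {T : ℝ} (h : ∀ᶠ ε in 𝓝[>] (0 : ℝ), Function.Periodic (f ε) T) :
    Function.Periodic F T := fun x =>
  hf.toApprox.unique_at hf.toApprox (h.mono fun _ hε => hε x)

end Expands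

/-! ### Real powers of expansions -/

theorem rpow_sub_linear_isBigO (p : ℝ) :
    (fun t : ℝ => (1 + t) ^ p - 1 - p * t) =O[𝓝 0] fun t => t ^ 2 := by
  have h1 : HasDerivAt (fun t : ℝ => (1 + t) ^ (p - 1)) ((p - 1) * (1 + 0) ^ (p - 1 - 1)) 0 := by
    have := ((hasDerivAt_id (0 : ℝ)).const_add 1).rpow_const (p := p - 1) (Or.inl (by simp))
    simpa using this
  obtain ⟨K, hK⟩ := h1.isBigO_sub.bound
  obtain ⟨δ, hδ, hball⟩ := Metric.eventually_nhds_iff_ball.1 hK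
  refine IsBigO.of_bound (|p| * K) ?_
  filter_upwards [Metric.ball_mem_nhds (0 : ℝ) (lt_min hδ one_pos)] with t ht
  -- The derivative of the remainder is `p((1 + s)^(p-1) - 1) = O(s)`; the mean value inequality on
  -- the ball of radius `|t|` supplies the second factor `|t|`.
  have hd : ∀ s ∈ Metric.closedBall (0 : ℝ) |t|, HasDerivWithinAt
      (fun t : ℝ => (1 + t) ^ p - 1 - p * t) (p * ((1 + s) ^ (p - 1) - 1))
      (Metric.closedBall 0 |t|) s := by
    intro s hs
    have hs1 : |s| < 1 := by
      have h1 : |s| ≤ |t| := by simpa using hs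
      have h2 : |t| < min δ 1 := by simpa using ht
      exact h1.trans_lt (h2.trans_le (min_le_right _ _))
    have hs2 : (1 : ℝ) + s ≠ 0 := by have := (abs_lt.1 hs1).1; linarith
    have := ((((hasDerivAt_id s).const_add 1).rpow_const (p := p) (Or.inl hs2)).sub_const 1).sub
      ((hasDerivAt_id s).const_mul p)
    refine (this.congr_deriv ?_).hasDerivWithinAt
    simp
    ring
  have hb : ∀ s ∈ Metric.closedBall (0 : ℝ) |t|, ‖p * ((1 + s) ^ (p - 1) - 1)‖ ≤ |p| * (K * |t|) := by
    intro s hs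
    have h1 : |s| ≤ |t| := by simpa using hs
    have h2 : |t| < min δ 1 := by simpa using ht
    have h3 := hball s (by simpa using h1.trans_lt (h2.trans_le (min_le_left _ _)))
    have h4 := hball t (by simpa using h2.trans_le (min_le_left _ _))
    simp only [add_zero, Real.one_rpow, sub_zero, Real.norm_eq_abs] at h3 h4
    rw [norm_mul, Real.norm_eq_abs, Real.norm_eq_abs]
    gcongr
    refine h3.trans ?_
    rcases (abs_nonneg t).eq_or_lt with h0 | h0
    · rw [← h0] at h1 ⊢
      rw [le_antisymm h1 (abs_nonneg s)]
    · have hK0 : 0 ≤ K := by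
        by_contra hneg
        have := (abs_nonneg _).trans h4
        nlinarith
      gcongr
  have := (convex_closedBall (0 : ℝ) |t|).norm_image_sub_le_of_norm_hasDerivWithin_le hd hb
    (x := 0) (y := t) (by simp) (by simp)
  simp only [add_zero, Real.one_rpow, sub_self, mul_zero, sub_zero, Real.norm_eq_abs] at this
  rw [Real.norm_eq_abs, Real.norm_eq_abs, abs_pow, pow_two]
  linarith

theorem Approx.rpow {g : ℝ → ℝ → ℝ} {G : ℝ → DualNumber ℝ} (hg : Approx g G) (hG : ContDiff ℝ ∞ G)
    (h1 : ∀ x, (G x).fst = 1) (p : ℝ) :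
    Approx (fun ε x => g ε x ^ p) fun x => inl 1 + inr (p * (G x).snd) := by
  intro r
  have ht := hg.isBigO_coeff hG r
  simp only [h1] at ht
  have h0 : Tendsto (fun q : ℝ × ℝ => g q.1 q.2 - 1) (smallOn r) (𝓝 0) := by
    refine ht.trans_tendsto ?_
    have hid : Tendsto (fun ε : ℝ => ε) (𝓝[>] 0) (𝓝 0) := tendsto_id.mono_left nhdsWithin_le_nhds
    have : Tendsto (fun q : ℝ × ℝ => q.1) (smallOn r) (𝓝 0) := hid.comp tendsto_fst
    simpa using this.pow 2
  have h2 := ((rpow_sub_linear_isBigO p).comp_tendsto h0).trans (ht.pow 2)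
  have h3 : (fun q : ℝ × ℝ => (q.1 ^ 2) ^ 2) =O[smallOn r] fun q => q.1 ^ 3 := by
    simpa only [← pow_mul] using isBigO_pow_smallOn (show 3 ≤ 2 * 2 by norm_num) r
  have h4 := (hg r).const_mul_left p
  refine ((h2.trans h3).add h4).congr_left fun q => ?_
  simp [h1]
  ring

/-- The derivative of `g^p` is `p g^(p-1) g'`, so the induction on the number of derivatives needs
all exponents at once. -/
theorem Expands.rpow {g : ℝ → ℝ → ℝ} {G : ℝ → DualNumber ℝ} (hg : Expands g G)
    (h1 : ∀ x, (G x).fst = 1) (hpos : ∀ᶠ ε in 𝓝[>] (0 : ℝ), ∀ x, 0 < g ε x) (p : ℝ) :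
    Expands (fun ε x => g ε x ^ p) fun x => inl 1 + inr (p * (G x).snd) := by
  have hsm : ∀ p : ℝ, ∀ᶠ ε in 𝓝[>] (0 : ℝ), ContDiff ℝ ∞ fun x => g ε x ^ p := fun p => by
    filter_upwards [hg.smooth, hpos] with ε hs hp
    exact hs.rpow_const_of_ne fun x => (hp x).ne'
  have hcf : ∀ p : ℝ, ContDiff ℝ ∞ fun x => (inl 1 + inr (p * (G x).snd) : DualNumber ℝ) :=
    fun p => contDiff_dual contDiff_const (contDiff_const.mul (contDiff_snd_dual hg.coeff))
  refine ⟨hsm p, hcf p, fun n => ?_⟩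
  induction n generalizing p with
  | zero => exact hg.toApprox.rpow hg.coeff h1 p
  | succ n ih =>
    refine ⟨hg.toApprox.rpow hg.coeff h1 p, ?_⟩
    have hd1 : ∀ x, (_root_.deriv G x).fst = 0 := fun x => by
      have := congrFun (deriv_fst_dual hg.coeff) x
      simp only [h1, deriv_const] at this
      exact this.symm
    -- `G` has constant real part `1`, so its derivative is a multiple of `η` and kills the `η` part
    -- of the factor representing `g^(p-1)`.
    have e : _root_.deriv (fun x => (inl 1 + inr (p * (G x).snd) : DualNumber ℝ)) =
        fun x => inl p * ((inl 1 + inr ((p - 1) * (G x).snd)) * _root_.deriv G x) := by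
      funext x
      have := ((inrCLM ℝ ℝ).hasFDerivAt.comp_hasDerivAt x
        (((contDiff_snd_dual hg.coeff).differentiable_infty x).hasDerivAt.const_mul p)).const_add
          (inl 1 : DualNumber ℝ)
      refine this.deriv.trans ?_
      rw [congrFun (deriv_snd_dual hg.coeff) x]
      refine TrivSqZeroExt.ext ?_ ?_ <;> simp [hd1]
    rw [e]
    have hc := (Expands.const p).approx n
    have hg' := hg.deriv
    refine (hc.mul ((ih (p - 1)).mul (hg'.approx n) (hsm _) hg'.smooth (hcf _) hg'.coeff)
      (Expands.const p).smooth ?_ (Expands.const p).coeff ((hcf _).mul hg'.coeff)).congr ?_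
    · filter_upwards [hsm (p - 1), hg'.smooth] with ε h2 h3 using h2.mul h3
    · filter_upwards [hg.smooth, hpos] with ε hs hp
      funext x
      rw [((hs.differentiable_infty x).hasDerivAt.rpow_const (p := p) (Or.inl (hp x).ne')).deriv]
      ring

end Expansion

/-! ### Confluent nodes -/

section Nodes

open Asymptotics TrivSqZeroExt

/-- As a function of `ε`, the remainder of order `n + 1` for `g` vanishes at `0` and has derivative
`k` times the remainder of order `n` for `g'`. Integrating the bound keeps it uniform in `x`. -/
theorem taylor_bound (n : ℕ) {g : ℝ → ℝ} (hg : ContDiff ℝ ∞ g) (k r : ℝ) :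
    ∃ K : ℝ, ∀ ε ∈ Set.Icc (0 : ℝ) 1, ∀ x ∈ Set.Icc (-r) r,
      |g (x + k * ε) - ∑ j ∈ Finset.range n,
        (k * ε) ^ j / (j.factorial : ℝ) * iteratedDeriv j g x| ≤ K * ε ^ n := by
  induction n generalizing g with
  | zero =>
    obtain ⟨K, hK⟩ := (isCompact_Icc (a := -(r + |k|)) (b := r + |k|)).exists_bound_of_continuousOn
      hg.continuous.continuousOn
    refine ⟨K, fun ε hε x hx => ?_⟩
    simp only [Finset.range_zero, Finset.sum_empty, sub_zero, pow_zero, mul_one]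
    refine hK _ ?_
    have h1 : |k * ε| ≤ |k| := by
      rw [abs_mul, abs_of_nonneg hε.1]
      exact mul_le_of_le_one_right (abs_nonneg _) hε.2
    have := abs_le.1 h1
    exact ⟨by linarith [hx.1], by linarith [hx.2]⟩
  | succ n ih =>
    obtain ⟨K, hK⟩ := ih hg.deriv_infty
    refine ⟨|k| * K, fun ε hε x hx => ?_⟩
    have hd : ∀ t ∈ Set.Icc (0 : ℝ) ε, HasDerivWithinAt (fun t => g (x + k * t) -
        ∑ j ∈ Finset.range (n + 1), (k * t) ^ j / (j.factorial : ℝ) * iteratedDeriv j g x)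
        (k * (deriv g (x + k * t) - ∑ j ∈ Finset.range n,
          (k * t) ^ j / (j.factorial : ℝ) * iteratedDeriv j (deriv g) x)) (Set.Icc 0 ε) t := by
      intro t _
      have h1 : HasDerivAt (fun t => g (x + k * t)) (deriv g (x + k * t) * k) t := by
        have h2 : HasDerivAt (fun t : ℝ => x + k * t) k t := by
          simpa using ((hasDerivAt_id t).const_mul k).const_add x
        exact (hg.differentiable_infty _).hasDerivAt.comp t h2
      have h3 : HasDerivAt (fun t => ∑ j ∈ Finset.range (n + 1),
          (k * t) ^ j / (j.factorial : ℝ) * iteratedDeriv j g x)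
          (∑ j ∈ Finset.range n,
            k * ((k * t) ^ j / (j.factorial : ℝ) * iteratedDeriv j (deriv g) x)) t := by
        simp only [Finset.sum_range_succ' _ n, pow_zero]
        refine HasDerivAt.add_const _ (HasDerivAt.fun_sum fun j _ => ?_)
        have h4 : HasDerivAt (fun t : ℝ => (k * t) ^ (j + 1)) (((j : ℝ) + 1) * (k * t) ^ j * k) t := by
          simpa using ((hasDerivAt_id t).const_mul k).fun_pow (j + 1)
        refine ((h4.div_const _).mul_const _).congr_deriv ?_
        rw [iteratedDeriv_succ', Nat.factorial_succ]
        have : (j.factorial : ℝ) ≠ 0 := by positivity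
        have : (j : ℝ) + 1 ≠ 0 := by positivity
        push_cast
        field_simp
      refine ((h1.sub h3).congr_deriv ?_).hasDerivWithinAt
      rw [← Finset.mul_sum]
      ring
    have hb : ∀ t ∈ Set.Icc (0 : ℝ) ε, ‖k * (deriv g (x + k * t) - ∑ j ∈ Finset.range n,
          (k * t) ^ j / (j.factorial : ℝ) * iteratedDeriv j (deriv g) x)‖ ≤ |k| * (K * ε ^ n) := by
      intro t ht
      have h1 := hK t ⟨ht.1, ht.2.trans hε.2⟩ x hx
      have h2 := hK ε hε x hx
      rw [norm_mul, Real.norm_eq_abs, Real.norm_eq_abs]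
      refine mul_le_mul_of_nonneg_left (h1.trans ?_) (abs_nonneg k)
      rcases hε.1.eq_or_lt with h0 | h0
      · rw [le_antisymm (ht.2.trans h0.ge) ht.1, ← h0]
      · have hK0 : 0 ≤ K := by
          by_contra hneg
          have h3 := (abs_nonneg _).trans h2
          have : 0 < ε ^ n := pow_pos h0 n
          nlinarith
        exact mul_le_mul_of_nonneg_left (pow_le_pow_left₀ ht.1 ht.2 n) hK0
    have := (convex_Icc (0 : ℝ) ε).norm_image_sub_le_of_norm_hasDerivWithin_le hd hb
      (x := 0) (y := ε) ⟨le_rfl, hε.1⟩ ⟨hε.1, le_rfl⟩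
    have h0 : ∑ j ∈ Finset.range (n + 1), (k * 0) ^ j / (j.factorial : ℝ) * iteratedDeriv j g x =
        g x := by
      simp [Finset.sum_range_succ']
    rw [h0, mul_zero, add_zero, sub_self, sub_zero, sub_zero, Real.norm_eq_abs, Real.norm_eq_abs,
      abs_of_nonneg hε.1] at this
    rw [pow_succ]
    linarith

variable {d : ℕ}

/-- The weights for which `∑ l, nodeWeight k i l * p (k l)` is the `i`-th derivative at `0` of every
polynomial `p` of degree less than `d`. -/
noncomputable def nodeWeight (k : Fin d → ℝ) : Matrix (Fin d) (Fin d) ℝ :=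
  Matrix.diagonal (fun i : Fin d => ((i : ℕ).factorial : ℝ)) * (Matrix.vandermonde k)⁻¹

noncomputable def nodeMoment (k : Fin d → ℝ) (i : Fin d) (n : ℕ) : ℝ :=
  ∑ l, nodeWeight k i l * k l ^ n

theorem det_nodeWeight_ne_zero {k : Fin d → ℝ} (hk : Function.Injective k) :
    (nodeWeight k).det ≠ 0 := by
  rw [nodeWeight, Matrix.det_mul, Matrix.det_diagonal, Matrix.det_nonsing_inv]
  refine mul_ne_zero (Finset.prod_ne_zero_iff.2 fun i _ => by positivity) ?_
  rw [Ring.inverse_eq_inv']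
  exact inv_ne_zero (Matrix.det_vandermonde_ne_zero_iff.2 hk)

/-- These are the entries of the product of the weights with the Vandermonde matrix that they
invert, up to the factor `i!`. -/
theorem nodeMoment_of_lt {k : Fin d → ℝ} (hk : Function.Injective k) (i : Fin d) {n : ℕ}
    (hn : n < d) : nodeMoment k i n = if (i : ℕ) = n then ((i : ℕ).factorial : ℝ) else 0 := by
  have hdet : IsUnit (Matrix.vandermonde k).det :=
    isUnit_iff_ne_zero.2 (Matrix.det_vandermonde_ne_zero_iff.2 hk)
  have h : (nodeWeight k * Matrix.vandermonde k) i ⟨n, hn⟩ =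
      (Matrix.diagonal (fun i : Fin d => ((i : ℕ).factorial : ℝ))) i ⟨n, hn⟩ := by
    rw [nodeWeight, Matrix.mul_assoc, Matrix.nonsing_inv_mul _ hdet, Matrix.mul_one]
  rw [Matrix.mul_apply, Matrix.diagonal_apply] at h
  simpa [nodeMoment, Matrix.vandermonde_apply, Fin.ext_iff] using h

-- The first moment beyond the reach of interpolation: at each node the polynomial `∏ (X - k_l)`
-- vanishes, which expresses `k_l^d` through lower powers.
open Polynomial in
theorem nodeMoment_self {k : Fin d → ℝ} (hk : Function.Injective k) (i : Fin d) :
    nodeMoment k i d = -((i : ℕ).factorial * (∏ l, (X - C (k l))).coeff i) := by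
  set p : ℝ[X] := ∏ l, (X - C (k l)) with hp
  have hdeg : p.natDegree = d := by
    rw [hp, natDegree_prod_of_monic _ _ fun l _ => monic_X_sub_C (k l)]
    simp
  have hmon : p.Monic := monic_prod_of_monic _ _ fun l _ => monic_X_sub_C _
  have h0 : ∀ l, k l ^ d = -∑ n ∈ Finset.range d, p.coeff n * k l ^ n := by
    intro l
    have h1 : p.eval (k l) = 0 := by
      rw [hp, eval_prod]
      exact Finset.prod_eq_zero (Finset.mem_univ l) (by simp)
    rw [eval_eq_sum_range, hdeg, Finset.sum_range_succ] at h1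
    have h2 : p.coeff d = 1 := by rw [← hdeg]; exact hmon
    rw [h2] at h1
    linarith
  have h1 : nodeMoment k i d = -∑ n ∈ Finset.range d, p.coeff n * nodeMoment k i n := by
    simp only [nodeMoment, h0, Finset.mul_sum]
    rw [Finset.sum_comm, ← Finset.sum_neg_distrib]
    refine Finset.sum_congr rfl fun l _ => ?_
    rw [mul_neg, Finset.mul_sum]
    congr 1
    exact Finset.sum_congr rfl fun n _ => by ring
  rw [h1, Finset.sum_eq_single (i : ℕ)]
  · rw [nodeMoment_of_lt hk i i.2, if_pos rfl, mul_comm]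
  · intro n hn hne
    rw [nodeMoment_of_lt hk i (Finset.mem_range.1 hn), if_neg hne.symm, mul_zero]
  · intro h
    exact absurd (Finset.mem_range.2 i.2) h

/-- The coefficient of the second order term of the `i`-th divided difference. -/
noncomputable def nodeCoeff (k : Fin d → ℝ) (i : Fin d) : ℝ :=
  nodeMoment k i (i + 2) / ((i + 2 : ℕ).factorial : ℝ)

/-- This is the coefficient responsible for a term linear in `ε`. For `i < d - 1` interpolation is
exact; for `i = d - 1` the moment is a multiple of `∑ k_l`. -/
theorem nodeMoment_succ {k : Fin d → ℝ} (hk : Function.Injective k) (hsum : ∑ l, k l = 0)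
    (i : Fin d) : nodeMoment k i (i + 1) = 0 := by
  rcases (Nat.succ_le_of_lt i.2).lt_or_eq with h | h
  · rw [nodeMoment_of_lt hk i h, if_neg (by omega)]
  · have h' : (i : ℕ) = d - 1 := by omega
    rw [show (i : ℕ) + 1 = d from h, nodeMoment_self hk, h']
    have := Polynomial.prod_X_sub_C_coeff_card_pred Finset.univ k (by simp; omega)
    rw [Finset.card_univ, Fintype.card_fin] at this
    rw [this, hsum]
    simp

/-- Newton's identity with vanishing first power sum. -/
theorem esymm_two_nodes (k : Fin d → ℝ) (hsum : ∑ l, k l = 0) :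
    2 * (Finset.univ.val.map k).esymm 2 = -∑ l, k l ^ 2 := by
  have h := congrArg (MvPolynomial.aeval k) (MvPolynomial.mul_esymm_eq_sum (Fin d) ℝ 2)
  rw [map_mul, MvPolynomial.aeval_esymm_eq_multiset_esymm] at h
  have e : (Finset.HasAntidiagonal.antidiagonal (2 : ℕ)).filter (fun a => a.1 < 2) =
      {(0, 2), (1, 1)} := by decide
  rw [e, Finset.sum_pair (by decide)] at h
  simpa [MvPolynomial.psum, MvPolynomial.esymm_one, hsum, pow_succ] using h

/-- For `i = d - 2` the coefficient is a nonzero multiple of the second elementary symmetric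
function, hence of `∑ k_l²`, which is positive for at least two distinct real nodes. -/
theorem nodeCoeff_ne_zero {k : Fin d → ℝ} (hk : Function.Injective k) (hsum : ∑ l, k l = 0)
    {i : Fin d} (hi : (i : ℕ) + 2 = d) : nodeCoeff k i ≠ 0 := by
  have hfac : ((i + 2 : ℕ).factorial : ℝ) ≠ 0 := by positivity
  rw [nodeCoeff]
  refine div_ne_zero ?_ hfac
  rw [hi, nodeMoment_self hk, neg_ne_zero]
  refine mul_ne_zero (by positivity) ?_
  have hc := Multiset.prod_X_sub_C_coeff (Finset.univ.val.map k) (k := i) (by simp)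
  simp only [Multiset.map_map, Multiset.card_map, Finset.card_val, Finset.card_univ,
    Fintype.card_fin, Function.comp_def] at hc
  have hc' : (∏ l, (Polynomial.X - Polynomial.C (k l))).coeff i =
      (-1) ^ (d - i) * (Finset.univ.val.map k).esymm (d - i) := hc
  rw [hc', show d - (i : ℕ) = 2 by omega]
  have h2 := esymm_two_nodes k hsum
  intro h0
  rw [neg_one_sq, one_mul] at h0
  have h3 : ∑ l, k l ^ 2 = 0 := by rw [h0] at h2; linarith
  rw [Finset.sum_eq_zero_iff_of_nonneg fun l _ => sq_nonneg _] at h3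
  have ha := h3 ⟨0, by omega⟩ (Finset.mem_univ _)
  have hb := h3 ⟨1, by omega⟩ (Finset.mem_univ _)
  have := hk ((pow_eq_zero_iff two_ne_zero).1 ha |>.trans ((pow_eq_zero_iff two_ne_zero).1 hb).symm)
  simp at this

/-- The combination of the values of `g` at the nodes that approximates the `i`-th derivative. -/
noncomputable def nodeDiff (k : Fin d → ℝ) (i : Fin d) (g : ℝ → ℝ) (ε x : ℝ) : ℝ :=
  (ε ^ (i : ℕ))⁻¹ * ∑ l, nodeWeight k i l * g (x + k l * ε)

theorem nodeDiff_smooth (k : Fin d → ℝ) (i : Fin d) {g : ℝ → ℝ} (hg : ContDiff ℝ ∞ g) (ε : ℝ) :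
    ContDiff ℝ ∞ (nodeDiff k i g ε) := by
  refine contDiff_const.mul (ContDiff.sum fun l _ => contDiff_const.mul (hg.comp ?_))
  exact contDiff_id.add contDiff_const

/-- Differences commute with `∂`, so the expansion of all derivatives reduces to the expansion of
values. -/
theorem deriv_nodeDiff (k : Fin d → ℝ) (i : Fin d) {g : ℝ → ℝ} (hg : ContDiff ℝ ∞ g) (ε : ℝ) :
    deriv (nodeDiff k i g ε) = nodeDiff k i (deriv g) ε := by
  funext x
  refine HasDerivAt.deriv (HasDerivAt.const_mul _ (HasDerivAt.fun_sum fun l _ =>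
    HasDerivAt.const_mul _ ?_))
  have := (hg.differentiable_infty (x + k l * ε)).hasDerivAt.comp_add_const x (k l * ε)
  exact this

theorem approx_nodeDiff {k : Fin d → ℝ} (hk : Function.Injective k) (hsum : ∑ l, k l = 0)
    (i : Fin d) {g : ℝ → ℝ} (hg : ContDiff ℝ ∞ g) :
    Approx (nodeDiff k i g) fun x =>
      inl (iteratedDeriv i g x) + inr (nodeCoeff k i * iteratedDeriv (i + 2) g x) := by
  intro r
  choose K hK using fun l => taylor_bound (i + 3) hg (k l) r
  refine (isBigO_smallOn_iff (f := fun ε x => nodeDiff k i g ε x -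
    (inl (iteratedDeriv i g x) + inr (nodeCoeff k i * iteratedDeriv (i + 2) g x) :
      DualNumber ℝ).fst - ε ^ 2 * (inl (iteratedDeriv i g x) +
        inr (nodeCoeff k i * iteratedDeriv (i + 2) g x) : DualNumber ℝ).snd)).2
    ⟨∑ l, |nodeWeight k i l| * K l, ?_⟩
  filter_upwards [Ioo_mem_nhdsGT (zero_lt_one' ℝ)] with ε hε x hx
  have hε0 : ε ≠ 0 := hε.1.ne'
  -- Of the moments of order at most `i + 2` only those of order `i` and `i + 2` survive. The Taylor
  -- remainder has order `i + 3`, which leaves `ε³` after division by `ε^i`.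
  have hmain : ∑ l, nodeWeight k i l * ∑ j ∈ Finset.range (i + 3),
      (k l * ε) ^ j / (j.factorial : ℝ) * iteratedDeriv j g x =
      ε ^ (i : ℕ) * (iteratedDeriv i g x + ε ^ 2 * (nodeCoeff k i * iteratedDeriv (i + 2) g x)) := by
    have h1 : ∑ l, nodeWeight k i l * ∑ j ∈ Finset.range (i + 3),
        (k l * ε) ^ j / (j.factorial : ℝ) * iteratedDeriv j g x = ∑ j ∈ Finset.range (i + 3),
        nodeMoment k i j * (ε ^ j / (j.factorial : ℝ) * iteratedDeriv j g x) := by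
      simp only [Finset.mul_sum, nodeMoment, Finset.sum_mul]
      rw [Finset.sum_comm]
      refine Finset.sum_congr rfl fun j _ => Finset.sum_congr rfl fun l _ => ?_
      rw [mul_pow]
      ring
    rw [h1, Finset.sum_range_succ, Finset.sum_range_succ, nodeMoment_succ hk hsum,
      Finset.sum_range_succ, Finset.sum_eq_zero, nodeMoment_of_lt hk i i.2, if_pos rfl, nodeCoeff]
    · have : ((i : ℕ).factorial : ℝ) ≠ 0 := by positivity
      have : ((i + 2 : ℕ).factorial : ℝ) ≠ 0 := by positivity
      field_simp
      ring
    · intro j hj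
      have hj' := Finset.mem_range.1 hj
      rw [nodeMoment_of_lt hk i (by omega), if_neg (by omega), zero_mul]
  have herr : nodeDiff k i g ε x - (iteratedDeriv i g x +
      ε ^ 2 * (nodeCoeff k i * iteratedDeriv (i + 2) g x)) =
      (ε ^ (i : ℕ))⁻¹ * ∑ l, nodeWeight k i l * (g (x + k l * ε) - ∑ j ∈ Finset.range (i + 3),
        (k l * ε) ^ j / (j.factorial : ℝ) * iteratedDeriv j g x) := by
    simp only [mul_sub, Finset.sum_sub_distrib]
    rw [hmain, nodeDiff, inv_mul_cancel_left₀ (pow_ne_zero _ hε0)]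
  have hb : |∑ l, nodeWeight k i l * (g (x + k l * ε) - ∑ j ∈ Finset.range (i + 3),
        (k l * ε) ^ j / (j.factorial : ℝ) * iteratedDeriv j g x)| ≤
      (∑ l, |nodeWeight k i l| * K l) * ε ^ (i + 3 : ℕ) := by
    refine (Finset.abs_sum_le_sum_abs _ _).trans ?_
    rw [Finset.sum_mul]
    refine Finset.sum_le_sum fun l _ => ?_
    rw [abs_mul, mul_assoc]
    exact mul_le_mul_of_nonneg_left (hK l ε ⟨hε.1.le, hε.2.le⟩ x hx) (abs_nonneg _)
  simp only [fst_add, fst_inl, fst_inr, add_zero, snd_add, snd_inl, snd_inr, zero_add,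
    Real.norm_eq_abs]
  rw [sub_sub, herr, abs_mul, abs_of_nonneg (inv_nonneg.2 (pow_nonneg hε.1.le _)),
    inv_mul_le_iff₀ (pow_pos hε.1 _)]
  refine hb.trans (le_of_eq ?_)
  rw [pow_add]
  ring

theorem expands_nodeDiff {k : Fin d → ℝ} (hk : Function.Injective k) (hsum : ∑ l, k l = 0)
    (i : Fin d) {g : ℝ → ℝ} (hg : ContDiff ℝ ∞ g) :
    Expands (nodeDiff k i g) fun x =>
      inl (iteratedDeriv i g x) + inr (nodeCoeff k i * iteratedDeriv (i + 2) g x) := by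
  refine ⟨Eventually.of_forall fun ε => nodeDiff_smooth k i hg ε,
    contDiff_dual (hg.iteratedDeriv_infty _) (contDiff_const.mul (hg.iteratedDeriv_infty _)),
    fun n => ?_⟩
  induction n generalizing g with
  | zero => exact approx_nodeDiff hk hsum i hg
  | succ n ih =>
    refine ⟨approx_nodeDiff hk hsum i hg, ?_⟩
    have e1 : (fun ε => deriv (nodeDiff k i g ε)) = nodeDiff k i (deriv g) :=
      funext fun ε => deriv_nodeDiff k i hg ε
    have e2 : deriv (fun x => (inl (iteratedDeriv i g x) +
        inr (nodeCoeff k i * iteratedDeriv (i + 2) g x) : DualNumber ℝ)) = fun x =>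
        inl (iteratedDeriv i (deriv g) x) +
          inr (nodeCoeff k i * iteratedDeriv (i + 2) (deriv g) x) := by
      funext x
      have h1 := ((inlCLM ℝ ℝ).hasFDerivAt.comp_hasDerivAt x
        ((hg.iteratedDeriv_infty i).differentiable_infty x).hasDerivAt)
      have h2 := ((inrCLM ℝ ℝ).hasFDerivAt.comp_hasDerivAt x
        (((hg.iteratedDeriv_infty (i + 2)).differentiable_infty x).hasDerivAt.const_mul
          (nodeCoeff k i)))
      refine (h1.add h2).deriv.trans ?_
      rw [← iteratedDeriv_succ, ← iteratedDeriv_succ, iteratedDeriv_succ', iteratedDeriv_succ']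
      rfl
    rw [e1, e2]
    exact ih hg.deriv_infty

end Nodes

/-! ### Frames of curves and dual curves -/

section Algebra

variable {R : Type*} {d : ℕ}

/-- The square matrix with rows `H_0, …, H_{d-1}, y`. -/
def rowsWith (H : Fin d → Fin (d + 1) → R) (y : Fin (d + 1) → R) :
    Matrix (Fin (d + 1)) (Fin (d + 1)) R :=
  Matrix.of (Fin.snoc (α := fun _ => Fin (d + 1) → R) H y)

theorem rowsWith_castSucc (H : Fin d → Fin (d + 1) → R) (y : Fin (d + 1) → R) (i : Fin d) :
    rowsWith H y i.castSucc = H i := by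
  funext c
  simp [rowsWith]

theorem rowsWith_last (H : Fin d → Fin (d + 1) → R) (y : Fin (d + 1) → R) :
    rowsWith H y (Fin.last d) = y := by
  funext c
  simp [rowsWith]

theorem updateRow_rowsWith (H : Fin d → Fin (d + 1) → R) (y z : Fin (d + 1) → R) :
    (rowsWith H y).updateRow (Fin.last d) z = rowsWith H z := by
  ext i c
  refine Fin.lastCases ?_ (fun i => ?_) i
  · rw [Matrix.updateRow_self, rowsWith_last]
  · rw [Matrix.updateRow_ne (Fin.castSucc_lt_last i).ne, rowsWith_castSucc, rowsWith_castSucc]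

variable [CommRing R]

/-- The covector `det (H_0, …, H_{d-1}, ·)`. -/
def conormal (H : Fin d → Fin (d + 1) → R) (c : Fin (d + 1)) : R :=
  (rowsWith H 0).adjugate c (Fin.last d)

theorem det_rowsWith (H : Fin d → Fin (d + 1) → R) (y : Fin (d + 1) → R) :
    (rowsWith H y).det = ∑ c, conormal H c * y c := by
  have h := congrFun (congrFun (Matrix.mul_adjugate (rowsWith H y)) (Fin.last d)) (Fin.last d)
  rw [Matrix.smul_apply, Matrix.one_apply_eq, smul_eq_mul, mul_one, Matrix.mul_apply] at h
  rw [← h]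
  refine Finset.sum_congr rfl fun c _ => ?_
  rw [rowsWith_last, mul_comm, conormal, Matrix.adjugate_apply, Matrix.adjugate_apply,
    updateRow_rowsWith, updateRow_rowsWith]

theorem conormal_dot_self (H : Fin d → Fin (d + 1) → R) (i : Fin d) :
    ∑ c, conormal H c * H i c = 0 := by
  rw [← det_rowsWith]
  refine Matrix.det_zero_of_row_eq (Fin.castSucc_lt_last i).ne ?_
  rw [rowsWith_castSucc, rowsWith_last]

/-- Covectors transform contragrediently: for `det M = 1` the covector of the transformed frame,
composed with `M`, is the old one. -/
theorem conormal_mulVec (H : Fin d → Fin (d + 1) → R) (M : Matrix (Fin (d + 1)) (Fin (d + 1)) R)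
    (c : Fin (d + 1)) :
    ∑ b, conormal (fun i => M.mulVec (H i)) b * M b c = M.det * conormal H c := by
  have h : ∀ y, rowsWith (fun i => M.mulVec (H i)) (M.mulVec y) = rowsWith H y * M.transpose := by
    intro y
    ext i c
    refine Fin.lastCases ?_ (fun i => ?_) i
    · rw [rowsWith_last, Matrix.mul_apply, rowsWith_last]
      exact dotProduct_comm (M c) y
    · rw [rowsWith_castSucc, Matrix.mul_apply, rowsWith_castSucc]
      exact dotProduct_comm (M c) (H i)
  have h1 := congrArg Matrix.det (h (Pi.single c 1))
  rw [Matrix.det_mul, Matrix.det_transpose, det_rowsWith, det_rowsWith] at h1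
  simpa [Matrix.mulVec_single, Pi.single_apply, mul_comm] using h1

/-- A vector annihilated by all rows but the last one is proportional to the last column of the
adjugate matrix. -/
theorem det_mul_of_rows_annihilate (A : Matrix (Fin (d + 1)) (Fin (d + 1)) R)
    (z : Fin (d + 1) → R) (h : ∀ i : Fin d, ∑ c, A i.castSucc c * z c = 0) (c : Fin (d + 1)) :
    A.det * z c = (∑ b, A (Fin.last d) b * z b) * A.adjugate c (Fin.last d) := by
  have h1 : A.adjugate.mulVec (A.mulVec z) = A.det • z := by
    rw [Matrix.mulVec_mulVec, Matrix.adjugate_mul, Matrix.smul_mulVec, Matrix.one_mulVec]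
  have h2 := congrFun h1 c
  rw [Pi.smul_apply, smul_eq_mul, Matrix.mulVec, dotProduct, Fin.sum_univ_castSucc,
    Finset.sum_eq_zero, zero_add] at h2
  · rw [← h2, mul_comm]
    rfl
  · intro i _
    have : A.mulVec z i.castSucc = 0 := h i
    rw [this, mul_zero]

theorem sum_mul_adjugate (A : Matrix (Fin (d + 1)) (Fin (d + 1)) R) (i j : Fin (d + 1)) :
    ∑ c, A i c * A.adjugate c j = if i = j then A.det else 0 := by
  have := congrFun (congrFun (Matrix.mul_adjugate A) i) j
  rw [Matrix.mul_apply, Matrix.smul_apply, Matrix.one_apply, smul_eq_mul, mul_ite, mul_one,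
    mul_zero] at this
  exact this

end Algebra

/-! ### Determinants over the dual numbers and their linearization -/

section DualDet

open TrivSqZeroExt

theorem fst_det {ι : Type*} [Fintype ι] [DecidableEq ι] (A : Matrix ι ι (DualNumber ℝ)) :
    A.det.fst = (A.map fst).det :=
  RingHom.map_det (fstHom ℝ ℝ ℝ).toRingHom A

theorem fst_adjugate {ι : Type*} [Fintype ι] [DecidableEq ι] (A : Matrix ι ι (DualNumber ℝ))
    (i j : ι) : (A.adjugate i j).fst = (A.map fst).adjugate i j :=
  congrFun (congrFun (RingHom.map_adjugate (fstHom ℝ ℝ ℝ).toRingHom A) i) j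

/-- The linearization of the determinant at a matrix with determinant `1`. -/
theorem snd_det {ι : Type*} [Fintype ι] [DecidableEq ι] (A : Matrix ι ι (DualNumber ℝ))
    (h : (A.map fst).det = 1) :
    A.det.snd = ∑ i, ∑ c, (A i c).snd * (A.map fst).adjugate c i := by
  set j : ℝ →+* DualNumber ℝ := inlHom ℝ ℝ with hj
  -- Factor `A = A_0 + η A_1` as `(1 + η A_1 adj A_0) A_0`, using `adj A_0 · A_0 = 1`; the `η` part
  -- of the determinant is then a trace.
  have hA : A = ((1 : Matrix ι ι (DualNumber ℝ)) +
      (inr 1 : DualNumber ℝ) • (((A.map snd) * (A.map fst).adjugate).map j)) *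
        (A.map fst).map j := by
    rw [add_mul, Matrix.one_mul, Matrix.smul_mul, ← Matrix.map_mul, Matrix.mul_assoc,
      Matrix.adjugate_mul, h, one_smul, Matrix.mul_one]
    ext a b <;> simp [hj, Matrix.add_apply]
  have h1 : ((A.map fst).map j).det = 1 := by
    have := RingHom.map_det j (A.map fst)
    rw [h, map_one] at this
    exact this.symm
  rw [hA, Matrix.det_mul, h1, mul_one, Matrix.det_one_add_smul, ← hA]
  have h2 : (inr 1 : DualNumber ℝ) ^ 2 = 0 := by rw [pow_two, inr_mul_inr]
  have h3 : (((A.map snd) * (A.map fst).adjugate).map j).trace =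
      inl (((A.map snd) * (A.map fst).adjugate).trace) :=
    (AddMonoidHom.map_trace j.toAddMonoidHom ((A.map snd) * (A.map fst).adjugate)).symm
  rw [h2, h3]
  simp [Matrix.trace, Matrix.mul_apply]

/-- Multiplication by `inl a + inr a'` encodes the product rule, so each monomial of the determinant
differentiates to its `η` part. -/
theorem hasDerivAt_det {ι : Type*} [Fintype ι] [DecidableEq ι] {A : ℝ → Matrix ι ι ℝ}
    {A' : Matrix ι ι ℝ} {x : ℝ} (h : ∀ i j, HasDerivAt (fun y => A y i j) (A' i j) x) :
    HasDerivAt (fun y => (A y).det)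
      (Matrix.of fun i j => (inl (A x i j) + inr (A' i j) : DualNumber ℝ)).det.snd x := by
  have hprod : ∀ (s : Finset ι) (σ : Equiv.Perm ι),
      (∏ i ∈ s, A x (σ i) i =
        (∏ i ∈ s, (inl (A x (σ i) i) + inr (A' (σ i) i) : DualNumber ℝ)).fst) ∧
      HasDerivAt (fun y => ∏ i ∈ s, A y (σ i) i)
        (∏ i ∈ s, (inl (A x (σ i) i) + inr (A' (σ i) i) : DualNumber ℝ)).snd x := by
    intro s σ
    induction s using Finset.induction_on with
    | empty => simpa using hasDerivAt_const x (1 : ℝ)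
    | insert a s ha ih =>
      simp only [Finset.prod_insert ha]
      refine ⟨by rw [ih.1]; simp, ?_⟩
      refine ((h (σ a) a).mul ih.2).congr_deriv ?_
      rw [ih.1]
      simp
      ring
  simp only [Matrix.det_apply']
  have hs : (∑ σ : Equiv.Perm ι, ((Equiv.Perm.sign σ : ℤ) : DualNumber ℝ) *
      ∏ i, (Matrix.of fun i j => (inl (A x i j) + inr (A' i j) : DualNumber ℝ)) (σ i) i).snd =
      ∑ σ : Equiv.Perm ι, ((Equiv.Perm.sign σ : ℤ) : ℝ) *
        (∏ i, (inl (A x (σ i) i) + inr (A' (σ i) i) : DualNumber ℝ)).snd := by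
    rw [snd_sum]
    refine Finset.sum_congr rfl fun σ _ => ?_
    rw [← inl_intCast, snd_mul]
    simp
  rw [hs]
  exact HasDerivAt.fun_sum fun σ _ => (hprod Finset.univ σ).2.const_mul _

end DualDet

/-! ### Jets, duality of curves, and Wronskians -/

section Jets

variable {d : ℕ}

/-- The matrix of the derivatives of order at most `d` of a curve. -/
noncomputable def jet {E : Type*} [NormedAddCommGroup E] [NormedSpace ℝ E]
    (f : ℝ → Fin (d + 1) → E) (x : ℝ) : Matrix (Fin (d + 1)) (Fin (d + 1)) E :=
  Matrix.of fun i c => iteratedDeriv i (fun y => f y c) x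

theorem iteratedDeriv_apply {f : ℝ → Fin (d + 1) → ℝ} (hf : ContDiff ℝ ∞ f) (n : ℕ) (x : ℝ)
    (c : Fin (d + 1)) : iteratedDeriv n f x c = iteratedDeriv n (fun y => f y c) x := by
  induction n generalizing f with
  | zero => simp
  | succ n ih =>
    rw [iteratedDeriv_succ', iteratedDeriv_succ', ih hf.deriv_infty]
    congr 1
    funext y
    exact (hasDerivAt_pi.1 (hf.differentiable_infty y).hasDerivAt c).deriv.symm

theorem wronskianDet_eq {f : ℝ → Fin (d + 1) → ℝ} (hf : ContDiff ℝ ∞ f) (x : ℝ) :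
    wronskianDet f x = (jet f x).det := by
  rw [wronskianDet]
  congr 1
  ext i c
  exact iteratedDeriv_apply hf i x c

theorem contDiff_component {f : ℝ → Fin (d + 1) → ℝ} (hf : ContDiff ℝ ∞ f) (c : Fin (d + 1)) :
    ContDiff ℝ ∞ fun x => f x c :=
  contDiff_pi.1 hf c

theorem hasDerivAt_iteratedDeriv {E : Type*} [NormedAddCommGroup E] [NormedSpace ℝ E] {f : ℝ → E}
    (hf : ContDiff ℝ ∞ f) (n : ℕ) (x : ℝ) :
    HasDerivAt (iteratedDeriv n f) (iteratedDeriv (n + 1) f x) x := by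
  rw [iteratedDeriv_succ]
  exact ((hf.iteratedDeriv_infty n).differentiable_infty x).hasDerivAt

/-- The pairing of the `i`-th derivative of a curve of covectors with the `j`-th derivative of a
curve of vectors. -/
noncomputable def pairing (φ Z : ℝ → Fin (d + 1) → ℝ) (i j : ℕ) (x : ℝ) : ℝ :=
  ∑ c, iteratedDeriv i (fun y => φ y c) x * iteratedDeriv j (fun y => Z y c) x

theorem pairing_comm (φ Z : ℝ → Fin (d + 1) → ℝ) (i j : ℕ) (x : ℝ) :
    pairing φ Z i j x = pairing Z φ j i x :=
  Finset.sum_congr rfl fun _ _ => mul_comm _ _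

variable {φ Z : ℝ → Fin (d + 1) → ℝ}

theorem hasDerivAt_pairing (hφ : ContDiff ℝ ∞ φ) (hZ : ContDiff ℝ ∞ Z) (i j : ℕ) (x : ℝ) :
    HasDerivAt (pairing φ Z i j) (pairing φ Z (i + 1) j x + pairing φ Z i (j + 1) x) x := by
  simp only [pairing, ← Finset.sum_add_distrib]
  exact HasDerivAt.fun_sum fun c _ =>
    (hasDerivAt_iteratedDeriv (contDiff_component hφ c) i x).mul
      (hasDerivAt_iteratedDeriv (contDiff_component hZ c) j x)

/-- Differentiating a vanishing pairing moves one derivative from `Z` to `φ`. Hence being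
annihilated by the jets of `φ` and annihilating the jets of `Z` are equivalent. -/
theorem pairing_eq_zero (hφ : ContDiff ℝ ∞ φ) (hZ : ContDiff ℝ ∞ Z)
    (h : ∀ j < d, ∀ x, pairing φ Z 0 j x = 0) (i j : ℕ) (hij : i + j < d) (x : ℝ) :
    pairing φ Z i j x = 0 := by
  induction i generalizing j x with
  | zero => exact h j (by omega) x
  | succ i ih =>
    have h1 := hasDerivAt_pairing hφ hZ i j x
    have h2 : pairing φ Z i j = fun _ => 0 := funext fun y => ih j (by omega) y
    rw [h2] at h1
    have h3 := h1.unique (hasDerivAt_const x 0)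
    rw [ih (j + 1) (by omega), add_zero] at h3
    exact h3

theorem pairing_eq_zero' (hφ : ContDiff ℝ ∞ φ) (hZ : ContDiff ℝ ∞ Z)
    (h : ∀ i < d, ∀ x, pairing φ Z i 0 x = 0) (i j : ℕ) (hij : i + j < d) (x : ℝ) :
    pairing φ Z i j x = 0 := by
  rw [pairing_comm]
  exact pairing_eq_zero hZ hφ (fun j hj x => by rw [pairing_comm]; exact h j hj x) j i (by omega) x

/-- On the line `i + j = d - 1` the pairings vanish, so moving one more derivative across changes
only the sign. -/
theorem pairing_antidiagonal (hφ : ContDiff ℝ ∞ φ) (hZ : ContDiff ℝ ∞ Z)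
    (h : ∀ j < d, ∀ x, pairing φ Z 0 j x = 0) (i j : ℕ) (hij : i + j = d) (x : ℝ) :
    pairing φ Z i j x = (-1) ^ i * pairing φ Z 0 d x := by
  induction i generalizing j with
  | zero => rw [show j = d by omega]; simp
  | succ i ih =>
    have h1 := hasDerivAt_pairing hφ hZ i j x
    have h2 : pairing φ Z i j = fun _ => 0 :=
      funext fun y => pairing_eq_zero hφ hZ h i j (by omega) y
    rw [h2] at h1
    have h3 := h1.unique (hasDerivAt_const x 0)
    have h4 := ih (j + 1) (by omega)
    rw [pow_succ]
    linarith

/-- The determinant of the antidiagonal matrix with entries `(-1)^i`. -/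
noncomputable def antidiagonalSign (d : ℕ) : ℝ :=
  ((Equiv.Perm.sign (Fin.revPerm : Equiv.Perm (Fin (d + 1))) : ℤ) : ℝ) *
    ∏ i : Fin (d + 1), (-1) ^ (i : ℕ)

theorem antidiagonalSign_mul_self (d : ℕ) : antidiagonalSign d * antidiagonalSign d = 1 := by
  have h1 : ((Equiv.Perm.sign (Fin.revPerm : Equiv.Perm (Fin (d + 1))) : ℤ) : ℝ) *
      ((Equiv.Perm.sign (Fin.revPerm : Equiv.Perm (Fin (d + 1))) : ℤ) : ℝ) = 1 := by
    norm_cast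
    rw [Int.units_mul_self, Units.val_one]
  have h2 : (∏ i : Fin (d + 1), (-1 : ℝ) ^ (i : ℕ)) * ∏ i : Fin (d + 1), (-1 : ℝ) ^ (i : ℕ) = 1 := by
    rw [← Finset.prod_mul_distrib]
    refine Finset.prod_eq_one fun i _ => ?_
    rw [← mul_pow]
    norm_num
  rw [antidiagonalSign, mul_mul_mul_comm, h1, h2, one_mul]

/-- The matrix of pairings vanishes where `i + j < d` and has entries `(-1)^i` where `i + j = d`;
reversing its columns makes it triangular. Thus the dual of a normalized curve has Wronskian `±1`.
-/
theorem det_jet_mul_det_jet (hφ : ContDiff ℝ ∞ φ) (hZ : ContDiff ℝ ∞ Z)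
    (h : ∀ j < d, ∀ x, pairing φ Z 0 j x = 0) (x : ℝ) (h1 : pairing φ Z 0 d x = 1) :
    (jet φ x).det * (jet Z x).det = antidiagonalSign d := by
  rw [← Matrix.det_transpose (jet Z x), ← Matrix.det_mul]
  set N := jet φ x * (jet Z x).transpose with hN
  have hNa : ∀ i j, N i j = pairing φ Z i j x := fun i j => rfl
  have hlow : (N.submatrix id Fin.revPerm).det = ∏ i : Fin (d + 1), (-1 : ℝ) ^ (i : ℕ) := by
    rw [Matrix.det_of_isLowerTriangular]
    · refine Finset.prod_congr rfl fun i _ => ?_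
      rw [Matrix.submatrix_apply, hNa, pairing_antidiagonal hφ hZ h, h1, mul_one]
      · rfl
      · simp [Fin.val_rev]; omega
    · intro i j hij
      have hij' : i < j := hij
      rw [Matrix.submatrix_apply, hNa]
      refine pairing_eq_zero hφ hZ h _ _ ?_ x
      have : (i : ℕ) < j := hij'
      simp [Fin.val_rev]
      omega
  rw [Matrix.det_permute'] at hlow
  rw [antidiagonalSign, ← hlow, ← mul_assoc]
  norm_cast
  rw [Int.units_mul_self]
  simp

/-- The transition matrix from the jets of a curve to those of its multiple by `f`. -/
noncomputable def leibnizMatrix (d : ℕ) (f : ℝ → ℝ) (x : ℝ) :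
    Matrix (Fin (d + 1)) (Fin (d + 1)) ℝ :=
  Matrix.of fun i k => ((i : ℕ).choose k : ℝ) * iteratedDeriv (i - k) f x

theorem jet_smul {f : ℝ → ℝ} (hf : ContDiff ℝ ∞ f) (hZ : ContDiff ℝ ∞ Z) (x : ℝ) :
    jet (fun y c => f y * Z y c) x = leibnizMatrix d f x * jet Z x := by
  ext i c
  have e : (fun y => f y * Z y c) = (fun y => Z y c) * f := funext fun y => mul_comm _ _
  have hle : ((i : ℕ) : WithTop ℕ∞) ≤ ∞ := by exact_mod_cast le_top
  have hr : (leibnizMatrix d f x * jet Z x) i c = ∑ k : Fin (d + 1), ((i : ℕ).choose k : ℝ) *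
      iteratedDeriv (i - k) f x * iteratedDeriv k (fun y => Z y c) x := rfl
  rw [hr, jet, Matrix.of_apply, e, iteratedDeriv_mul
    ((contDiff_component hZ c).contDiffAt.of_le hle) (hf.contDiffAt.of_le hle),
    Fin.sum_univ_eq_sum_range (fun k => ((i : ℕ).choose k : ℝ) * iteratedDeriv (i - k) f x *
      iteratedDeriv k (fun y => Z y c) x)]
  rw [← Finset.sum_subset (Finset.range_mono (show (i : ℕ) + 1 ≤ d + 1 by omega))]
  · exact Finset.sum_congr rfl fun k _ => by ring
  · intro k _ hk
    rw [Nat.choose_eq_zero_of_lt (by simpa using hk)]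
    simp

/-- The Wronskian of a rescaled curve. -/
theorem det_jet_smul {f : ℝ → ℝ} (hf : ContDiff ℝ ∞ f) (hZ : ContDiff ℝ ∞ Z) (x : ℝ) :
    (jet (fun y c => f y * Z y c) x).det = f x ^ (d + 1) * (jet Z x).det := by
  rw [jet_smul hf hZ, Matrix.det_mul, Matrix.det_of_isLowerTriangular]
  · simp [leibnizMatrix]
  · intro i k hik
    have : (i : ℕ) < k := hik
    simp [leibnizMatrix, Nat.choose_eq_zero_of_lt this]

/-- `Z(x + T) = M Z(x)`. -/
def QuasiPeriodic (M : Matrix (Fin (d + 1)) (Fin (d + 1)) ℝ) (T : ℝ) (Z : ℝ → Fin (d + 1) → ℝ) :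
    Prop :=
  ∀ x, Z (x + T) = M.mulVec (Z x)

theorem QuasiPeriodic.iteratedDeriv {M : Matrix (Fin (d + 1)) (Fin (d + 1)) ℝ} {T : ℝ}
    (h : QuasiPeriodic M T Z) (hZ : ContDiff ℝ ∞ Z) (n : ℕ) (x : ℝ) (c : Fin (d + 1)) :
    iteratedDeriv n (fun y => Z y c) (x + T) =
      ∑ b, M c b * iteratedDeriv n (fun y => Z y b) x := by
  have h1 : (fun y => Z (y + T) c) = fun y => ∑ b, M c b * Z y b := funext fun y => by
    rw [h y]
    rfl
  rw [← congrFun (iteratedDeriv_comp_add_const n (fun y => Z y c) T) x, h1]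
  have hle : ((n : ℕ) : WithTop ℕ∞) ≤ ∞ := by exact_mod_cast le_top
  rw [iteratedDeriv_fun_sum fun b _ =>
    (contDiff_const.mul (contDiff_component hZ b)).contDiffAt.of_le hle]
  exact Finset.sum_congr rfl fun b _ => iteratedDeriv_const_mul_field _ _

theorem QuasiPeriodic.jet {M : Matrix (Fin (d + 1)) (Fin (d + 1)) ℝ} {T : ℝ}
    (h : QuasiPeriodic M T Z) (hZ : ContDiff ℝ ∞ Z) (x : ℝ) :
    jet Z (x + T) = jet Z x * M.transpose := by
  ext i c
  exact (h.iteratedDeriv hZ i x c).trans (Finset.sum_congr rfl fun b _ => mul_comm _ _)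

/-! ### The operator annihilating a curve -/

/-- The coefficients of the linear relation between the derivatives of order at most `d + 1`. -/
noncomputable def opCoeff {E : Type*} [NormedCommRing E] [NormedAlgebra ℝ E]
    (Z : ℝ → Fin (d + 1) → E) (x : ℝ) (j : Fin (d + 1)) : E :=
  -∑ c, iteratedDeriv (d + 1) (fun y => Z y c) x * (jet Z x).adjugate c j

theorem sum_opCoeff {x : ℝ} (h : (jet Z x).det = 1) (c : Fin (d + 1)) :
    ∑ j, opCoeff Z x j * jet Z x j c = -iteratedDeriv (d + 1) (fun y => Z y c) x := by
  have h1 := congrFun (Matrix.vecMul_vecMul (fun c => iteratedDeriv (d + 1) (fun y => Z y c) x)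
    (jet Z x).adjugate (jet Z x)) c
  rw [Matrix.adjugate_mul, h, one_smul, Matrix.vecMul_one] at h1
  rw [← h1]
  simp only [opCoeff, neg_mul, Finset.sum_neg_distrib]
  rfl

/-- The coefficient of `∂^d` is minus the derivative of the Wronskian, which is constant. -/
theorem opCoeff_last (hZ : ContDiff ℝ ∞ Z) (h : ∀ x, (jet Z x).det = 1) (x : ℝ) :
    opCoeff Z x (Fin.last d) = 0 := by
  have h1 := hasDerivAt_det (A := jet Z)
    (A' := Matrix.of fun i c => iteratedDeriv (i + 1) (fun y => Z y c) x) (x := x)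
    fun i c => hasDerivAt_iteratedDeriv (contDiff_component hZ c) i x
  simp only [h] at h1
  have h2 := h1.unique (hasDerivAt_const x 1)
  set B : Matrix (Fin (d + 1)) (Fin (d + 1)) (DualNumber ℝ) :=
    Matrix.of fun i c => TrivSqZeroExt.inl (jet Z x i c) +
      TrivSqZeroExt.inr (iteratedDeriv (i + 1) (fun y => Z y c) x) with hB
  have h3 : B.map TrivSqZeroExt.fst = jet Z x := by
    ext i c
    simp [hB]
  have h4 := snd_det B (by rw [h3, h])
  rw [h3, Fin.sum_univ_castSucc, Finset.sum_eq_zero, zero_add] at h4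
  · have h5 : ∀ c, (B (Fin.last d) c).snd = iteratedDeriv (d + 1) (fun y => Z y c) x := fun c => by
      simp [hB]
    simp only [h5] at h4
    rw [opCoeff, ← h4, neg_eq_zero]
    exact h2
  -- Differentiating any row but the last one repeats the following row and contributes nothing.
  · intro i _
    have h6 := sum_mul_adjugate (jet Z x) i.succ i.castSucc
    rw [if_neg (Fin.castSucc_lt_succ (i := i)).ne'] at h6
    rw [← h6]
    refine Finset.sum_congr rfl fun c _ => ?_
    simp [hB, jet]

theorem applyOp_opCoeff (hZ : ContDiff ℝ ∞ Z) (h : ∀ x, (jet Z x).det = 1) (x : ℝ) :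
    applyOp (fun (j : Fin d) x => opCoeff Z x j.castSucc) Z x = 0 := by
  funext c
  have h1 := sum_opCoeff (h x) c
  rw [Fin.sum_univ_castSucc, opCoeff_last hZ h, zero_mul, add_zero] at h1
  simp only [applyOp, Pi.add_apply, Finset.sum_apply, Pi.smul_apply, smul_eq_mul,
    iteratedDeriv_apply hZ]
  have h2 : ∑ j : Fin d, opCoeff Z x j.castSucc * iteratedDeriv j (fun y => Z y c) x =
      -iteratedDeriv (d + 1) (fun y => Z y c) x := h1
  rw [h2]
  simp

/-- An operator of order at most `d` is determined at a point by its values on the components of a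
curve with nonzero Wronskian. Periodicity of coefficients and the identification of the flow both
rest on this. -/
theorem eq_of_sum_jet_eq {x : ℝ} (h : (jet Z x).det ≠ 0) {a b : Fin (d + 1) → ℝ}
    (hab : ∀ c, ∑ j, a j * jet Z x j c = ∑ j, b j * jet Z x j c) : a = b := by
  rw [← sub_eq_zero]
  refine Matrix.eq_zero_of_vecMul_eq_zero h ?_
  rw [Matrix.sub_vecMul, sub_eq_zero]
  exact funext hab

theorem opCoeff_periodic (hZ : ContDiff ℝ ∞ Z) (h : ∀ x, (jet Z x).det = 1)
    {M : Matrix (Fin (d + 1)) (Fin (d + 1)) ℝ} {T : ℝ} (hM : QuasiPeriodic M T Z) (x : ℝ) :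
    opCoeff Z (x + T) = opCoeff Z x := by
  refine eq_of_sum_jet_eq (Z := Z) (x := x + T) (by rw [h]; exact one_ne_zero) fun c => ?_
  rw [sum_opCoeff (h _), hM.iteratedDeriv hZ, hM.jet hZ]
  have h1 : ∀ b, iteratedDeriv (d + 1) (fun y => Z y b) x = -∑ j, opCoeff Z x j * jet Z x j b :=
    fun b => by rw [sum_opCoeff (h x), neg_neg]
  simp only [h1, Matrix.mul_apply, Matrix.transpose_apply, Finset.mul_sum, mul_neg,
    Finset.sum_neg_distrib, neg_neg]
  rw [Finset.sum_comm]
  exact Finset.sum_congr rfl fun j _ => Finset.sum_congr rfl fun b _ => by ring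

end Jets

/-! ### The envelope family -/

section VectorExpansion

open TrivSqZeroExt

variable {d : ℕ}

/-- The components of a family of curves have second order expansions. -/
def ExpandsV (Z : ℝ → ℝ → Fin (d + 1) → ℝ) (Y : ℝ → Fin (d + 1) → DualNumber ℝ) : Prop :=
  ∀ c, Expands (fun ε x => Z ε x c) fun x => Y x c

variable {Z : ℝ → ℝ → Fin (d + 1) → ℝ} {Y : ℝ → Fin (d + 1) → DualNumber ℝ}

theorem ExpandsV.smooth (h : ExpandsV Z Y) : ∀ᶠ ε in 𝓝[>] (0 : ℝ), ContDiff ℝ ∞ (Z ε) := by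
  filter_upwards [eventually_all.2 fun c => (h c).smooth] with ε hε
  exact contDiff_pi.2 hε

theorem ExpandsV.smooth_fst (h : ExpandsV Z Y) : ContDiff ℝ ∞ fun x c => (Y x c).fst :=
  contDiff_pi.2 fun c => contDiff_fst_dual (h c).coeff

theorem ExpandsV.smooth_snd (h : ExpandsV Z Y) : ContDiff ℝ ∞ fun x c => (Y x c).snd :=
  contDiff_pi.2 fun c => contDiff_snd_dual (h c).coeff

theorem ExpandsV.jet (h : ExpandsV Z Y) (i c : Fin (d + 1)) :
    Expands (fun ε x => jet (Z ε) x i c) fun x => jet Y x i c :=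
  (h c).iteratedDeriv i

theorem ExpandsV.jet_map_fst (h : ExpandsV Z Y) (x : ℝ) :
    (_root_.jet Y x).map fst = _root_.jet (fun x c => (Y x c).fst) x := by
  ext i c
  exact (congrFun (iteratedDeriv_fst_dual (h c).coeff i) x).symm

theorem ExpandsV.tendsto (h : ExpandsV Z Y) (x : ℝ) :
    Tendsto (fun ε => Z ε x) (𝓝[>] 0) (𝓝 fun c => (Y x c).fst) :=
  tendsto_pi_nhds.2 fun c => (h c).tendsto x

theorem ExpandsV.congr {Z' : ℝ → ℝ → Fin (d + 1) → ℝ}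
    (he : ∀ᶠ ε in 𝓝[>] (0 : ℝ), Z ε = Z' ε) (h : ExpandsV Z Y) : ExpandsV Z' Y := fun c =>
  (h c).congr (he.mono fun ε hε => by rw [hε])

theorem ExpandsV.hasSecondOrderExpansion (h : ExpandsV Z Y) :
    HasSecondOrderExpansion Z (fun x c => (Y x c).fst) fun x c => (Y x c).snd := by
  intro i r
  choose K hK using fun c => (h c).hasSecondOrderExpansion i r
  refine ⟨∑ c, |K c|, ?_⟩
  filter_upwards [eventually_all.2 hK, h.smooth, self_mem_nhdsWithin] with ε h1 h2 h3 x hx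
  have h3' : (0 : ℝ) < ε := h3
  refine (pi_norm_le_iff_of_nonneg (by positivity)).2 fun c => ?_
  rw [Pi.sub_apply, Pi.sub_apply, Pi.smul_apply, iteratedDeriv_apply h2,
    iteratedDeriv_apply h.smooth_fst, iteratedDeriv_apply h.smooth_snd]
  refine (h1 c x hx).trans (mul_le_mul_of_nonneg_right ?_ (by positivity))
  exact (le_abs_self _).trans
    (Finset.single_le_sum (f := fun c => |K c|) (fun c _ => abs_nonneg _) (Finset.mem_univ c))

/-- Periodicity upgrades uniformity on one compact interval to uniformity on the line, so that a
single small `ε` serves all `x`. -/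
theorem Expands.eventually_forall_of_periodic {f : ℝ → ℝ → ℝ} {F : ℝ → DualNumber ℝ}
    (hf : Expands f F) {T a δ : ℝ} (hT : 0 < T) (hδ : 0 < δ) (ha : ∀ x, (F x).fst = a)
    (hper : ∀ᶠ ε in 𝓝[>] (0 : ℝ), Function.Periodic (f ε) T) :
    ∀ᶠ ε in 𝓝[>] (0 : ℝ), ∀ x, |f ε x - a| < δ := by
  filter_upwards [hf.toApprox.eventually_dist_lt hf.coeff T hδ, hper] with ε h1 h2 x
  obtain ⟨y, hy, hxy⟩ := h2.exists_mem_Ico₀ hT x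
  rw [hxy, ← ha y]
  exact h1 y ⟨by linarith [hy.1], hy.2.le⟩

/-- The direction annihilated by the derivatives of order less than `d` of a curve of covectors. -/
noncomputable def envelopeVec {E : Type*} [NormedCommRing E] [NormedAlgebra ℝ E]
    (φ : ℝ → Fin (d + 1) → E) (x : ℝ) (c : Fin (d + 1)) : E :=
  (jet φ x).adjugate c (Fin.last d)

theorem ExpandsV.envelopeVec (h : ExpandsV Z Y) :
    ExpandsV (fun ε => envelopeVec (Z ε)) (envelopeVec Y) := fun c =>
  Expands.adjugate h.jet c (Fin.last d)

end VectorExpansion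

/-! ### Construction and normalization of the envelope -/

section Envelope

open TrivSqZeroExt

variable {d : ℕ} (k : Fin d → ℝ) (G : ℝ → Fin (d + 1) → ℝ)

noncomputable def confluentFrame (ε x : ℝ) (i : Fin d) (c : Fin (d + 1)) : ℝ :=
  nodeDiff k i (fun y => G y c) ε x

noncomputable def osculatingFrame (x : ℝ) (i : Fin d) (c : Fin (d + 1)) : DualNumber ℝ :=
  inl (iteratedDeriv i (fun y => G y c) x) +
    inr (nodeCoeff k i * iteratedDeriv (i + 2) (fun y => G y c) x)

/-- The covectors of the hyperplanes whose envelope is taken. -/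
noncomputable def conormalCurve (ε x : ℝ) : Fin (d + 1) → ℝ :=
  conormal (confluentFrame k G ε x)

noncomputable def conormalExpansion (x : ℝ) : Fin (d + 1) → DualNumber ℝ :=
  conormal (osculatingFrame k G x)

/-- The covectors of the osculating hyperplanes of `G`. -/
noncomputable def osculatingConormal (x : ℝ) : Fin (d + 1) → ℝ :=
  conormal fun (i : Fin d) c => iteratedDeriv i (fun y => G y c) x

/-- The constant sign is the one for which the limit is `G` itself; see
`envelopeVec_osculatingConormal`. -/
noncomputable def rawEnvelope (ε x : ℝ) (c : Fin (d + 1)) : ℝ :=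
  (-1) ^ d * antidiagonalSign d * envelopeVec (conormalCurve k G ε) x c

noncomputable def rawEnvelopeExpansion (x : ℝ) (c : Fin (d + 1)) : DualNumber ℝ :=
  inl ((-1) ^ d * antidiagonalSign d) * envelopeVec (conormalExpansion k G) x c

/-- Multiplying a curve by a function `f` multiplies its Wronskian by `f^(d+1)`, whence the
exponent. -/
noncomputable def envelopeLift (ε x : ℝ) (c : Fin (d + 1)) : ℝ :=
  (jet (rawEnvelope k G ε) x).det ^ (-((d : ℝ) + 1)⁻¹) * rawEnvelope k G ε x c

noncomputable def envelopeLiftExpansion (x : ℝ) (c : Fin (d + 1)) : DualNumber ℝ :=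
  (inl 1 + inr (-((d : ℝ) + 1)⁻¹ * (jet (rawEnvelopeExpansion k G) x).det.snd)) *
    rawEnvelopeExpansion k G x c

variable {k G}

theorem expandsV_conormalCurve (hk : Function.Injective k) (hsum : ∑ l, k l = 0)
    (hG : ContDiff ℝ ∞ G) : ExpandsV (conormalCurve k G) (conormalExpansion k G) := by
  intro c
  refine Expands.adjugate (A := fun ε x => rowsWith (confluentFrame k G ε x) 0)
    (𝒜 := fun x => rowsWith (osculatingFrame k G x) 0) (fun i b => ?_) c (Fin.last d)
  refine Fin.lastCases ?_ (fun i => ?_) i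
  · simp only [rowsWith_last, Pi.zero_apply]
    simpa using Expands.const 0
  · simp only [rowsWith_castSucc]
    exact expands_nodeDiff hk hsum i (contDiff_component hG b)

theorem fst_conormalExpansion (x : ℝ)
    (c : Fin (d + 1)) : (conormalExpansion k G x c).fst = osculatingConormal G x c := by
  rw [conormalExpansion, conormal, fst_adjugate, osculatingConormal, conormal]
  congr 1
  ext i b
  refine Fin.lastCases ?_ (fun i => ?_) i
  · simp [rowsWith_last]
  · simp [rowsWith_castSucc, osculatingFrame]

theorem osculatingConormal_smooth (hk : Function.Injective k) (hsum : ∑ l, k l = 0)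
    (hG : ContDiff ℝ ∞ G) : ContDiff ℝ ∞ (osculatingConormal G) := by
  have := (expandsV_conormalCurve hk hsum hG).smooth_fst
  simpa only [fst_conormalExpansion] using this

theorem pairing_osculatingConormal (j : ℕ) (hj : j < d) (x : ℝ) :
    pairing (osculatingConormal G) G 0 j x = 0 := by
  simp only [pairing, iteratedDeriv_zero]
  exact conormal_dot_self (fun (i : Fin d) c => iteratedDeriv i (fun y => G y c) x) ⟨j, hj⟩

theorem pairing_osculatingConormal_last (hdet : ∀ x, (jet G x).det = 1) (x : ℝ) :
    pairing (osculatingConormal G) G 0 d x = 1 := by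
  simp only [pairing, iteratedDeriv_zero]
  have h := det_rowsWith (fun (i : Fin d) c => iteratedDeriv i (fun y => G y c) x)
    (fun c => iteratedDeriv d (fun y => G y c) x)
  refine h.symm.trans ?_
  rw [← hdet x]
  congr 1
  ext i c
  refine Fin.lastCases ?_ (fun i => ?_) i
  · rw [rowsWith_last]
    simp [jet]
  · rw [rowsWith_castSucc]
    simp [jet]

theorem det_jet_osculatingConormal (hφ : ContDiff ℝ ∞ (osculatingConormal G))
    (hG : ContDiff ℝ ∞ G) (hdet : ∀ x, (jet G x).det = 1) (x : ℝ) :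
    (jet (osculatingConormal G) x).det = antidiagonalSign d := by
  have := det_jet_mul_det_jet hφ hG pairing_osculatingConormal x
    (pairing_osculatingConormal_last hdet x)
  rwa [hdet, mul_one] at this

/-- Biduality: `G` is annihilated by the osculating covector and its derivatives of order less than
`d`, so it is proportional to the cofactor vector. Pairing with the `d`-th derivative, which gives
`(-1)^d`, fixes the factor. -/
theorem envelopeVec_osculatingConormal (hφ : ContDiff ℝ ∞ (osculatingConormal G))
    (hG : ContDiff ℝ ∞ G) (hdet : ∀ x, (jet G x).det = 1) (x : ℝ) (c : Fin (d + 1)) :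
    (-1) ^ d * antidiagonalSign d * envelopeVec (osculatingConormal G) x c = G x c := by
  have h1 := det_mul_of_rows_annihilate (jet (osculatingConormal G) x) (G x) (fun i => by
    have := pairing_eq_zero hφ hG pairing_osculatingConormal i 0 (by omega) x
    simpa [pairing, jet] using this) c
  have h2 := pairing_antidiagonal hφ hG pairing_osculatingConormal d 0 (by omega) x
  rw [pairing_osculatingConormal_last hdet, mul_one] at h2
  have h3 : ∑ b, jet (osculatingConormal G) x (Fin.last d) b * G x b = (-1) ^ d := by
    rw [← h2]
    simp [pairing, jet]
  rw [h3, det_jet_osculatingConormal hφ hG hdet] at h1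
  rw [mul_comm ((-1) ^ d), mul_assoc, envelopeVec, ← h1, ← mul_assoc, antidiagonalSign_mul_self,
    one_mul]

theorem expandsV_rawEnvelope (hk : Function.Injective k) (hsum : ∑ l, k l = 0)
    (hG : ContDiff ℝ ∞ G) : ExpandsV (rawEnvelope k G) (rawEnvelopeExpansion k G) := fun c =>
  (Expands.const _).mul ((expandsV_conormalCurve hk hsum hG).envelopeVec c)

theorem fst_rawEnvelopeExpansion (hk : Function.Injective k) (hsum : ∑ l, k l = 0)
    (hG : ContDiff ℝ ∞ G) (hdet : ∀ x, (jet G x).det = 1) (x : ℝ) (c : Fin (d + 1)) :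
    (rawEnvelopeExpansion k G x c).fst = G x c := by
  have hE := expandsV_conormalCurve hk hsum hG
  rw [rawEnvelopeExpansion, fst_mul, fst_inl, envelopeVec, fst_adjugate, hE.jet_map_fst]
  simp only [fst_conormalExpansion]
  exact envelopeVec_osculatingConormal (osculatingConormal_smooth hk hsum hG) hG hdet x c

/-! #### Quasi-periodicity -/

theorem confluentFrame_quasiPeriodic {M : Matrix (Fin (d + 1)) (Fin (d + 1)) ℝ} {T : ℝ}
    (hM : QuasiPeriodic M T G) (ε x : ℝ) (i : Fin d) :
    confluentFrame k G ε (x + T) i = M.mulVec (confluentFrame k G ε x i) := by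
  funext c
  have h1 : ∀ l, G (x + T + k l * ε) c = ∑ b, M c b * G (x + k l * ε) b := fun l => by
    rw [add_right_comm, hM]
    rfl
  simp only [confluentFrame, nodeDiff, h1, Matrix.mulVec, dotProduct, Finset.mul_sum]
  rw [Finset.sum_comm]
  exact Finset.sum_congr rfl fun b _ => Finset.sum_congr rfl fun l _ => by ring

theorem jet_conormalCurve_quasiPeriodic {M : Matrix (Fin (d + 1)) (Fin (d + 1)) ℝ} {T : ℝ}
    (hdetM : M.det = 1) (hM : QuasiPeriodic M T G) {ε : ℝ}
    (hφ : ContDiff ℝ ∞ (conormalCurve k G ε)) (x : ℝ) :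
    jet (conormalCurve k G ε) (x + T) * M = jet (conormalCurve k G ε) x := by
  ext i c
  have h1 : (fun y => conormalCurve k G ε y c) =
      fun y => ∑ b, conormalCurve k G ε (y + T) b * M b c := by
    funext y
    have := conormal_mulVec (confluentFrame k G ε y) M c
    rw [hdetM, one_mul] at this
    rw [conormalCurve, ← this]
    simp only [conormalCurve]
    congr! 4 with b
    exact (confluentFrame_quasiPeriodic hM ε y _).symm
  have hle : (((i : ℕ) : ℕ∞) : WithTop ℕ∞) ≤ ∞ := by exact_mod_cast le_top
  have h2 : jet (conormalCurve k G ε) x i c =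
      iteratedDeriv i (fun y => ∑ b, conormalCurve k G ε (y + T) b * M b c) x := by
    rw [← h1]
    rfl
  rw [h2, Matrix.mul_apply, iteratedDeriv_fun_sum]
  · refine Finset.sum_congr rfl fun b _ => ?_
    rw [iteratedDeriv_mul_const_field,
      congrFun (iteratedDeriv_comp_add_const i (fun y => conormalCurve k G ε y b) T) x]
    rfl
  · intro b _
    refine ContDiffAt.mul ?_ contDiffAt_const
    exact (((contDiff_component hφ b).comp (contDiff_id.add contDiff_const)).contDiffAt).of_le hle

theorem det_jet_conormalCurve_periodic {M : Matrix (Fin (d + 1)) (Fin (d + 1)) ℝ} {T : ℝ}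
    (hdetM : M.det = 1) (hM : QuasiPeriodic M T G) {ε : ℝ}
    (hφ : ContDiff ℝ ∞ (conormalCurve k G ε)) :
    Function.Periodic (fun x => (jet (conormalCurve k G ε) x).det) T := fun x => by
  beta_reduce
  rw [← jet_conormalCurve_quasiPeriodic hdetM hM hφ x, Matrix.det_mul, hdetM, mul_one]

theorem rawEnvelope_quasiPeriodic {M : Matrix (Fin (d + 1)) (Fin (d + 1)) ℝ} {T : ℝ}
    (hdetM : M.det = 1) (hM : QuasiPeriodic M T G) {ε : ℝ}
    (hφ : ContDiff ℝ ∞ (conormalCurve k G ε)) : QuasiPeriodic M T (rawEnvelope k G ε) := by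
  intro x
  have h1 : (jet (conormalCurve k G ε) (x + T)).adjugate =
      M * (jet (conormalCurve k G ε) x).adjugate := by
    rw [← jet_conormalCurve_quasiPeriodic hdetM hM hφ x, Matrix.adjugate_mul_distrib,
      ← Matrix.mul_assoc, Matrix.mul_adjugate, hdetM, one_smul, Matrix.one_mul]
  funext c
  simp only [rawEnvelope, envelopeVec, h1, Matrix.mul_apply, Matrix.mulVec, dotProduct,
    Finset.mul_sum]
  exact Finset.sum_congr rfl fun b _ => by ring

theorem det_jet_periodic {M : Matrix (Fin (d + 1)) (Fin (d + 1)) ℝ} {T : ℝ} (hdetM : M.det = 1)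
    {Z : ℝ → Fin (d + 1) → ℝ} (hM : QuasiPeriodic M T Z) (hZ : ContDiff ℝ ∞ Z) :
    Function.Periodic (fun x => (jet Z x).det) T := fun x => by
  beta_reduce
  rw [hM.jet hZ, Matrix.det_mul, Matrix.det_transpose, hdetM, mul_one]

/-! #### Normalization -/

/-- Distinct nodes with sum zero, and a normalized curve with monodromy `M`. -/
structure NormalizedData (k : Fin d → ℝ) (G : ℝ → Fin (d + 1) → ℝ)
    (M : Matrix (Fin (d + 1)) (Fin (d + 1)) ℝ) : Prop where
  injective : Function.Injective k
  sum_eq_zero : ∑ l, k l = 0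
  smooth : ContDiff ℝ ∞ G
  det_jet : ∀ x, (jet G x).det = 1
  det_eq_one : M.det = 1
  quasiPeriodic : QuasiPeriodic M (2 * Real.pi) G

namespace NormalizedData

variable {M : Matrix (Fin (d + 1)) (Fin (d + 1)) ℝ}

theorem conormal_expands (h : NormalizedData k G M) :
    ExpandsV (conormalCurve k G) (conormalExpansion k G) :=
  expandsV_conormalCurve h.injective h.sum_eq_zero h.smooth

theorem raw_expands (h : NormalizedData k G M) :
    ExpandsV (rawEnvelope k G) (rawEnvelopeExpansion k G) :=
  expandsV_rawEnvelope h.injective h.sum_eq_zero h.smooth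

theorem osculatingConormal_smooth (h : NormalizedData k G M) :
    ContDiff ℝ ∞ (osculatingConormal G) :=
  _root_.osculatingConormal_smooth h.injective h.sum_eq_zero h.smooth

theorem fst_rawEnvelopeExpansion (h : NormalizedData k G M) (x : ℝ) (c : Fin (d + 1)) :
    (rawEnvelopeExpansion k G x c).fst = G x c :=
  _root_.fst_rawEnvelopeExpansion h.injective h.sum_eq_zero h.smooth h.det_jet x c

theorem eventually_det_jet_conormalCurve_ne_zero (h : NormalizedData k G M) :
    ∀ᶠ ε in 𝓝[>] (0 : ℝ), ∀ x, (jet (conormalCurve k G ε) x).det ≠ 0 := by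
  have hE := h.conormal_expands
  have hφ := h.osculatingConormal_smooth
  have hfst : ∀ x, ((jet (conormalExpansion k G) x).det).fst = antidiagonalSign d := fun x => by
    rw [fst_det, hE.jet_map_fst]
    simp only [fst_conormalExpansion]
    exact det_jet_osculatingConormal hφ h.smooth h.det_jet x
  have hne : antidiagonalSign d ≠ 0 := left_ne_zero_of_mul_eq_one (antidiagonalSign_mul_self d)
  filter_upwards [(Expands.det hE.jet).eventually_forall_of_periodic Real.two_pi_pos (abs_pos.2 hne) hfst
    (hE.smooth.mono fun ε hε => det_jet_conormalCurve_periodic h.det_eq_one h.quasiPeriodic hε)] with ε hε x h0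
  have := hε x
  rw [h0, zero_sub, abs_neg] at this
  exact lt_irrefl _ this

theorem eventually_wronskian_pos (h : NormalizedData k G M) :
    ∀ᶠ ε in 𝓝[>] (0 : ℝ), ∀ x, 0 < (jet (rawEnvelope k G ε) x).det := by
  have hE := h.raw_expands
  have hfst : ∀ x, ((jet (rawEnvelopeExpansion k G) x).det).fst = 1 := fun x => by
    rw [fst_det, hE.jet_map_fst]
    simp only [h.fst_rawEnvelopeExpansion]
    exact h.det_jet x
  filter_upwards [(Expands.det hE.jet).eventually_forall_of_periodic Real.two_pi_pos one_pos hfst (by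
    filter_upwards [hE.smooth, h.conormal_expands.smooth] with ε h2 h3
    exact det_jet_periodic h.det_eq_one (rawEnvelope_quasiPeriodic h.det_eq_one h.quasiPeriodic h3) h2)] with ε hε x
  have := (abs_lt.1 (hε x)).1
  linarith

theorem expandsV_envelopeLift (h : NormalizedData k G M) : ExpandsV (envelopeLift k G) (envelopeLiftExpansion k G) := by
  intro c
  have hE := h.raw_expands
  refine Expands.mul (Expands.rpow (Expands.det hE.jet) (fun x => ?_)
    h.eventually_wronskian_pos _) (hE c)
  rw [fst_det, hE.jet_map_fst]
  simp only [h.fst_rawEnvelopeExpansion]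
  exact h.det_jet x

theorem eventually_det_jet_envelopeLift (h : NormalizedData k G M) :
    ∀ᶠ ε in 𝓝[>] (0 : ℝ), ∀ x, (jet (envelopeLift k G ε) x).det = 1 := by
  have hE := h.raw_expands
  filter_upwards [h.eventually_wronskian_pos, hE.smooth,
    (Expands.det hE.jet).smooth] with ε hpos h1 h2 x
  have hd : (d : ℝ) + 1 ≠ 0 := by positivity
  have := det_jet_smul (h2.rpow_const_of_ne (p := -((d : ℝ) + 1)⁻¹) fun x => (hpos x).ne') h1 x
  refine this.trans ?_
  rw [← Real.rpow_natCast, ← Real.rpow_mul (hpos x).le]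
  push_cast
  rw [neg_mul, inv_mul_cancel₀ hd, Real.rpow_neg_one, inv_mul_cancel₀ (hpos x).ne']

theorem eventually_envelopeLift_quasiPeriodic (h : NormalizedData k G M) :
    ∀ᶠ ε in 𝓝[>] (0 : ℝ), QuasiPeriodic M (2 * Real.pi) (envelopeLift k G ε) := by
  filter_upwards [h.raw_expands.smooth,
    h.conormal_expands.smooth] with ε h2 h3 x
  have h4 := rawEnvelope_quasiPeriodic h.det_eq_one h.quasiPeriodic h3
  have h5 := det_jet_periodic h.det_eq_one h4 h2 x
  funext c
  beta_reduce at h5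
  simp only [envelopeLift, h5, h4 x, Matrix.mulVec, dotProduct, Finset.mul_sum]
  exact Finset.sum_congr rfl fun b _ => by ring

/-- The cofactor vector is annihilated by the derivatives of the covector, and multiplication by a
function does not disturb this; `pairing_eq_zero'` then moves the derivatives onto the curve, as the
envelope condition requires. -/
theorem eventually_pairing_envelopeLift (h : NormalizedData k G M) :
    ∀ᶠ ε in 𝓝[>] (0 : ℝ), ∀ j < d, ∀ x,
      pairing (conormalCurve k G ε) (envelopeLift k G ε) 0 j x = 0 := by
  filter_upwards [h.conormal_expands.smooth,
    h.expandsV_envelopeLift.smooth] with ε h1 h2 j hj x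
  refine pairing_eq_zero' h1 h2 (fun i hi x => ?_) 0 j (by omega) x
  have h3 := sum_mul_adjugate (jet (conormalCurve k G ε) x) ⟨i, by omega⟩ (Fin.last d)
  rw [if_neg (by simp [Fin.ext_iff]; omega)] at h3
  simp only [pairing, iteratedDeriv_zero, envelopeLift, rawEnvelope, envelopeVec]
  have h4 : ∀ a b : ℝ, ∑ c, iteratedDeriv i (fun y => conormalCurve k G ε y c) x *
      (a * (b * (jet (conormalCurve k G ε) x).adjugate c (Fin.last d))) = a * b *
      ∑ c, jet (conormalCurve k G ε) x ⟨i, by omega⟩ c *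
        (jet (conormalCurve k G ε) x).adjugate c (Fin.last d) := fun a b => by
    rw [Finset.mul_sum]
    exact Finset.sum_congr rfl fun c _ => by simp only [jet, Matrix.of_apply]; ring
  rw [h4, h3, mul_zero]

theorem fst_envelopeLiftExpansion (h : NormalizedData k G M) (x : ℝ) (c : Fin (d + 1)) :
    (envelopeLiftExpansion k G x c).fst = G x c := by
  rw [envelopeLiftExpansion, fst_mul, h.fst_rawEnvelopeExpansion]
  simp

end NormalizedData

end Envelope

/-! ### Uniqueness of the envelope -/

section Uniqueness

variable {d : ℕ}

/-- This form depends on the rows of `H` only through their common kernel, so the nodes may be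
exchanged for the confluent frame. -/
theorem det_rowsWith_eq_zero_iff (H : Fin d → Fin (d + 1) → ℝ) (y : Fin (d + 1) → ℝ) :
    (rowsWith H y).det = 0 ↔
      ∃ v : Fin (d + 1) → ℝ, v ≠ 0 ∧ (∀ l, H l ⬝ᵥ v = 0) ∧ y ⬝ᵥ v = 0 := by
  rw [← Matrix.exists_mulVec_eq_zero_iff]
  refine exists_congr fun v => and_congr_right fun _ => ?_
  rw [funext_iff, Fin.forall_fin_succ']
  refine and_congr (forall_congr' fun l => ?_) ?_
  · rw [Matrix.mulVec, rowsWith_castSucc, Pi.zero_apply]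
  · rw [Matrix.mulVec, rowsWith_last, Pi.zero_apply]

variable {k : Fin d → ℝ} {G : ℝ → Fin (d + 1) → ℝ}

theorem confluentFrame_dotProduct (ε x : ℝ) (i : Fin d) (v : Fin (d + 1) → ℝ) :
    confluentFrame k G ε x i ⬝ᵥ v =
      (ε ^ (i : ℕ))⁻¹ * (nodeWeight k).mulVec (fun l => G (x + k l * ε) ⬝ᵥ v) i := by
  simp only [confluentFrame, nodeDiff, dotProduct, Matrix.mulVec, Finset.mul_sum, Finset.sum_mul]
  rw [Finset.sum_comm]
  exact Finset.sum_congr rfl fun l _ => Finset.sum_congr rfl fun c _ => by ring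

theorem det_confluentFrame_eq_zero_iff (hk : Function.Injective k) {ε : ℝ} (hε : ε ≠ 0) (x : ℝ)
    (y : Fin (d + 1) → ℝ) :
    (rowsWith (confluentFrame k G ε x) y).det = 0 ↔
      (rowsWith (fun l => G (x + k l * ε)) y).det = 0 := by
  rw [det_rowsWith_eq_zero_iff, det_rowsWith_eq_zero_iff]
  refine exists_congr fun v => and_congr_right fun _ => and_congr_left fun _ => ⟨fun h => ?_,
    fun h i => ?_⟩
  · refine congrFun (Matrix.eq_zero_of_mulVec_eq_zero (det_nodeWeight_ne_zero hk)
      (v := fun l => G (x + k l * ε) ⬝ᵥ v) (funext fun i => ?_))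
    have := h i
    rw [confluentFrame_dotProduct] at this
    exact (mul_eq_zero.1 this).resolve_left (inv_ne_zero (pow_ne_zero _ hε))
  · rw [confluentFrame_dotProduct]
    have : (fun l => G (x + k l * ε) ⬝ᵥ v) = 0 := funext h
    rw [this, Matrix.mulVec_zero, Pi.zero_apply, mul_zero]

theorem pairing_conormalCurve_eq_det {Z : ℝ → Fin (d + 1) → ℝ} (hZ : ContDiff ℝ ∞ Z) (ε x : ℝ)
    (j : ℕ) : pairing (conormalCurve k G ε) Z 0 j x =
      (rowsWith (confluentFrame k G ε x) (iteratedDeriv j Z x)).det := by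
  rw [det_rowsWith]
  simp only [iteratedDeriv_apply hZ]
  rfl

namespace NormalizedData

variable {M : Matrix (Fin (d + 1)) (Fin (d + 1)) ℝ}

theorem eventually_isEnvelopeLift (h : NormalizedData k G M) :
    ∀ᶠ ε in 𝓝[>] (0 : ℝ), IsEnvelopeLift k ε G (envelopeLift k G ε) := by
  filter_upwards [self_mem_nhdsWithin, h.eventually_pairing_envelopeLift,
    h.expandsV_envelopeLift.smooth, h.eventually_det_jet_envelopeLift,
    h.eventually_det_jet_conormalCurve_ne_zero] with ε hε hpair hsm hdet hne
  have hε0 : ε ≠ 0 := (show (0 : ℝ) < ε from hε).ne'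
  refine ⟨hsm, fun x => ?_, fun x j hj => ?_, fun x => by rw [wronskianDet_eq hsm, hdet]⟩
  -- A nonzero covector means that some unit vector completes the frame to a basis, so the points
  -- themselves are independent.
  · obtain ⟨c, hc⟩ : ∃ c, conormalCurve k G ε x c ≠ 0 := by
      by_contra hcon
      push Not at hcon
      exact hne x (Matrix.det_eq_zero_of_row_eq_zero 0 fun c => by simp [jet, hcon])
    have h1 : (rowsWith (fun l => G (x + k l * ε)) (Pi.single c 1)).det ≠ 0 := by
      rw [Ne, ← det_confluentFrame_eq_zero_iff h.injective hε0, det_rowsWith]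
      simpa [Pi.single_apply, conormalCurve] using hc
    have h2 := Matrix.linearIndependent_rows_of_det_ne_zero h1
    have h3 := h2.comp Fin.castSucc (Fin.castSucc_injective d)
    have h4 : (fun l => G (x + k l * ε)) =
        (rowsWith (fun l => G (x + k l * ε)) (Pi.single c 1)).row ∘ Fin.castSucc :=
      funext fun l => (rowsWith_castSucc (fun l => G (x + k l * ε)) (Pi.single c 1) l).symm
    rw [h4]
    exact h3
  · have h1 := hpair j hj x
    rw [pairing_conormalCurve_eq_det hsm, det_confluentFrame_eq_zero_iff h.injective hε0] at h1
    exact h1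

theorem isEnvelopeFamily_envelopeLift (h : NormalizedData k G M) :
    IsEnvelopeFamily k G (envelopeLift k G) := by
  refine ⟨h.eventually_isEnvelopeLift, fun x => ?_⟩
  have := h.expandsV_envelopeLift.tendsto x
  simpa only [h.fst_envelopeLiftExpansion] using this

/-- The envelope direction is unique, so two lifts differ by a smooth factor `f`; equal Wronskians
force `f^(d+1) = 1`, and continuity makes `f` constantly `1` or `-1`. -/
theorem eventually_eq_or_eq_neg (h : NormalizedData k G M) :
    ∀ᶠ ε in 𝓝[>] (0 : ℝ), ∀ Z, IsEnvelopeLift k ε G Z →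
      Z = envelopeLift k G ε ∨ Z = fun x => -envelopeLift k G ε x := by
  filter_upwards [self_mem_nhdsWithin, h.conormal_expands.smooth, h.raw_expands.smooth,
    h.expandsV_envelopeLift.smooth, h.eventually_det_jet_envelopeLift, h.eventually_wronskian_pos,
    h.eventually_det_jet_conormalCurve_ne_zero, (Expands.det h.conormal_expands.jet).smooth,
    (Expands.det h.raw_expands.jet).smooth] with ε hε hφ hraw hlift hdet hpos hne hsm1 hsm2 Z hZ
  have hε0 : ε ≠ 0 := (show (0 : ℝ) < ε from hε).ne'
  have hpair : ∀ j < d, ∀ x, pairing (conormalCurve k G ε) Z 0 j x = 0 := fun j hj x => by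
    rw [pairing_conormalCurve_eq_det hZ.smooth, det_confluentFrame_eq_zero_iff h.injective hε0]
    exact hZ.envelope x j hj
  have hann := fun x c => det_mul_of_rows_annihilate (jet (conormalCurve k G ε) x) (Z x) (fun i => by
    have := pairing_eq_zero hφ hZ.smooth hpair i 0 (by omega) x
    simpa [pairing, jet] using this) c
  set D : ℝ → ℝ := fun x => (jet (conormalCurve k G ε) x).det with hD
  set W : ℝ → ℝ := fun x => (jet (rawEnvelope k G ε) x).det with hW
  set κ : ℝ := (-1) ^ d * antidiagonalSign d with hκ
  have hκκ : κ * κ = 1 := by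
    rw [hκ, mul_mul_mul_comm, antidiagonalSign_mul_self, ← mul_pow]
    norm_num
  -- The factor is written by explicit smooth expressions: the proportionality of `Z` to the
  -- cofactor vector, with the sign and the normalizing power undone.
  set f : ℝ → ℝ := fun x =>
    pairing (conormalCurve k G ε) Z d 0 x * κ * (D x)⁻¹ * W x ^ ((d : ℝ) + 1)⁻¹ with hf
  have hpsm : ContDiff ℝ ∞ (pairing (conormalCurve k G ε) Z d 0) :=
    ContDiff.sum fun c _ => ((contDiff_component hφ c).iteratedDeriv_infty d).mul
      ((contDiff_component hZ.smooth c).iteratedDeriv_infty 0)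
  have hfsm : ContDiff ℝ ∞ f := ((hpsm.mul contDiff_const).mul (hsm1.inv hne)).mul
    (hsm2.rpow_const_of_ne fun x => (hpos x).ne')
  have hZf : Z = fun x c => f x * envelopeLift k G ε x c := by
    funext x c
    have h1 := hann x c
    have h2 : ∑ b, jet (conormalCurve k G ε) x (Fin.last d) b * Z x b =
        pairing (conormalCurve k G ε) Z d 0 x := by
      simp [pairing, jet]
    have h3 : W x ^ ((d : ℝ) + 1)⁻¹ * W x ^ (-((d : ℝ) + 1)⁻¹) = 1 := by
      rw [← Real.rpow_add (hpos x), add_neg_cancel, Real.rpow_zero]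
    have h4 : Z x c = (D x)⁻¹ * (pairing (conormalCurve k G ε) Z d 0 x *
        envelopeVec (conormalCurve k G ε) x c) := by
      rw [eq_inv_mul_iff_mul_eq₀ (hne x), ← h2]
      exact h1
    rw [h4]
    have h5 : envelopeLift k G ε x c =
        W x ^ (-((d : ℝ) + 1)⁻¹) * (κ * envelopeVec (conormalCurve k G ε) x c) := rfl
    rw [h5, hf]
    linear_combination (-(D x)⁻¹ * pairing (conormalCurve k G ε) Z d 0 x *
      envelopeVec (conormalCurve k G ε) x c) * (κ * κ * h3 + hκκ)
  have hf1 : ∀ x, f x ^ 2 = 1 := by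
    intro x
    have h1 := det_jet_smul hfsm hlift x
    rw [← hZf, hdet, mul_one, ← wronskianDet_eq hZ.smooth, hZ.wronskian] at h1
    have h2 : |f x| ^ (d + 1) = 1 := by rw [← abs_pow, ← h1, abs_one]
    have h3 := (pow_eq_one_iff_of_nonneg (abs_nonneg _) (Nat.succ_ne_zero d)).1 h2
    rw [← sq_abs, h3, one_pow]
  rcases isPreconnected_univ.eq_one_or_eq_neg_one_of_sq_eq hfsm.continuous.continuousOn
    (fun x _ => hf1 x) with h1 | h1
  · left
    rw [hZf]
    funext x c
    rw [h1 (Set.mem_univ x), Pi.one_apply, one_mul]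
  · right
    rw [hZf]
    funext x c
    rw [h1 (Set.mem_univ x)]
    simp

/-- Two opposite vectors cannot both lie within `‖G 0‖` of `G 0 ≠ 0`, so the limit at the single
point `0` excludes the other sign. -/
theorem eventually_eq_envelopeLift (h : NormalizedData k G M) {Z : ℝ → ℝ → Fin (d + 1) → ℝ}
    (hZ : IsEnvelopeFamily k G Z) : ∀ᶠ ε in 𝓝[>] (0 : ℝ), Z ε = envelopeLift k G ε := by
  have hG0 : 0 < ‖G 0‖ := by
    rw [norm_pos_iff]
    intro h0
    have := h.det_jet 0
    rw [Matrix.det_eq_zero_of_row_eq_zero 0 fun c => by simp [jet, h0]] at this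
    exact zero_ne_one this
  have h1 := Metric.tendsto_nhds.1 (hZ.tendsto 0) _ hG0
  have h2 := Metric.tendsto_nhds.1 (h.isEnvelopeFamily_envelopeLift.tendsto 0) _ hG0
  filter_upwards [h1, h2, hZ.lift, h.eventually_eq_or_eq_neg] with ε d1 d2 hl hor
  refine (hor _ hl).resolve_right fun hneg => ?_
  rw [hneg, dist_eq_norm] at d1
  rw [dist_eq_norm] at d2
  have e : (2 : ℝ) • G 0 = -((-envelopeLift k G ε 0 - G 0) + (envelopeLift k G ε 0 - G 0)) := by
    module
  have h3 := congrArg norm e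
  rw [norm_smul, norm_neg] at h3
  have h4 := norm_add_le (-envelopeLift k G ε 0 - G 0) (envelopeLift k G ε 0 - G 0)
  simp only [Real.norm_ofNat] at h3
  linarith

end NormalizedData

end Uniqueness

/-! ### The second order term of the envelope -/

section SecondOrder

open TrivSqZeroExt

variable {d : ℕ}

theorem pred_lt_of_two_le {d : ℕ} (hd : 2 ≤ d) : d - 1 < d := by omega

theorem Expands.neg {f : ℝ → ℝ → ℝ} {F : ℝ → DualNumber ℝ} (hf : Expands f F) :
    Expands (fun ε x => -f ε x) fun x => -F x := by
  simpa using (Expands.const (-1)).mul hf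

theorem ExpandsV.opCoeff {Z : ℝ → ℝ → Fin (d + 1) → ℝ} {Y : ℝ → Fin (d + 1) → DualNumber ℝ}
    (h : ExpandsV Z Y) (j : Fin (d + 1)) :
    Expands (fun ε x => opCoeff (Z ε) x j) fun x => opCoeff Y x j :=
  Expands.neg (Expands.sum _ fun c _ => ((h c).iteratedDeriv (d + 1)).mul
    (Expands.adjugate h.jet c j))

theorem ExpandsV.fst_opCoeff {Z : ℝ → ℝ → Fin (d + 1) → ℝ} {Y : ℝ → Fin (d + 1) → DualNumber ℝ}
    (h : ExpandsV Z Y) (x : ℝ) (j : Fin (d + 1)) :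
    (_root_.opCoeff Y x j).fst = _root_.opCoeff (fun x c => (Y x c).fst) x j := by
  rw [_root_.opCoeff, _root_.opCoeff, fst_neg, fst_sum]
  congr 1
  refine Finset.sum_congr rfl fun c _ => ?_
  rw [fst_mul, fst_adjugate, h.jet_map_fst, ← congrFun (iteratedDeriv_fst_dual (h c).coeff _) x]

/-- The second order term of the expansion of the envelope. -/
noncomputable def secondOrderTerm (k : Fin d → ℝ) (G : ℝ → Fin (d + 1) → ℝ) (x : ℝ)
    (c : Fin (d + 1)) : ℝ :=
  (envelopeLiftExpansion k G x c).snd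

namespace NormalizedData

variable {k : Fin d → ℝ} {G : ℝ → Fin (d + 1) → ℝ} {M : Matrix (Fin (d + 1)) (Fin (d + 1)) ℝ}

theorem fst_iteratedDeriv (h : NormalizedData k G M) (n : ℕ) (x : ℝ) (c : Fin (d + 1)) :
    (iteratedDeriv n (fun y => envelopeLiftExpansion k G y c) x).fst =
      iteratedDeriv n (fun y => G y c) x := by
  rw [← congrFun (iteratedDeriv_fst_dual (h.expandsV_envelopeLift c).coeff n) x]
  simp only [h.fst_envelopeLiftExpansion]

theorem snd_iteratedDeriv (h : NormalizedData k G M) (n : ℕ) (x : ℝ) (c : Fin (d + 1)) :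
    (iteratedDeriv n (fun y => envelopeLiftExpansion k G y c) x).snd =
      iteratedDeriv n (fun y => secondOrderTerm k G y c) x := by
  rw [← congrFun (iteratedDeriv_snd_dual (h.expandsV_envelopeLift c).coeff n) x]
  rfl

theorem secondOrderTerm_smooth (h : NormalizedData k G M) : ContDiff ℝ ∞ (secondOrderTerm k G) :=
  h.expandsV_envelopeLift.smooth_snd

theorem opCoeff_smooth (h : NormalizedData k G M) (j : Fin (d + 1)) :
    ContDiff ℝ ∞ fun x => opCoeff G x j := by
  have h1 := contDiff_fst_dual (h.expandsV_envelopeLift.opCoeff j).coeff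
  simpa only [h.expandsV_envelopeLift.fst_opCoeff, h.fst_envelopeLiftExpansion] using h1

/-- `G^(d+1)` is a combination of `G, …, G^(d-1)`, all of which lie in the osculating hyperplane. -/
theorem pairing_conormal_succ (h : NormalizedData k G M) (x : ℝ) :
    pairing (osculatingConormal G) G 0 (d + 1) x = 0 := by
  have h1 : ∀ c, iteratedDeriv (d + 1) (fun y => G y c) x =
      -∑ j : Fin d, opCoeff G x j.castSucc * iteratedDeriv j (fun y => G y c) x := fun c => by
    have h2 := sum_opCoeff (h.det_jet x) c
    rw [Fin.sum_univ_castSucc, opCoeff_last h.smooth h.det_jet, zero_mul, add_zero] at h2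
    rw [← neg_eq_iff_eq_neg, ← h2]
    rfl
  simp only [pairing, iteratedDeriv_zero, h1, mul_neg, Finset.mul_sum, Finset.sum_neg_distrib]
  rw [Finset.sum_comm, neg_eq_zero]
  refine Finset.sum_eq_zero fun j _ => ?_
  have h3 := pairing_osculatingConormal (G := G) j j.2 x
  simp only [pairing, iteratedDeriv_zero] at h3
  rw [← mul_zero (opCoeff G x j.castSucc), ← h3, Finset.mul_sum]
  exact Finset.sum_congr rfl fun c _ => by ring

/-- The perturbed covector annihilates both the `j`-th vector of the perturbed frame and the `j`-th
derivative of the envelope. Both relations have the same leading vector `G^(j)`, so subtracting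
their `ε²` parts eliminates the unknown perturbation of the covector. -/
theorem pairing_secondOrderTerm (h : NormalizedData k G M) (j : Fin d) (x : ℝ) :
    pairing (osculatingConormal G) (secondOrderTerm k G) 0 j x =
      nodeCoeff k j * pairing (osculatingConormal G) G 0 (j + 2) x := by
  have ha := congrArg snd (conormal_dot_self (osculatingFrame k G x) j)
  have hb : (fun x => ∑ c, conormalExpansion k G x c *
      iteratedDeriv j (fun y => envelopeLiftExpansion k G y c) x) = fun _ => inl 0 := by
    refine (Expands.sum Finset.univ fun c _ => (h.conormal_expands c).mul
      ((h.expandsV_envelopeLift c).iteratedDeriv j)).toApprox.unique (Expands.const 0).toApprox ?_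
    filter_upwards [h.eventually_pairing_envelopeLift] with ε hε
    funext x
    simpa [pairing] using hε j j.2 x
  have hb' := congrArg snd (congrFun hb x)
  rw [snd_sum, snd_zero] at ha
  rw [snd_sum, snd_inl] at hb'
  have ha' : ∑ c, (osculatingConormal G x c *
      (nodeCoeff k j * iteratedDeriv (j + 2) (fun y => G y c) x) +
      (conormalExpansion k G x c).snd * iteratedDeriv j (fun y => G y c) x) = 0 := by
    rw [← ha]
    refine Finset.sum_congr rfl fun c _ => ?_
    change _ = (conormalExpansion k G x c * osculatingFrame k G x j c).snd
    rw [snd_mul, fst_conormalExpansion]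
    simp [osculatingFrame, mul_comm]
  have hb2 : ∑ c, (osculatingConormal G x c *
      iteratedDeriv j (fun y => secondOrderTerm k G y c) x +
      (conormalExpansion k G x c).snd * iteratedDeriv j (fun y => G y c) x) = 0 := by
    rw [← hb']
    refine Finset.sum_congr rfl fun c _ => ?_
    rw [snd_mul, fst_conormalExpansion, h.fst_iteratedDeriv, h.snd_iteratedDeriv]
    simp
  rw [Finset.sum_add_distrib] at ha' hb2
  have e : ∑ c, osculatingConormal G x c *
      (nodeCoeff k j * iteratedDeriv (j + 2) (fun y => G y c) x) =
      nodeCoeff k j * pairing (osculatingConormal G) G 0 (j + 2) x := by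
    rw [pairing, Finset.mul_sum]
    exact Finset.sum_congr rfl fun c _ => by rw [iteratedDeriv_zero]; ring
  rw [← e]
  simp only [pairing, iteratedDeriv_zero]
  linarith

/-- The pairing on the right is nonzero only for `j = d - 2`, so the single constant `c_{d-2}` may
replace every `c_j`. -/
theorem pairing_secondOrderTerm' (h : NormalizedData k G M) (hd : 2 ≤ d) (j : ℕ) (hj : j < d)
    (x : ℝ) : pairing (osculatingConormal G) (secondOrderTerm k G) 0 j x =
      nodeCoeff k ⟨d - 2, by omega⟩ * pairing (osculatingConormal G) G 0 (j + 2) x := by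
  rw [h.pairing_secondOrderTerm ⟨j, hj⟩]
  rcases lt_trichotomy (j + 2) d with h1 | h1 | h1
  · simp only [pairing_osculatingConormal (G := G) (j + 2) h1, mul_zero]
  · have : (⟨j, hj⟩ : Fin d) = ⟨d - 2, by omega⟩ := Fin.ext (by simp; omega)
    rw [this]
    change _ * pairing _ _ 0 (d - 2 + 2) x = _
    rw [show d - 2 + 2 = j + 2 by omega]
  · have h2 : j + 2 = d + 1 := by omega
    simp only [h2, h.pairing_conormal_succ, mul_zero]

/-- Up to a multiple of `G`, the second order term is proportional to `G''`. -/
theorem exists_secondOrderTerm_eq (h : NormalizedData k G M) (hd : 2 ≤ d) :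
    ∃ f : ℝ → ℝ, ContDiff ℝ ∞ f ∧ ∀ x c, secondOrderTerm k G x c =
      nodeCoeff k ⟨d - 2, by omega⟩ * iteratedDeriv 2 (fun y => G y c) x + f x * G x c := by
  set C := nodeCoeff k ⟨d - 2, by omega⟩ with hC
  set φ := osculatingConormal G with hφ
  have hφs : ContDiff ℝ ∞ φ := h.osculatingConormal_smooth
  -- The difference from `C G''` is annihilated by `φ, …, φ^(d-1)`, as `G` is, and is therefore a
  -- multiple of `G`.
  set Y : ℝ → Fin (d + 1) → ℝ := fun x c =>
    secondOrderTerm k G x c - C * iteratedDeriv 2 (fun y => G y c) x with hY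
  have hYs : ContDiff ℝ ∞ Y := contDiff_pi.2 fun c =>
    (contDiff_component h.secondOrderTerm_smooth c).sub
      (contDiff_const.mul ((contDiff_component h.smooth c).iteratedDeriv_infty 2))
  have hYp : ∀ j < d, ∀ x, pairing φ Y 0 j x = 0 := by
    intro j hj x
    have h1 : ∀ c, iteratedDeriv j (fun y => Y y c) x =
        iteratedDeriv j (fun y => secondOrderTerm k G y c) x -
          C * iteratedDeriv (j + 2) (fun y => G y c) x := by
      intro c
      have hle : (((j : ℕ) : ℕ∞) : WithTop ℕ∞) ≤ ∞ := by exact_mod_cast le_top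
      have h2 := (contDiff_component h.smooth c).iteratedDeriv_infty 2
      have h3 : iteratedDeriv (j + 2) (fun y => G y c) =
          iteratedDeriv j (iteratedDeriv 2 fun y => G y c) := by
        simp only [iteratedDeriv_eq_iterate, Function.iterate_add_apply]
      rw [h3, ← iteratedDeriv_const_mul_field, ← iteratedDeriv_fun_sub
        ((contDiff_component h.secondOrderTerm_smooth c).contDiffAt.of_le hle)
        ((contDiff_const.mul h2).contDiffAt.of_le hle)]
    have h4 := h.pairing_secondOrderTerm' hd j hj x
    simp only [pairing, h1, mul_sub, Finset.sum_sub_distrib]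
    simp only [pairing] at h4
    rw [h4, Finset.mul_sum, sub_eq_zero]
    exact Finset.sum_congr rfl fun c _ => by ring
  refine ⟨fun x => (-1) ^ d * pairing φ Y d 0 x, contDiff_const.mul (ContDiff.sum fun c _ =>
    ((contDiff_component hφs c).iteratedDeriv_infty d).mul
      ((contDiff_component hYs c).iteratedDeriv_infty 0)), fun x c => ?_⟩
  have h1 := det_mul_of_rows_annihilate (jet φ x) (Y x) (fun i => by
    have := pairing_eq_zero hφs hYs hYp i 0 (by omega) x
    simpa [pairing, jet] using this) c
  rw [det_jet_osculatingConormal hφs h.smooth h.det_jet] at h1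
  have h2 : ∑ b, jet φ x (Fin.last d) b * Y x b = pairing φ Y d 0 x := by simp [pairing, jet]
  rw [h2] at h1
  rw [← sub_eq_iff_eq_add']
  change Y x c = _
  rw [← envelopeVec_osculatingConormal hφs h.smooth h.det_jet x c]
  have h3 : ((-1 : ℝ) ^ d) * (-1) ^ d = 1 := by rw [← mul_pow]; norm_num
  change _ = (-1) ^ d * pairing φ Y d 0 x *
    ((-1) ^ d * antidiagonalSign d * (jet φ x).adjugate c (Fin.last d))
  linear_combination antidiagonalSign d * h1 - Y x c * antidiagonalSign_mul_self d -
    antidiagonalSign d * pairing φ Y d 0 x * (jet φ x).adjugate c (Fin.last d) * h3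

theorem sum_snd_jet_mul_adjugate (h : NormalizedData k G M) (x : ℝ) :
    ∑ i : Fin (d + 1), ∑ c, iteratedDeriv i (fun y => secondOrderTerm k G y c) x *
      (jet G x).adjugate c i = 0 := by
  have h1 : (fun x => (jet (envelopeLiftExpansion k G) x).det) = fun _ => inl 1 :=
    (Expands.det h.expandsV_envelopeLift.jet).toApprox.unique (Expands.const 1).toApprox
      (h.eventually_det_jet_envelopeLift.mono fun ε hε => funext hε)
  have h2 : (jet (envelopeLiftExpansion k G) x).map fst = jet G x := by
    rw [h.expandsV_envelopeLift.jet_map_fst]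
    simp only [h.fst_envelopeLiftExpansion]
  have h3 := snd_det _ (by rw [h2, h.det_jet])
  rw [congrFun h1 x, h2, snd_inl] at h3
  rw [h3]
  refine Finset.sum_congr rfl fun i _ => Finset.sum_congr rfl fun c _ => ?_
  rw [← h.snd_iteratedDeriv]
  rfl

/-- Differentiating `L G = 0` once shows that `G^(d)` enters `G^(d+2)` with coefficient `-u_{d-1}`.
-/
theorem iteratedDeriv_add_two_dual (h : NormalizedData k G M) (x : ℝ) :
    ∑ c, iteratedDeriv (d + 2) (fun y => G y c) x * (jet G x).adjugate c (Fin.last d) =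
      -∑ j : Fin d, opCoeff G x j.castSucc * if (j : ℕ) + 1 = d then 1 else 0 := by
  have h1 : ∀ c, iteratedDeriv (d + 1) (fun y => G y c) = fun x =>
      -∑ j : Fin d, opCoeff G x j.castSucc * iteratedDeriv j (fun y => G y c) x := fun c => by
    funext x
    have h2 := sum_opCoeff (h.det_jet x) c
    rw [Fin.sum_univ_castSucc, opCoeff_last h.smooth h.det_jet, zero_mul, add_zero] at h2
    rw [← neg_eq_iff_eq_neg, ← h2]
    rfl
  have h2 : ∀ c, iteratedDeriv (d + 2) (fun y => G y c) x = -∑ j : Fin d,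
      (deriv (fun x => opCoeff G x j.castSucc) x * jet G x j.castSucc c +
        opCoeff G x j.castSucc * jet G x j.succ c) := fun c => by
    have h3 : HasDerivAt (fun x => -∑ j : Fin d, opCoeff G x j.castSucc *
        iteratedDeriv j (fun y => G y c) x) (-∑ j : Fin d,
      (deriv (fun x => opCoeff G x j.castSucc) x * jet G x j.castSucc c +
        opCoeff G x j.castSucc * jet G x j.succ c)) x := by
      refine (HasDerivAt.fun_sum fun j _ => ?_).neg
      exact ((h.opCoeff_smooth j.castSucc).differentiable_infty x).hasDerivAt.mul
        (hasDerivAt_iteratedDeriv (contDiff_component h.smooth c) j x)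
    rw [← h1 c] at h3
    exact (hasDerivAt_iteratedDeriv (contDiff_component h.smooth c) (d + 1) x).unique h3
  simp only [h2, neg_mul, Finset.sum_mul, Finset.sum_neg_distrib]
  rw [Finset.sum_comm]
  congr 1
  refine Finset.sum_congr rfl fun j _ => ?_
  have h4 := sum_mul_adjugate (jet G x) j.castSucc (Fin.last d)
  have h5 := sum_mul_adjugate (jet G x) j.succ (Fin.last d)
  rw [if_neg (Fin.castSucc_lt_last j).ne] at h4
  rw [h.det_jet] at h5
  have h6 : (if (j : ℕ) + 1 = d then (1 : ℝ) else 0) = if j.succ = Fin.last d then 1 else 0 := by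
    simp [Fin.ext_iff]
  have h7 : ∑ c, (deriv (fun x => opCoeff G x j.castSucc) x * jet G x j.castSucc c +
      opCoeff G x j.castSucc * jet G x j.succ c) * (jet G x).adjugate c (Fin.last d) =
      deriv (fun x => opCoeff G x j.castSucc) x *
        ∑ c, jet G x j.castSucc c * (jet G x).adjugate c (Fin.last d) +
      opCoeff G x j.castSucc * ∑ c, jet G x j.succ c * (jet G x).adjugate c (Fin.last d) := by
    rw [Finset.mul_sum, Finset.mul_sum, ← Finset.sum_add_distrib]
    exact Finset.sum_congr rfl fun c _ => by ring
  rw [h7, h4, h5, h6, mul_zero, zero_add]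

/-- This is the trace of `G^(i) ↦ G^(i+2)` in the frame of derivatives. Only the rows `i = d - 1`
and `i = d` have diagonal entries, each equal to `-u_{d-1}`. -/
theorem sum_iteratedDeriv_add_two (h : NormalizedData k G M) (hd : 2 ≤ d) (x : ℝ) :
    ∑ i : Fin (d + 1), ∑ c, iteratedDeriv (i + 2) (fun y => G y c) x * (jet G x).adjugate c i =
      -2 * opCoeff G x ⟨d - 1, by omega⟩ := by
  obtain ⟨e, rfl⟩ := Nat.exists_eq_add_of_le' hd
  rw [Fin.sum_univ_castSucc, Fin.sum_univ_castSucc, Finset.sum_eq_zero, zero_add]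
  · have h1 := h.iteratedDeriv_add_two_dual x
    rw [Finset.sum_eq_single (⟨e + 1, by omega⟩ : Fin (e + 2))] at h1
    · have h2 : ∑ c, iteratedDeriv (e + 1 + 2) (fun y => G y c) x *
          (jet G x).adjugate c ⟨e + 1, by omega⟩ = -opCoeff G x ⟨e + 1, by omega⟩ := by
        rw [opCoeff, neg_neg]
      have h3 : opCoeff G x (Fin.castSucc (⟨e + 1, by omega⟩ : Fin (e + 2))) =
        opCoeff G x ⟨e + 1, by omega⟩ := rfl
      rw [h3] at h1
      simp only [Fin.val_castSucc, Fin.val_last]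
      refine (congrArg₂ (· + ·) h2 h1).trans ?_
      have h4 : opCoeff G x ⟨e + 2 - 1, by omega⟩ = opCoeff G x ⟨e + 1, by omega⟩ := rfl
      rw [h4]
      simp
      ring
    · intro j _ hj
      rw [if_neg, mul_zero]
      intro h0
      exact hj (Fin.ext (by simp; omega))
    · simp
  · intro i _
    have h1 := sum_mul_adjugate (jet G x) ⟨i + 2, by omega⟩ i.castSucc.castSucc
    rw [if_neg (by simp [Fin.ext_iff])] at h1
    exact h1

/-- In `Y = C G'' + f G` the linearized Wronskian condition reads `-2 C u_{d-1} + (d + 1) f = 0`,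
the term `f G` having a triangular transition matrix with diagonal `f`. -/
theorem secondOrderTerm_eq (h : NormalizedData k G M) (hd : 2 ≤ d) (x : ℝ) (c : Fin (d + 1)) :
    secondOrderTerm k G x c = nodeCoeff k ⟨d - 2, by omega⟩ *
      (iteratedDeriv 2 (fun y => G y c) x +
        2 / ((d : ℝ) + 1) * opCoeff G x ⟨d - 1, by omega⟩ * G x c) := by
  obtain ⟨f, hf, hfe⟩ := h.exists_secondOrderTerm_eq hd
  set C := nodeCoeff k ⟨d - 2, by omega⟩ with hC
  have h1 := h.sum_snd_jet_mul_adjugate x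
  have h2 : ∀ (i : Fin (d + 1)) c, iteratedDeriv i (fun y => secondOrderTerm k G y c) x =
      C * iteratedDeriv (i + 2) (fun y => G y c) x + jet (fun y c => f y * G y c) x i c := by
    intro i c
    have hle : (((i : ℕ) : ℕ∞) : WithTop ℕ∞) ≤ ∞ := by exact_mod_cast le_top
    have h3 : iteratedDeriv (i + 2) (fun y => G y c) =
        iteratedDeriv i (iteratedDeriv 2 fun y => G y c) := by
      simp only [iteratedDeriv_eq_iterate, Function.iterate_add_apply]
    have h4 := (contDiff_component h.smooth c).iteratedDeriv_infty 2
    simp only [hfe]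
    rw [iteratedDeriv_fun_add ((contDiff_const.mul h4).contDiffAt.of_le hle)
      ((hf.mul (contDiff_component h.smooth c)).contDiffAt.of_le hle),
      iteratedDeriv_const_mul_field, h3]
    rfl
  have h5 : ∑ i, ∑ c, jet (fun y c => f y * G y c) x i c * (jet G x).adjugate c i =
      ((d : ℝ) + 1) * f x := by
    have h6 : ∀ i, ∑ c, jet (fun y c => f y * G y c) x i c * (jet G x).adjugate c i =
        leibnizMatrix d f x i i := by
      intro i
      rw [jet_smul hf h.smooth]
      have h7 : leibnizMatrix d f x * jet G x * (jet G x).adjugate = leibnizMatrix d f x := by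
        rw [Matrix.mul_assoc, Matrix.mul_adjugate, h.det_jet, one_smul, Matrix.mul_one]
      exact congrFun (congrFun h7 i) i
    rw [Finset.sum_congr rfl fun i _ => h6 i]
    simp [leibnizMatrix]
  simp only [h2, add_mul, Finset.sum_add_distrib] at h1
  rw [h5] at h1
  have h8 := h.sum_iteratedDeriv_add_two hd x
  have h9 : ∑ i : Fin (d + 1), ∑ c, C * iteratedDeriv (i + 2) (fun y => G y c) x *
      (jet G x).adjugate c i = C * (-2 * opCoeff G x ⟨d - 1, by omega⟩) := by
    rw [← h8]
    simp only [Finset.mul_sum, mul_assoc]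
  rw [h9] at h1
  have hd1 : (d : ℝ) + 1 ≠ 0 := by positivity
  have h10 : f x = C * (2 / ((d : ℝ) + 1) * opCoeff G x ⟨d - 1, by omega⟩) := by
    field_simp
    linarith
  rw [hfe, h10]
  ring

/-- The linearization of the equation satisfied by the envelope. -/
theorem linearized_operator (h : NormalizedData k G M) (x : ℝ) (c : Fin (d + 1)) :
    iteratedDeriv (d + 1) (fun y => secondOrderTerm k G y c) x +
      ∑ j : Fin d, (opCoeff G x j.castSucc * iteratedDeriv j (fun y => secondOrderTerm k G y c) x +
        (opCoeff (envelopeLiftExpansion k G) x j.castSucc).snd *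
          iteratedDeriv j (fun y => G y c) x) = 0 := by
  have hE := h.expandsV_envelopeLift
  have h1 : (fun x => iteratedDeriv (d + 1) (fun y => envelopeLiftExpansion k G y c) x +
      ∑ j : Fin d, opCoeff (envelopeLiftExpansion k G) x j.castSucc *
        iteratedDeriv j (fun y => envelopeLiftExpansion k G y c) x) = fun _ => inl 0 := by
    refine (((hE c).iteratedDeriv (d + 1)).add (Expands.sum Finset.univ fun j _ =>
      (hE.opCoeff (Fin.castSucc j)).mul ((hE c).iteratedDeriv j))).toApprox.unique
        (Expands.const 0).toApprox ?_
    filter_upwards [h.eventually_det_jet_envelopeLift, hE.smooth] with ε h2 h3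
    funext x
    have := congrFun (applyOp_opCoeff h3 h2 x) c
    simpa [applyOp, iteratedDeriv_apply h3] using this
  have h2 := congrArg snd (congrFun h1 x)
  rw [snd_add, snd_sum, snd_inl, h.snd_iteratedDeriv] at h2
  rw [← h2]
  congr 1
  refine Finset.sum_congr rfl fun j _ => ?_
  rw [snd_mul, hE.fst_opCoeff, h.fst_iteratedDeriv, h.snd_iteratedDeriv]
  simp only [h.fst_envelopeLiftExpansion]
  simp

end NormalizedData

end SecondOrder

/-! ### The flow -/

section JetFunctional

theorem iteratedDeriv_iteratedDeriv (m n : ℕ) (f : ℝ → ℝ) :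
    iteratedDeriv m (iteratedDeriv n f) = iteratedDeriv (n + m) f := by
  simp only [iteratedDeriv_eq_iterate, ← Function.iterate_add_apply, add_comm]

/-- The functional is a linear combination of the derivatives at `x` of order less than `n`. -/
def IsJetFunctional (n : ℕ) (x : ℝ) (T : (ℝ → ℝ) → ℝ) : Prop :=
  ∃ a : ℕ → ℝ, ∀ f, ContDiff ℝ ∞ f → T f = ∑ j ∈ Finset.range n, a j * iteratedDeriv j f x

namespace IsJetFunctional

variable {n : ℕ} {x : ℝ} {S T : (ℝ → ℝ) → ℝ}

theorem iteratedDeriv {m : ℕ} (h : m < n) : IsJetFunctional n x fun f => iteratedDeriv m f x :=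
  ⟨fun j => if j = m then 1 else 0, fun f _ => by simp [h]⟩

theorem add (hS : IsJetFunctional n x S) (hT : IsJetFunctional n x T) :
    IsJetFunctional n x fun f => S f + T f := by
  obtain ⟨a, ha⟩ := hS
  obtain ⟨b, hb⟩ := hT
  exact ⟨fun j => a j + b j, fun f hf => by
    beta_reduce
    rw [ha f hf, hb f hf, ← Finset.sum_add_distrib]
    exact Finset.sum_congr rfl fun j _ => (add_mul _ _ _).symm⟩

theorem const_mul (c : ℝ) (hT : IsJetFunctional n x T) : IsJetFunctional n x fun f => c * T f := by
  obtain ⟨b, hb⟩ := hT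
  exact ⟨fun j => c * b j, fun f hf => by
    beta_reduce
    rw [hb f hf, Finset.mul_sum]
    exact Finset.sum_congr rfl fun j _ => (mul_assoc _ _ _).symm⟩

theorem sum {ι : Type*} (s : Finset ι) {S : ι → (ℝ → ℝ) → ℝ}
    (h : ∀ i ∈ s, IsJetFunctional n x (S i)) : IsJetFunctional n x fun f => ∑ i ∈ s, S i f := by
  classical
  induction s using Finset.induction_on with
  | empty => exact ⟨0, fun f _ => by simp⟩
  | insert a s ha ih =>
    simp only [Finset.sum_insert ha]
    exact (h a (by simp)).add (ih fun i hi => h i (by simp [hi]))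

theorem commutator_mul {q : ℝ → ℝ} (hq : ContDiff ℝ ∞ q) {m : ℕ} (h : m ≤ n) :
    IsJetFunctional n x fun f =>
      _root_.iteratedDeriv m (fun y => q y * f y) x - q x * _root_.iteratedDeriv m f x := by
  refine ⟨fun j => if j < m then (m.choose j : ℝ) * _root_.iteratedDeriv (m - j) q x else 0,
    fun f hf => ?_⟩
  have hle : ((m : ℕ) : WithTop ℕ∞) ≤ ∞ := by exact_mod_cast le_top
  have e : (fun y => q y * f y) = f * q := funext fun y => mul_comm _ _
  beta_reduce
  rw [e, iteratedDeriv_mul (hf.contDiffAt.of_le hle) (hq.contDiffAt.of_le hle),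
    Finset.sum_range_succ, Nat.choose_self, Nat.sub_self, iteratedDeriv_zero, Nat.cast_one, one_mul,
    mul_comm (q x), add_sub_cancel_right, ← Finset.sum_subset (Finset.range_mono h)]
  · refine Finset.sum_congr rfl fun j hj => ?_
    rw [if_pos (Finset.mem_range.1 hj)]
    ring
  · intro j _ hj
    rw [if_neg (by simpa using hj), zero_mul]

/-- The commutator of `∂² + q` with `∂^{d+1} + u_{d-1} ∂^{d-1} + ⋯ + u_0` has order at most `d`. -/
theorem commutator_applyOp {d : ℕ} {u : Fin d → ℝ → ℝ} (hu : ∀ j, ContDiff ℝ ∞ (u j)) {q : ℝ → ℝ}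
    (hq : ContDiff ℝ ∞ q) (x : ℝ) : IsJetFunctional (d + 1) x fun f =>
      (_root_.iteratedDeriv 2 (applyOp u f) x + q x * applyOp u f x) -
        applyOp u (fun y => _root_.iteratedDeriv 2 f y + q y * f y) x := by
  -- What remains of the commutator once `∂^(d+3)`, the terms `u_j ∂^(j+2)` and the products of `q`
  -- with the operator cancel.
  have key : IsJetFunctional (d + 1) x fun f =>
      ∑ j : Fin d, (_root_.iteratedDeriv 2 (u j) x * _root_.iteratedDeriv j f x +
        2 * deriv (u j) x * _root_.iteratedDeriv (j + 1) f x) +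
      ((-1) * (_root_.iteratedDeriv (d + 1) (fun y => q y * f y) x -
        q x * _root_.iteratedDeriv (d + 1) f x) +
      ∑ j : Fin d, -u j x * (_root_.iteratedDeriv j (fun y => q y * f y) x -
        q x * _root_.iteratedDeriv j f x)) := by
    refine (sum _ fun j _ => ?_).add (((commutator_mul hq le_rfl).const_mul _).add
      (sum _ fun j _ => (commutator_mul hq (by omega)).const_mul _))
    exact ((iteratedDeriv (by omega)).const_mul _).add ((iteratedDeriv (by omega)).const_mul _)
  obtain ⟨a, ha⟩ := key
  refine ⟨a, fun f hf => ?_⟩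
  rw [← ha f hf]
  have hle : ∀ n : ℕ, ((n : ℕ) : WithTop ℕ∞) ≤ ∞ := fun n => by exact_mod_cast le_top
  have h1 : _root_.iteratedDeriv 2 (applyOp u f) x = _root_.iteratedDeriv (d + 1 + 2) f x +
      ∑ j : Fin d, (_root_.iteratedDeriv 2 (u j) x * _root_.iteratedDeriv j f x +
        2 * deriv (u j) x * _root_.iteratedDeriv (j + 1) f x +
        u j x * _root_.iteratedDeriv (j + 2) f x) := by
    have e : applyOp u f = fun x => _root_.iteratedDeriv (d + 1) f x +
        ∑ j : Fin d, (u j * _root_.iteratedDeriv j f) x := rfl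
    have hsm : ∀ j : Fin d, ContDiff ℝ ∞ (u j * _root_.iteratedDeriv j f) := fun j =>
      (hu j).mul (hf.iteratedDeriv_infty j)
    rw [e, iteratedDeriv_fun_add ((hf.iteratedDeriv_infty _).contDiffAt.of_le (hle 2))
      ((ContDiff.sum fun j _ => hsm j).contDiffAt.of_le (hle 2)), iteratedDeriv_fun_sum fun j _ =>
      (hsm j).contDiffAt.of_le (hle 2), iteratedDeriv_iteratedDeriv]
    congr 1
    refine Finset.sum_congr rfl fun j _ => ?_
    rw [iteratedDeriv_mul ((hu j).contDiffAt.of_le (hle 2))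
      ((hf.iteratedDeriv_infty j).contDiffAt.of_le (hle 2))]
    simp only [Finset.sum_range_succ, Finset.sum_range_zero, iteratedDeriv_iteratedDeriv]
    simp
    ring
  have h2 : ∀ m, _root_.iteratedDeriv m (fun y => _root_.iteratedDeriv 2 f y + q y * f y) x =
      _root_.iteratedDeriv (m + 2) f x + _root_.iteratedDeriv m (fun y => q y * f y) x := by
    intro m
    rw [iteratedDeriv_fun_add ((hf.iteratedDeriv_infty _).contDiffAt.of_le (hle m))
      ((hq.mul hf).contDiffAt.of_le (hle m)), iteratedDeriv_iteratedDeriv, add_comm 2 m]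
  beta_reduce
  rw [h1]
  simp only [applyOp, h2, smul_eq_mul, mul_add, neg_mul, mul_sub, Finset.sum_add_distrib,
    Finset.sum_sub_distrib, Finset.sum_neg_distrib, Finset.mul_sum]
  have h3 : ∑ j : Fin d, q x * (u j x * _root_.iteratedDeriv j f x) =
      ∑ j : Fin d, u j x * (q x * _root_.iteratedDeriv j f x) :=
    Finset.sum_congr rfl fun j _ => by ring
  rw [h3]
  ring

end IsJetFunctional

end JetFunctional

/-! ### Identification of the limit with the KdV flow -/

section Flow

open TrivSqZeroExt

variable {d : ℕ}

namespace NormalizedData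

variable {k : Fin d → ℝ} {G : ℝ → Fin (d + 1) → ℝ} {M : Matrix (Fin (d + 1)) (Fin (d + 1)) ℝ}

theorem opCoeff_expansion_periodic (h : NormalizedData k G M) (j : Fin (d + 1)) :
    Function.Periodic (fun x => opCoeff (envelopeLiftExpansion k G) x j) (2 * Real.pi) := by
  refine (h.expandsV_envelopeLift.opCoeff j).periodic ?_
  filter_upwards [h.expandsV_envelopeLift.smooth, h.eventually_det_jet_envelopeLift,
    h.eventually_envelopeLift_quasiPeriodic] with ε h1 h2 h3 x
  exact congrFun (opCoeff_periodic h1 h2 h3 x) j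

theorem isCircleCoeffs_opCoeff (h : NormalizedData k G M) :
    IsCircleCoeffs fun (j : Fin d) x => opCoeff G x j.castSucc := fun j =>
  ⟨h.opCoeff_smooth j.castSucc, fun x =>
    congrFun (opCoeff_periodic h.smooth h.det_jet h.quasiPeriodic x) j.castSucc⟩

theorem isCircleCoeffs_velocity (h : NormalizedData k G M) (C : ℝ) :
    IsCircleCoeffs fun (j : Fin d) x =>
      (opCoeff (envelopeLiftExpansion k G) x j.castSucc).snd / C := fun j =>
  ⟨(contDiff_snd_dual (h.expandsV_envelopeLift.opCoeff j.castSucc).coeff).div_const C,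
    fun x => congrArg (fun F => TrivSqZeroExt.snd F / C) (h.opCoeff_expansion_periodic _ x)⟩

/-- On the components of `G` the commutator reduces to `-L Q₂ G`, which the linearized equation
equates with the velocity divided by `C`; the Wronskian then gives equality of operators. -/
theorem isKdVVelocity (h : NormalizedData k G M) (hd : 2 ≤ d) :
    IsKdVVelocity 2 (fun (j : Fin d) x => opCoeff G x j.castSucc) fun (j : Fin d) x =>
      (opCoeff (envelopeLiftExpansion k G) x j.castSucc).snd /
        nodeCoeff k ⟨d - 2, by omega⟩ := by
  set u : Fin d → ℝ → ℝ := fun j x => opCoeff G x j.castSucc with hu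
  set C := nodeCoeff k ⟨d - 2, by omega⟩ with hC
  have hC0 : C ≠ 0 := nodeCoeff_ne_zero h.injective h.sum_eq_zero (by simp; omega)
  have hus : ∀ j, ContDiff ℝ ∞ (u j) := fun j => h.opCoeff_smooth j.castSucc
  obtain ⟨R, hR⟩ := exists_isOperatorRoot hus
  refine ⟨R, hR, fun f hf x => ?_⟩
  set q : ℝ → ℝ := fun x => 2 / ((d : ℝ) + 1) * u ⟨d - 1, pred_lt_of_two_le hd⟩ x with hq
  have hqs : ContDiff ℝ ∞ q := contDiff_const.mul (hus _)
  have hQ : ∀ g, applyDiffPart 2 (psiPow R 2) g = fun x => iteratedDeriv 2 g x + q x * g x :=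
    fun g => funext fun x => hR.applyDiffPart_two (by omega) g x
  rw [hQ, hQ]
  obtain ⟨a, ha⟩ := IsJetFunctional.commutator_applyOp hus hqs x
  have hLG : ∀ c, applyOp u (fun y => G y c) = fun _ => 0 := fun c => by
    funext y
    have := congrFun (applyOp_opCoeff h.smooth h.det_jet y) c
    simpa [applyOp, iteratedDeriv_apply h.smooth] using this
  have hZ : ∀ c, (fun y => secondOrderTerm k G y c) =
      fun y => C * (iteratedDeriv 2 (fun y => G y c) y + q y * G y c) := fun c =>
    funext fun y => h.secondOrderTerm_eq hd y c
  have hlin : ∀ c, C * applyOp u (fun y => iteratedDeriv 2 (fun y => G y c) y + q y * G y c) x +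
      ∑ j : Fin d, (opCoeff (envelopeLiftExpansion k G) x j.castSucc).snd *
        iteratedDeriv j (fun y => G y c) x = 0 := by
    intro c
    have h1 := h.linearized_operator x c
    rw [Finset.sum_add_distrib, hZ c] at h1
    simp only [iteratedDeriv_const_mul_field] at h1
    rw [← h1, applyOp, mul_add, Finset.mul_sum, add_assoc]
    congr 2
    exact Finset.sum_congr rfl fun j _ => by rw [smul_eq_mul]; ring
  -- The commutator is known only to have order at most `d`; comparison with the velocity, padded by
  -- a zero, also shows that its `∂^d` coefficient vanishes.
  have hab : (fun j : Fin (d + 1) => a j) = Fin.snoc (α := fun _ => ℝ)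
      (fun j : Fin d => (opCoeff (envelopeLiftExpansion k G) x j.castSucc).snd / C) 0 := by
    refine eq_of_sum_jet_eq (Z := G) (x := x) (by rw [h.det_jet]; exact one_ne_zero) fun c => ?_
    have h1 := ha _ (contDiff_component h.smooth c)
    beta_reduce at h1
    rw [hLG c] at h1
    have h2 := hlin c
    rw [← Fin.sum_univ_eq_sum_range (fun j => a j * iteratedDeriv j (fun y => G y c) x)] at h1
    refine h1.symm.trans ?_
    rw [Fin.sum_univ_castSucc]
    simp only [Fin.snoc_castSucc, Fin.snoc_last, zero_mul, add_zero, mul_zero]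
    have h3 : ∑ j : Fin d, (opCoeff (envelopeLiftExpansion k G) x j.castSucc).snd / C *
        jet G x j.castSucc c = (∑ j : Fin d, (opCoeff (envelopeLiftExpansion k G) x j.castSucc).snd *
        iteratedDeriv j (fun y => G y c) x) / C := by
      rw [Finset.sum_div]
      exact Finset.sum_congr rfl fun j _ => div_mul_eq_mul_div _ _ _
    rw [h3, eq_div_iff hC0]
    simp only [iteratedDeriv_const, OfNat.ofNat_ne_zero, if_false]
    linarith
  refine Eq.trans ?_ (ha f hf).symm
  rw [← Fin.sum_univ_eq_sum_range (fun j => a j * iteratedDeriv j f x), Fin.sum_univ_castSucc]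
  have h1 : a (Fin.last d : Fin (d + 1)) = 0 := by
    have := congrFun hab (Fin.last d)
    simpa using this
  rw [h1, zero_mul, add_zero]
  refine Finset.sum_congr rfl fun j _ => ?_
  have := congrFun hab j.castSucc
  simp only [Fin.snoc_castSucc] at this
  beta_reduce
  rw [← this]
  rfl

theorem isContinuousLimit {J : Fin (d - 1) → ℕ} (h : NormalizedData (centeredSeq J) G M)
    (hd : 2 ≤ d) {m : ℕ} (hm : 0 < m) :
    IsContinuousLimit (fun _ => m) J G (fun j x => opCoeff G x j.castSucc) fun j x =>
      nodeCoeff (centeredSeq J) ⟨d - 2, by omega⟩ *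
        ((opCoeff (envelopeLiftExpansion (centeredSeq J) G) x j.castSucc).snd /
          nodeCoeff (centeredSeq J) ⟨d - 2, by omega⟩) := by
  have hE := h.expandsV_envelopeLift
  refine ⟨⟨m, hm, fun _ => rfl⟩, applyOp_opCoeff h.smooth h.det_jet,
    ⟨_, h.isEnvelopeFamily_envelopeLift⟩, fun Z hZ => ?_⟩
  have heq := h.eventually_eq_envelopeLift hZ
  refine ⟨fun ε j x => opCoeff (Z ε) x j.castSucc, ?_, fun j => ?_⟩
  · filter_upwards [heq, hE.smooth, h.eventually_det_jet_envelopeLift,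
      h.eventually_envelopeLift_quasiPeriodic,
      eventually_all.2 fun j => (hE.opCoeff j).smooth] with ε h1 h2 h3 h4 h5
    rw [h1]
    exact ⟨fun j => ⟨h5 _, fun x => congrFun (opCoeff_periodic h2 h3 h4 x) _⟩,
      applyOp_opCoeff h2 h3⟩
  · have h1 := ((hE.opCoeff j.castSucc).congr (g := fun ε x => opCoeff (Z ε) x j.castSucc)
      (heq.mono fun ε hε => by rw [hε])).hasSecondOrderExpansion
    have hC0 : nodeCoeff (centeredSeq J) ⟨d - 2, by omega⟩ ≠ 0 :=
      nodeCoeff_ne_zero h.injective h.sum_eq_zero (by simp; omega)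
    simp only [hE.fst_opCoeff, h.fst_envelopeLiftExpansion] at h1
    simpa only [mul_div_cancel₀ _ hC0] using h1

theorem hasSecondOrderExpansion (h : NormalizedData k G M) (hd : 2 ≤ d)
    {Z : ℝ → ℝ → Fin (d + 1) → ℝ} (hZ : IsEnvelopeFamily k G Z) :
    HasSecondOrderExpansion Z G fun x => nodeCoeff k ⟨d - 2, by omega⟩ •
      (iteratedDeriv 2 G x +
        (2 / ((d : ℝ) + 1) * opCoeff G x (Fin.castSucc ⟨d - 1, pred_lt_of_two_le hd⟩)) • G x) := by
  have h1 := (h.expandsV_envelopeLift.congr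
    ((h.eventually_eq_envelopeLift hZ).mono fun ε hε => hε.symm)).hasSecondOrderExpansion
  simp only [h.fst_envelopeLiftExpansion] at h1
  convert h1 using 1
  funext x c
  rw [Pi.smul_apply, Pi.add_apply, Pi.smul_apply, iteratedDeriv_apply h.smooth, smul_eq_mul,
    smul_eq_mul]
  exact (h.secondOrderTerm_eq hd x c).symm

end NormalizedData

theorem centeredSeq_injective {J : Fin (d - 1) → ℕ} (hJ : ∀ l, 0 < J l) :
    Function.Injective (centeredSeq J) := by
  have hmono : StrictMono (jumpSeq J) := by
    intro a b hab
    have hab' : (a : ℕ) < b := hab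
    refine Finset.sum_lt_sum_of_subset (i := ⟨a, by omega⟩) ?_ ?_ ?_ (hJ _) fun _ _ _ => Nat.zero_le _
    · intro i
      simp only [Finset.mem_filter, Finset.mem_univ, true_and]
      omega
    · simpa using hab'
    · simp
  intro a b hab
  have h1 : (jumpSeq J a : ℝ) = jumpSeq J b := by
    simp only [centeredSeq] at hab
    linarith
  exact hmono.injective (by exact_mod_cast h1)

theorem sum_centeredSeq (hd : 0 < d) (J : Fin (d - 1) → ℕ) : ∑ l : Fin d, centeredSeq J l = 0 := by
  have hd' : (d : ℝ) ≠ 0 := by positivity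
  simp only [centeredSeq, Finset.sum_sub_distrib, Finset.sum_const, Finset.card_univ,
    Fintype.card_fin, nsmul_eq_mul]
  rw [mul_div_cancel₀ _ hd', sub_self]

theorem IsNormalizedLift.exists_normalizedData (hd : 0 < d) {J : Fin (d - 1) → ℕ}
    (hJ : ∀ l, 0 < J l) {G : ℝ → Fin (d + 1) → ℝ} (hG : IsNormalizedLift G) :
    ∃ M, NormalizedData (centeredSeq J) G M := by
  obtain ⟨M, hM⟩ := hG.quasiPeriodic
  exact ⟨M.1, centeredSeq_injective hJ, sum_centeredSeq hd J, hG.smooth,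
    fun x => by rw [← wronskianDet_eq hG.smooth, hG.wronskian], M.2, hM⟩

end Flow

/-! ### Assembly of the three claims -/

theorem theorem4p2 (d : ℕ) (hd : 2 ≤ d) :
    -- the continuous limit of `T_{I,J}`, `I = m (1, …, 1)`, is the `(2, d+1)`-KdV flow
    (∀ (m : ℕ) (J : Fin (d - 1) → ℕ), 0 < m → (∀ l, 0 < J l) →
      ∃ C : ℝ, C ≠ 0 ∧
        ∀ G : ℝ → Fin (d + 1) → ℝ, IsNormalizedLift G →
          ∃ u v : Fin d → ℝ → ℝ,
            IsCircleCoeffs u ∧ IsCircleCoeffs v ∧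
            IsKdVVelocity 2 u v ∧
            IsContinuousLimit (fun _ => m) J G u (fun j x => C * v j x) ∧
            ∀ Z, IsEnvelopeFamily (centeredSeq J) G Z →
              HasSecondOrderExpansion Z G (fun x =>
                C • (iteratedDeriv 2 G x +
                  (2 / ((d : ℝ) + 1) * u ⟨d - 1, by omega⟩ x) • G x))) ∧
    -- the inverse of every long-diagonal map is such a map, up to a shift of indices
    (∀ (m : ℕ) (b₁ b₂ : ℤ) (n₁ n₂ : ℕ), 0 < m → 0 < n₁ → 0 < n₂ →
      (arithProg b₁ m n₁ ∪ arithProg b₂ m n₂).card = d → n₁ + n₂ = d →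
      (∀ (a : ℤ) (n : ℕ), arithProg b₁ m n₁ ∪ arithProg b₂ m n₂ ≠ arithProg a m n) →
      ∃ (J : Fin (d - 1) → ℕ) (c s : ℤ), (∀ l, 0 < J l) ∧
        jumpSet J = (arithProg b₁ m n₁ ∪ arithProg b₂ m n₂).image (fun b => c - b) ∧
        ∀ v w : ProjPolygon d,
          PentagramDefined (arithProg 0 m d) (arithProg b₁ m n₁ ∪ arithProg b₂ m n₂) v →
          PentagramDefined (jumpSet J) (jumpSet (d := d) fun _ => m) w →
          (IsPentagramImage (arithProg 0 m d) (arithProg b₁ m n₁ ∪ arithProg b₂ m n₂) v w ↔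
            IsPentagramImage (jumpSet J) (jumpSet (d := d) fun _ => m) w
              (fun k => v (k + s)))) ∧
    -- and so is the inverse of every bi-diagonal map
    (∀ (m : ℕ) (a₁ a₂ : ℤ) (n₁ n₂ : ℕ), 0 < m → 2 ≤ n₁ → 2 ≤ n₂ → n₁ + n₂ = d + 2 →
      Disjoint (arithProg a₁ m n₁) (arithProg a₂ m n₂) →
      ∃ (J : Fin (d - 1) → ℕ) (s : ℤ), (∀ l, 0 < J l) ∧
        ∀ v w : ProjPolygon d,
          BidiagonalDefined (arithProg a₁ m n₁) (arithProg a₂ m n₂) v →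
          PentagramDefined (jumpSet J) (jumpSet (d := d) fun _ => m) w →
          (IsBidiagonalImage (arithProg a₁ m n₁) (arithProg a₂ m n₂) v w ↔
            IsPentagramImage (jumpSet J) (jumpSet (d := d) fun _ => m) w
              (fun k => v (k + s)))) := by
  refine ⟨fun m J hm hJ => ?_, fun m b₁ b₂ n₁ n₂ _ _ _ hcard _ _ => ?_,
    fun m a₁ a₂ n₁ n₂ hm h₁ h₂ hn hdisj => ?_⟩
  · refine ⟨nodeCoeff (centeredSeq J) ⟨d - 2, by omega⟩,
      nodeCoeff_ne_zero (centeredSeq_injective hJ) (sum_centeredSeq (by omega) J)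
        (by simp; omega), fun G hG => ?_⟩
    obtain ⟨M, h⟩ := hG.exists_normalizedData (by omega) hJ
    exact ⟨_, _, h.isCircleCoeffs_opCoeff, h.isCircleCoeffs_velocity _, h.isKdVVelocity hd,
      h.isContinuousLimit hd hm, fun Z hZ => h.hasSecondOrderExpansion hd hZ⟩
  · obtain ⟨J, c, hJ, hJc⟩ := exists_jumpSet_eq_image (by omega) _ hcard
    refine ⟨J, c, c + m * ((d : ℤ) - 1), hJ, hJc, fun v w hv hw => ?_⟩
    rw [jumpSet_const] at hw ⊢
    exact longDiagonal_inverse hJc hv hw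
  -- The `n₂ - 1` hyperplanes through the first diagonal and the `n₁ - 1` through the second play
  -- the role of `B`.
  · have hcard : (arithProg (a₁ - m * (n₂ - 2 : ℕ)) m (n₂ - 1) ∪
        arithProg (a₂ - m * (n₁ - 2 : ℕ)) m (n₁ - 1)).card = d := by
      rw [Finset.card_union_of_disjoint (disjoint_hyperplane_indices hm h₁ h₂ hdisj),
        card_arithProg hm, card_arithProg hm]
      omega
    obtain ⟨J, c, hJ, hJc⟩ := exists_jumpSet_eq_image (by omega) _ hcard
    refine ⟨J, c + m * ((d : ℤ) - 1), hJ, fun v w hv hw => ?_⟩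
    rw [jumpSet_const] at hw ⊢
    exact bidiagonal_inverse hm h₁ h₂ hn hJc hv hw
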